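/- Let $k\ge 1$ and let $\mu$ be a self-similar Borel probability measure on $\mathbb{R}^k$: there are $N>1$ similarities $f_i(x)=r_iO_ix+t_i$ ($0<r_i<1$, $O_i\in O(k)$, $t_i\in\mathbb{R}^k$) without a common fixed point, and weights $w_i\in(0,1)$ with $\sum_i w_i=1$, such that $\mu=\sum_i w_i\,(f_i)_*\mu$ and $\mu$ is carried by the attractor of $\{f_i\}$. Assume that $\mu$ is non-expanding, i.e. the maps can be chosen so that for every $\varepsilon>0$ the number of distinct products $O_{i_1}\cdots O_{i_n}$ is $\ll_\varepsilon e^{\varepsilon n}$. Write $\widehat\mu(\xi)=\int e^{-2\pi i\langle\xi,x\rangle}\,d\mu(x)$ and define - the Fourier $l^p$ dimension $\kappa_p=\sup\{0\le s<k:\int_{B(0,R)}|\widehat\mu(\xi)|^p\,d\xi\ll R^{k-s}\}$; - for $1<q<\infty$ the $L^q$ dimension $d_q=\liminf_{n\to\infty}\frac{-\log_2\sum_{D\in\mathcal D_n}\mu(D)^q}{n(q-1)}$, where $\mathcal D_n$ is the set of half-open dyadic cubes of sidelength $2^{-n}$; - the Frostman exponent $d_\infty=\sup\{s\ge0:\mu(B_r(x))\ll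 r^s \text{ uniformly in } x\in\mathbb{R}^k,\ r>0\}$; - $\kappa_*$, the Assouad dimension of $\operatorname{supp}(\mu)$. Suppose that $\kappa_2>k/2$. Let $f:\mathbb{R}^k\to\mathbb{R}$ be $C^2$ and such that its graph has non-vanishing Gaussian curvature at $(x,f(x))$ for every $x\in\operatorname{supp}(\mu)$. For $1\le p\le2$ put $$\sigma_p=\frac{d_{p/(p-1)}+\kappa_p-k}{2p-k+2\kappa_*+\kappa_p-d_{p/(p-1)}},$$ where $d_{p/(p-1)}$ means $d_\infty$ when $p=1$. Then the maximum $$\sigma_{\max}=\max\{\sigma_p:\ 1\le p\le 2,\ d_{p/(p-1)}+\kappa_p>k\}$$ exists, and for every $0<\sigma<\sigma_{\max}$ there is a constant $C$ such that the pushforward $\mu_f$ of $\mu$ under $f$ satisfies $|\widehat{\mu_f}(\xi)|\le C|\xi|^{-\sigma}$ for all $\xi\in\mathbb{R}\setminus\{0\}$. -/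

import Mathlib

open MeasureTheory Filter Topology Set

noncomputable section

namespace FourierImage

/-- Euclidean space of dimension `k`. -/
abbrev Euc (k : ℕ) : Type := EuclideanSpace ℝ (Fin k)

/-! ### Fourier transforms of measures -/

/-- The Fourier transform `ξ ↦ ∫ exp (-2πi⟨ξ, x⟩) dμ(x)` of a measure. -/
def fourierTransform {E : Type*} [NormedAddCommGroup E] [InnerProductSpace ℝ E]
    [MeasurableSpace E] (μ : Measure E) (ξ : E) : ℂ :=
  ∫ x, Complex.exp (-2 * Real.pi * Complex.I * ((inner ℝ ξ x : ℝ) : ℂ)) ∂μ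

/-- The Fourier `l^p` dimension `κ_p`: the supremum of all `0 ≤ s < k` such that
`∫_{B(0,R)} |μ̂|^p ≪ R^(k-s)`. -/
def fourierLpDim {k : ℕ} (μ : Measure (Euc k)) (p : ℝ) : ℝ :=
  sSup {s : ℝ | 0 ≤ s ∧ s < k ∧ ∃ C : ℝ, ∀ R : ℝ, 0 < R →
    ∫ ξ in Metric.ball (0 : Euc k) R, ‖fourierTransform μ ξ‖ ^ p ≤ C * R ^ ((k : ℝ) - s)}

/-! ### `L^q` dimensions and the Frostman exponent -/

/-- The half-open dyadic cube of sidelength `2^(-n)` with lower corner `2^(-n) m`. -/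
def dyadicCube {k : ℕ} (n : ℕ) (m : Fin k → ℤ) : Set (Euc k) :=
  {x | ∀ i, (m i : ℝ) / 2 ^ n ≤ x i ∧ x i < ((m i : ℝ) + 1) / 2 ^ n}

/-- The `L^q` dimension `d_q`, for `1 < q < ∞` (logarithms to base `2`). -/
def lqDim {k : ℕ} (μ : Measure (Euc k)) (q : ℝ) : ℝ :=
  liminf (fun n : ℕ =>
    -Real.logb 2 (∑' m : Fin k → ℤ, μ.real (dyadicCube n m) ^ q) / ((n : ℝ) * (q - 1))) atTop

/-- The Frostman exponent `d_∞`: the supremum of all `s ≥ 0` such that `μ (B_r(x)) ≪ r^s`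
uniformly in `x` and `r > 0`. -/
def frostmanExponent {k : ℕ} (μ : Measure (Euc k)) : ℝ :=
  sSup {s : ℝ | 0 ≤ s ∧ ∃ C : ℝ, ∀ (x : Euc k) (r : ℝ), 0 < r →
    μ.real (Metric.ball x r) ≤ C * r ^ s}

/-- `d_{p/(p-1)}`, which means the Frostman exponent when `p = 1`. -/
def conjugateDim {k : ℕ} (μ : Measure (Euc k)) (p : ℝ) : ℝ :=
  if p = 1 then frostmanExponent μ else lqDim μ (p / (p - 1))

/-! ### Assouad dimension -/

/-- The smallest number of open balls of diameter `δ` needed to cover the (bounded) set `A`. -/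
def coveringNumber {k : ℕ} (δ : ℝ) (A : Set (Euc k)) : ℕ :=
  sInf {n : ℕ | ∃ t : Finset (Euc k), t.card = n ∧ A ⊆ ⋃ y ∈ t, Metric.ball y (δ / 2)}

/-- The Assouad dimension of a set. -/
def assouadDim {k : ℕ} (A : Set (Euc k)) : ℝ :=
  sInf {α : ℝ | 0 ≤ α ∧ ∃ C : ℝ, 0 < C ∧ ∀ r R : ℝ, 0 < r → r < R → ∀ x ∈ A,
    (coveringNumber r (Metric.ball x R ∩ A) : ℝ) ≤ C * (R / r) ^ α}

/-! ### Self-similar measures -/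

/-- A self-similar iterated function system on `ℝ^k`: `N > 1` contracting similarities
`x ↦ r_i O_i x + t_i` without a common fixed point. -/
structure SelfSimilarIFS (k : ℕ) where
  /-- number of maps -/
  N : ℕ
  one_lt_N : 1 < N
  /-- contraction ratios -/
  ratio : Fin N → ℝ
  ratio_pos : ∀ i, 0 < ratio i
  ratio_lt_one : ∀ i, ratio i < 1
  /-- orthogonal parts -/
  rot : Fin N → (Euc k ≃ₗᵢ[ℝ] Euc k)
  /-- translation parts -/
  trans : Fin N → Euc k
  no_common_fixed_point : ¬ ∃ x, ∀ i, ratio i • rot i x + trans i = x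

/-- The `i`-th similarity of the system. -/
def SelfSimilarIFS.map {k : ℕ} (Φ : SelfSimilarIFS k) (i : Fin Φ.N) (x : Euc k) : Euc k :=
  Φ.ratio i • Φ.rot i x + Φ.trans i

/-- `K` is the attractor of the system. -/
def SelfSimilarIFS.IsAttractor {k : ℕ} (Φ : SelfSimilarIFS k) (K : Set (Euc k)) : Prop :=
  IsCompact K ∧ K.Nonempty ∧ K = ⋃ i, Φ.map i '' K

/-- `μ` is the Borel probability measure carried by the attractor of the system which satisfies
`μ = ∑ p_i f_i(μ)` for some weights `p_i ∈ (0,1)` of sum one. -/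
def SelfSimilarIFS.IsStationary {k : ℕ} (Φ : SelfSimilarIFS k) (μ : Measure (Euc k)) : Prop :=
  IsProbabilityMeasure μ ∧ (∃ K, Φ.IsAttractor K ∧ μ Kᶜ = 0) ∧
    ∃ w : Fin Φ.N → ℝ, (∀ i, 0 < w i ∧ w i < 1) ∧ ∑ i, w i = 1 ∧
      μ = ∑ i, ENNReal.ofReal (w i) • μ.map (Φ.map i)

/-- The set of all products `g_1 ⋯ g_n` with every `g_j` in `F`. -/
def products {G : Type*} [Group G] (F : Set G) (n : ℕ) : Set G :=
  {g | ∃ w : Fin n → G, (∀ j, w j ∈ F) ∧ (List.ofFn w).prod = g}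

/-- A finite subset of a group is non-expanding if the number of products of length `n` of its
elements grows subexponentially in `n`. -/
def NonExpanding {G : Type*} [Group G] (F : Set G) : Prop :=
  ∀ ε : ℝ, 0 < ε → ∃ C : ℝ, ∀ n : ℕ, ((products F n).ncard : ℝ) ≤ C * Real.exp (ε * n)

/-- `μ` is a non-expanding self-similar measure: it is the stationary measure of a self-similar
system whose orthogonal parts form a non-expanding set. -/
def IsNonExpandingSelfSimilar {k : ℕ} (μ : Measure (Euc k)) : Prop :=
  ∃ Φ : SelfSimilarIFS k, Φ.IsStationary μ ∧ NonExpanding (Set.range Φ.rot)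

/-! ### Gaussian curvature of a graph -/

/-- The point `(v, t)` of `ℝ^(k+1)`. -/
def snoc {k : ℕ} (v : Euc k) (t : ℝ) : Euc (k + 1) :=
  WithLp.toLp 2 (Fin.snoc (α := fun _ => ℝ) (fun i => v i) t)

/-- The parametrisation `x ↦ (x, f x)` of the graph of `f`. -/
def graphMap {k : ℕ} (f : Euc k → ℝ) (x : Euc k) : Euc (k + 1) :=
  snoc x (f x)

/-- The upward unit normal to the graph of `f` at `(x, f x)`. -/
def unitNormal {k : ℕ} (f : Euc k → ℝ) (x : Euc k) : Euc (k + 1) :=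
  (Real.sqrt (1 + ‖gradient f x‖ ^ 2))⁻¹ • snoc (-gradient f x) 1

/-- The Gram matrix of the basis `∂_i (x, f x)` of the tangent space at `(x, f x)`. -/
def firstForm {k : ℕ} (f : Euc k → ℝ) (x : Euc k) : Matrix (Fin k) (Fin k) ℝ :=
  Matrix.of fun i j => inner ℝ (fderiv ℝ (graphMap f) x (EuclideanSpace.single i 1))
    (fderiv ℝ (graphMap f) x (EuclideanSpace.single j 1))

/-- The matrix of the bilinear form `(v, w) ↦ ⟨S v, w⟩` in the same basis, where the shape
operator `S` is the differential of the unit normal. -/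
def secondForm {k : ℕ} (f : Euc k → ℝ) (x : Euc k) : Matrix (Fin k) (Fin k) ℝ :=
  Matrix.of fun i j => inner ℝ (fderiv ℝ (unitNormal f) x (EuclideanSpace.single i 1))
    (fderiv ℝ (graphMap f) x (EuclideanSpace.single j 1))

/-- The Gaussian curvature of the graph of `f` at `(x, f x)`: the determinant of the shape
operator on the tangent space. -/
def gaussianCurvature {k : ℕ} (f : Euc k → ℝ) (x : Euc k) : ℝ :=
  (secondForm f x).det / (firstForm f x).det

/-! ### The decay exponents -/

/-- The exponent `σ_p`. -/
def decayExponent {k : ℕ} (μ : Measure (Euc k)) (p : ℝ) : ℝ :=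
  (conjugateDim μ p + fourierLpDim μ p - k) /
    (2 * p - k + 2 * assouadDim μ.support + fourierLpDim μ p - conjugateDim μ p)

/-- The values of `p ∈ [1,2]` for which the numerator of `σ_p` is positive. -/
def admissibleExponents {k : ℕ} (μ : Measure (Euc k)) : Set ℝ :=
  {p | p ∈ Set.Icc (1 : ℝ) 2 ∧ (k : ℝ) < conjugateDim μ p + fourierLpDim μ p}

end FourierImage

end

/-! Write `N = d_{p/(p-1)} + κ_p - k`. Iterating stationarity makes μ a convex combination of copies
of itself of ratio about `δ = |ξ|^(-(1+σ)/2)`. On such a copy, of ratio `r` and rotation `O`,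
replacing `f` by its first-order Taylor polynomial costs `|ξ| δ² = |ξ|^(-σ)`. What remains is, up to
a unimodular factor, μ̂ at `ξ r O⁻¹∇f(y)`, where `y` may be any point of the piece. One averages
over `y` with respect to the piece itself (`norm_integral_wordMap_le`) and reassembles the pieces
into μ. Non-expansion leaves only about `δ^(-ε)` pairs `(r, O)` (`exists_decomposition`), so
everything reduces to the decay of `∫ |μ̂(ρ O ∇f(y))| dμ(y)` for `|ρ| ≳ |ξ|^((1-σ)/2)`.

That decay is `exists_integral_norm_fourierTransform_le`. Non-vanishing curvature makes `∇f` locally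
anti-Lipschitz on the support. Cut the support into dyadic cubes of side about `1/|ρ|`. Hölder's
inequality separates `∑ μ(D)^q`, governed by `d_q`, from `∑ |μ̂(η_D)|^p`, where boundedly many
frequencies `η_D` lie in any unit ball. As μ has compact support, μ̂ is essentially constant at unit
scale, so the second sum is nearly `∫ |μ̂|^p` over a ball of radius `≲ |ρ|`, governed by `κ_p`. The
outcome is a bound `|ρ|^(-a)` for every `a < N/p`.

Balancing the two errors permits every `σ < N/(2p+N)`. The denominator of `σ_p` equals `N + 2p +
2(κ_* - d_{p/(p-1)})`, and `d_{p/(p-1)} ≤ κ_*`, so `σ_p ≤ N/(2p+N)`; the Assouad dimension enters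
only through this comparison.

The maximum exists because `d_{p/(p-1)}` and `κ_p` are nondecreasing in `p` while their quotients by
`p` are nonincreasing; hence both are continuous on `[1,2]`. The exponent `p = 2` is admissible
because `κ_2 ≤ d_2`. Continuity also replaces `p = 1` by a nearby `p > 1`, where Hölder's inequality
is available. -/

namespace FourierImage

/-! ### Dyadic cubes -/

/-- The index of the dyadic cube of level `n` that contains `x`. -/
noncomputable def dyadicIndex {k : ℕ} (n : ℕ) (x : Euc k) : Fin k → ℤ := fun i => ⌊2 ^ n * x i⌋

theorem mem_dyadicCube_iff {k : ℕ} {n : ℕ} {m : Fin k → ℤ} {x : Euc k} :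
    x ∈ dyadicCube n m ↔ dyadicIndex n x = m := by
  have h2 : (0 : ℝ) < 2 ^ n := by positivity
  simp only [dyadicCube, dyadicIndex, mem_ofPred_eq, funext_iff, Int.floor_eq_iff]
  refine forall_congr' fun i => ?_
  rw [div_le_iff₀ h2, lt_div_iff₀ h2, mul_comm]

theorem measurableSet_dyadicCube {k : ℕ} (n : ℕ) (m : Fin k → ℤ) :
    MeasurableSet (dyadicCube n m) := by
  have : dyadicCube n m = ⋂ i, {x : Euc k | (m i : ℝ) / 2 ^ n ≤ x i ∧ x i < ((m i : ℝ) + 1) / 2 ^ n} := by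
    ext x; simp [dyadicCube]
  rw [this]
  refine MeasurableSet.iInter fun i => ?_
  have hm : Measurable fun x : Euc k => x i := by fun_prop
  exact (measurableSet_le measurable_const hm).inter (measurableSet_lt hm measurable_const)

theorem pairwise_disjoint_dyadicCube {k : ℕ} (n : ℕ) :
    Pairwise (Function.onFun Disjoint (dyadicCube (k := k) n)) := by
  intro a b hab
  refine Set.disjoint_left.2 fun x ha hb => hab ?_
  rw [mem_dyadicCube_iff] at ha hb
  exact ha.symm.trans hb

theorem iUnion_dyadicCube {k : ℕ} (n : ℕ) : (⋃ m, dyadicCube (k := k) n m) = univ :=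
  eq_univ_of_forall fun x => mem_iUnion.2 ⟨dyadicIndex n x, mem_dyadicCube_iff.2 rfl⟩

theorem hasSum_dyadicCube {k : ℕ} (μ : Measure (Euc k)) [IsProbabilityMeasure μ] (n : ℕ) :
    HasSum (fun m : Fin k → ℤ => μ.real (dyadicCube n m)) 1 := by
  have h : HasSum (fun m : Fin k → ℤ => μ.real (dyadicCube n m))
      (μ.real (⋃ m, dyadicCube (k := k) n m)) := by
    have h1 := measure_iUnion (μ := μ) (pairwise_disjoint_dyadicCube (k := k) n)
      (measurableSet_dyadicCube n)
    have h2 : ∑' m : Fin k → ℤ, μ (dyadicCube n m) ≠ ⊤ := by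
      rw [← h1]; exact measure_ne_top _ _
    have h3 := (ENNReal.summable_toReal h2).hasSum
    rw [← ENNReal.tsum_toReal_eq (fun m => measure_ne_top _ _), ← h1] at h3
    exact h3
  simpa [iUnion_dyadicCube] using h

/-- A finite set of indices that contains those of all cubes of level `n` meeting the closed ball
of radius `r` about `x`. -/
noncomputable def cubesNear {k : ℕ} (n : ℕ) (x : Euc k) (r : ℝ) : Finset (Fin k → ℤ) :=
  Fintype.piFinset fun i => Finset.Icc ⌊2 ^ n * (x i - r)⌋ ⌊2 ^ n * (x i + r)⌋

theorem abs_apply_le_norm {k : ℕ} (x : Euc k) (i : Fin k) : |x i| ≤ ‖x‖ := by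
  simpa using PiLp.norm_apply_le x i

theorem dyadicIndex_mem_cubesNear {k : ℕ} {n : ℕ} {x y : Euc k} {r : ℝ} (h : dist y x ≤ r) :
    dyadicIndex n y ∈ cubesNear n x r := by
  refine Fintype.mem_piFinset.2 fun i => ?_
  have h1 := abs_apply_le_norm (y - x) i
  rw [← dist_eq_norm] at h1
  have h2 := abs_le.1 (h1.trans h)
  simp only [PiLp.sub_apply] at h2
  refine Finset.mem_Icc.2 ⟨Int.floor_le_floor ?_, Int.floor_le_floor ?_⟩ <;>
  · apply mul_le_mul_of_nonneg_left _ (by positivity)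
    linarith [h2.1, h2.2]

theorem card_cubesNear_le {k : ℕ} (n : ℕ) (x : Euc k) {r : ℝ} (hr : 0 ≤ r) :
    ((cubesNear n x r).card : ℝ) ≤ (2 * (2 ^ n * r) + 2) ^ k := by
  rw [cubesNear, Fintype.card_piFinset]
  push_cast
  have : ∀ i ∈ (Finset.univ : Finset (Fin k)),
      ((Finset.Icc ⌊(2 : ℝ) ^ n * (x i - r)⌋ ⌊(2 : ℝ) ^ n * (x i + r)⌋).card : ℝ)
        ≤ 2 * (2 ^ n * r) + 2 := by
    intro i _
    have hle : ⌊(2 : ℝ) ^ n * (x i - r)⌋ ≤ ⌊(2 : ℝ) ^ n * (x i + r)⌋ :=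
      Int.floor_le_floor (mul_le_mul_of_nonneg_left (by linarith) (by positivity))
    rw [Int.card_Icc]
    have h0 : (0 : ℤ) ≤ ⌊(2 : ℝ) ^ n * (x i + r)⌋ + 1 - ⌊(2 : ℝ) ^ n * (x i - r)⌋ := by omega
    have h1 : (((⌊(2 : ℝ) ^ n * (x i + r)⌋ + 1 - ⌊(2 : ℝ) ^ n * (x i - r)⌋).toNat : ℤ) : ℝ)
        = ⌊(2 : ℝ) ^ n * (x i + r)⌋ + 1 - ⌊(2 : ℝ) ^ n * (x i - r)⌋ := by
      rw [Int.toNat_of_nonneg h0]; push_cast; ring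
    rw [Int.cast_natCast] at h1
    rw [h1]
    have h2 := Int.floor_le ((2 : ℝ) ^ n * (x i + r))
    have h3 := Int.lt_floor_add_one ((2 : ℝ) ^ n * (x i - r))
    nlinarith
  refine (Finset.prod_le_prod (fun i _ => by positivity) this).trans ?_
  simp

theorem dist_le_of_dyadicIndex_eq {k : ℕ} {n : ℕ} {x y : Euc k}
    (h : dyadicIndex n x = dyadicIndex n y) : dist x y ≤ Real.sqrt k / 2 ^ n := by
  rw [EuclideanSpace.dist_eq]
  have h2 : (0 : ℝ) < 2 ^ n := by positivity
  have : ∑ i, dist (x i) (y i) ^ 2 ≤ k * (1 / 2 ^ n) ^ 2 := by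
    have : ∀ i ∈ (Finset.univ : Finset (Fin k)), dist (x i) (y i) ^ 2 ≤ (1 / 2 ^ n : ℝ) ^ 2 := by
      intro i _
      refine pow_le_pow_left₀ dist_nonneg ?_ 2
      have h3 : ⌊2 ^ n * x i⌋ = ⌊2 ^ n * y i⌋ := congrFun h i
      have h4 := Int.abs_sub_lt_one_of_floor_eq_floor h3
      rw [← mul_sub, abs_mul, abs_of_pos h2] at h4
      rw [Real.dist_eq, le_div_iff₀ h2]
      linarith
    simpa using Finset.sum_le_sum this
  calc Real.sqrt (∑ i, dist (x i) (y i) ^ 2) ≤ Real.sqrt (k * (1 / 2 ^ n) ^ 2) :=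
        Real.sqrt_le_sqrt this
    _ = Real.sqrt k / 2 ^ n := by
        rw [Real.sqrt_mul (by positivity), Real.sqrt_sq (by positivity)]; ring

theorem measureReal_ball_le_sum {k : ℕ} (μ : Measure (Euc k)) [IsProbabilityMeasure μ] (n : ℕ)
    (x : Euc k) (r : ℝ) :
    μ.real (Metric.ball x r) ≤ ∑ m ∈ cubesNear n x r, μ.real (dyadicCube n m) := by
  refine (measureReal_mono ?_ (measure_ne_top _ _)).trans
    (measureReal_biUnion_finset_le (cubesNear n x r) (dyadicCube n))
  intro y hy
  exact mem_iUnion₂.2 ⟨dyadicIndex n y, dyadicIndex_mem_cubesNear (Metric.mem_ball.1 hy).le,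
    mem_dyadicCube_iff.2 rfl⟩

theorem dyadicCube_subset_ball {k : ℕ} {n : ℕ} {x : Euc k} {r : ℝ}
    (hr : Real.sqrt k / 2 ^ n < r) : dyadicCube n (dyadicIndex n x) ⊆ Metric.ball x r := fun _ hy =>
  (dist_le_of_dyadicIndex_eq (mem_dyadicCube_iff.1 hy)).trans_lt hr

/-! ### Covering numbers and the Assouad dimension -/

theorem exists_finset_cover_ball {k : ℕ} (x : Euc k) {r R : ℝ} (hr : 0 < r) (hR : r < R) :
    ∃ t : Finset (Euc k), Metric.ball x R ⊆ (⋃ y ∈ t, Metric.ball y (r / 2)) ∧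
      (t.card : ℝ) ≤ ((4 * (Real.sqrt k + 1) + 2) * (R / r)) ^ k := by
  classical
  set s := Real.sqrt k + 1 with hs
  have hs1 : 1 ≤ s := by have := Real.sqrt_nonneg (k : ℝ); linarith
  -- Scaled by `h`, a unit cube has diameter `h√k < hs = r/2`, so integer points scaled by `h` serve
  -- as centres.
  set h := r / (2 * s) with hh
  have h0 : 0 < h := by positivity
  have hR0 : 0 < R := hr.trans hR
  let pt : (Fin k → ℤ) → Euc k := fun m => WithLp.toLp 2 fun i => (m i : ℝ)
  have hpt : ∀ m, dyadicIndex 0 (pt m) = m := fun m => by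
    funext i; simp [dyadicIndex, pt]
  refine ⟨(cubesNear 0 (h⁻¹ • x) (h⁻¹ * R)).image fun m => h • pt m, fun z hz => ?_, ?_⟩
  · refine mem_iUnion₂.2 ⟨h • pt (dyadicIndex 0 (h⁻¹ • z)), Finset.mem_image.2
      ⟨_, dyadicIndex_mem_cubesNear ?_, rfl⟩, ?_⟩
    · rw [dist_smul₀, Real.norm_of_nonneg (by positivity)]
      exact mul_le_mul_of_nonneg_left (Metric.mem_ball.1 hz).le (by positivity)
    · have h1 : dist (h⁻¹ • z) (pt (dyadicIndex 0 (h⁻¹ • z))) ≤ Real.sqrt k / 2 ^ 0 :=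
        dist_le_of_dyadicIndex_eq (hpt _).symm
      have h2 : dist z (h • pt (dyadicIndex 0 (h⁻¹ • z))) =
          h * dist (h⁻¹ • z) (pt (dyadicIndex 0 (h⁻¹ • z))) := by
        conv_lhs => rw [← smul_inv_smul₀ h0.ne' z]
        rw [dist_smul₀, Real.norm_of_nonneg h0.le, smul_inv_smul₀ h0.ne']
      rw [Metric.mem_ball, h2]
      calc h * dist (h⁻¹ • z) (pt (dyadicIndex 0 (h⁻¹ • z))) ≤ h * Real.sqrt k :=
            mul_le_mul_of_nonneg_left (by simpa using h1) h0.le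
        _ < h * s := mul_lt_mul_of_pos_left (by linarith) h0
        _ = r / 2 := by rw [hh]; field_simp
  · refine (Nat.cast_le.2 Finset.card_image_le).trans
      ((card_cubesNear_le 0 _ (by positivity)).trans ?_)
    refine pow_le_pow_left₀ (by positivity) ?_ k
    have h1 : h⁻¹ * R = 2 * s * (R / r) := by rw [hh]; field_simp
    have h2 : 1 ≤ R / r := (one_le_div hr).2 hR.le
    rw [pow_zero, one_mul, h1]
    nlinarith

theorem exists_finset_card_eq_coveringNumber {k : ℕ} {A : Set (Euc k)} {x : Euc k} {r R : ℝ}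
    (hr : 0 < r) (hR : r < R) (hA : A ⊆ Metric.ball x R) :
    ∃ t : Finset (Euc k), t.card = coveringNumber r A ∧ A ⊆ ⋃ y ∈ t, Metric.ball y (r / 2) := by
  obtain ⟨t, ht, -⟩ := exists_finset_cover_ball x hr hR
  exact Nat.sInf_mem (s := {n : ℕ | ∃ t : Finset (Euc k), t.card = n ∧
    A ⊆ ⋃ y ∈ t, Metric.ball y (r / 2)}) ⟨t.card, t, rfl, hA.trans ht⟩

/-- `α` is an admissible exponent in the definition of the Assouad dimension of `A`. -/
def IsAssouadExponent {k : ℕ} (A : Set (Euc k)) (α : ℝ) : Prop :=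
  0 ≤ α ∧ ∃ C : ℝ, 0 < C ∧ ∀ r R : ℝ, 0 < r → r < R → ∀ x ∈ A,
    (coveringNumber r (Metric.ball x R ∩ A) : ℝ) ≤ C * (R / r) ^ α

/-- Keeps the infimum defining `assouadDim` from ranging over the empty set, and supplies a concrete
exponent wherever some polynomial lower bound on the moment sums suffices. -/
theorem isAssouadExponent_natCast {k : ℕ} (A : Set (Euc k)) : IsAssouadExponent A k := by
  refine ⟨Nat.cast_nonneg k, (4 * (Real.sqrt k + 1) + 2) ^ k, by positivity, ?_⟩
  intro r R hr hR x _
  obtain ⟨t, ht, hc⟩ := exists_finset_cover_ball x hr hR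
  have h1 : coveringNumber r (Metric.ball x R ∩ A) ≤ t.card :=
    Nat.sInf_le ⟨t, rfl, inter_subset_left.trans ht⟩
  rw [Real.rpow_natCast, ← mul_pow]
  exact (Nat.cast_le.2 h1).trans hc

/-! ### Moment sums over dyadic cubes -/

/-- The moment sum `∑ μ(D)^q` over the dyadic cubes `D` of level `n`. -/
noncomputable def cubeSum {k : ℕ} (μ : Measure (Euc k)) (n : ℕ) (q : ℝ) : ℝ :=
  ∑' m : Fin k → ℤ, μ.real (dyadicCube n m) ^ q

theorem cubeSum_nonneg {k : ℕ} (μ : Measure (Euc k)) (n : ℕ) (q : ℝ) : 0 ≤ cubeSum μ n q :=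
  tsum_nonneg fun _ => by positivity

theorem lqDim_eq {k : ℕ} (μ : Measure (Euc k)) (q : ℝ) : lqDim μ q =
    liminf (fun n : ℕ => -Real.logb 2 (cubeSum μ n q) / ((n : ℝ) * (q - 1))) atTop := rfl

section
variable {k : ℕ} (μ : Measure (Euc k)) [IsProbabilityMeasure μ]

theorem measureReal_rpow_le {q : ℝ} (hq : 1 ≤ q) (A : Set (Euc k)) : μ.real A ^ q ≤ μ.real A := by
  simpa using Real.rpow_le_rpow_of_exponent_ge' measureReal_nonneg measureReal_le_one zero_le_one hq

theorem summable_cubeSum (n : ℕ) {q : ℝ} (hq : 1 ≤ q) :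
    Summable fun m : Fin k → ℤ => μ.real (dyadicCube n m) ^ q :=
  Summable.of_nonneg_of_le (fun _ => by positivity) (fun _ => measureReal_rpow_le μ hq _)
    (hasSum_dyadicCube μ n).summable

theorem cubeSum_le_one (n : ℕ) {q : ℝ} (hq : 1 ≤ q) : cubeSum μ n q ≤ 1 := by
  rw [← (hasSum_dyadicCube μ n).tsum_eq]
  exact Summable.tsum_le_tsum (fun _ => measureReal_rpow_le μ hq _) (summable_cubeSum μ n hq)
    (hasSum_dyadicCube μ n).summable

/-- The support meets only about `2^(nα)` cubes of level `n`, and their masses add up to at least 1.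
By the power mean inequality the moment sum is least when the mass is spread evenly over them. -/
theorem exists_cubeSum_ge (hS : IsCompact μ.support) {α : ℝ} (hα : IsAssouadExponent μ.support α)
    {q : ℝ} (hq : 1 < q) :
    ∃ c : ℝ, 0 < c ∧ ∀ n : ℕ, c * 2 ^ (-(n * (q - 1) * α)) ≤ cubeSum μ n q := by
  classical
  obtain ⟨x, hx⟩ := Measure.nonempty_support (IsProbabilityMeasure.ne_zero μ)
  obtain ⟨R, hR1, hR⟩ : ∃ R : ℝ, 1 < R ∧ μ.support ⊆ Metric.ball x R := by
    obtain ⟨R, hR⟩ := hS.isBounded.subset_ball x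
    exact ⟨max R 2, by simp, hR.trans (Metric.ball_subset_ball (le_max_left _ _))⟩
  obtain ⟨-, C, hC, hcov⟩ := hα
  have hB : 0 < 3 ^ k * (C * R ^ α) := by positivity
  refine ⟨((3 ^ k * (C * R ^ α)) ^ (q - 1))⁻¹, by positivity, fun n => ?_⟩
  have h2 : (0 : ℝ) < 2 ^ n := by positivity
  have hr0 : (0 : ℝ) < 1 / 2 ^ n := by positivity
  have hrR : (1 : ℝ) / 2 ^ n < R := by
    refine lt_of_le_of_lt ?_ hR1
    rw [div_le_one h2]; exact one_le_pow₀ one_le_two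
  obtain ⟨t, ht, htc⟩ := exists_finset_card_eq_coveringNumber hr0 hrR
    (inter_subset_left : Metric.ball x R ∩ μ.support ⊆ Metric.ball x R)
  have hcard := hcov _ R hr0 hrR x hx
  rw [← ht] at hcard
  rw [inter_eq_self_of_subset_right hR] at htc
  set Z := t.biUnion fun y => cubesNear n y (1 / 2 ^ n / 2) with hZ
  have hZc : (Z.card : ℝ) ≤ 3 ^ k * (C * R ^ α) * 2 ^ (n * α) := by
    have h1 : (Z.card : ℝ) ≤ ∑ y ∈ t, ((cubesNear n y (1 / 2 ^ n / 2)).card : ℝ) := by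
      rw [← Nat.cast_sum]
      exact Nat.cast_le.2 Finset.card_biUnion_le
    have h3 : ∀ y ∈ t, ((cubesNear n y (1 / 2 ^ n / 2)).card : ℝ) ≤ 3 ^ k := by
      intro y _
      refine (card_cubesNear_le n y (by positivity)).trans (le_of_eq ?_)
      congr 1; field_simp; norm_num
    refine (h1.trans (Finset.sum_le_sum h3)).trans ?_
    rw [Finset.sum_const, nsmul_eq_mul]
    have h4 : (R / (1 / 2 ^ n)) ^ α = R ^ α * 2 ^ (n * α) := by
      rw [div_div_eq_mul_div, div_one, Real.mul_rpow (by linarith) h2.le, ← Real.rpow_natCast,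
        ← Real.rpow_mul zero_le_two]
    rw [h4] at hcard
    calc (t.card : ℝ) * 3 ^ k ≤ (C * (R ^ α * 2 ^ (n * α))) * 3 ^ k :=
          mul_le_mul_of_nonneg_right hcard (by positivity)
      _ = _ := by ring
  have hone : 1 ≤ ∑ m ∈ Z, μ.real (dyadicCube n m) := by
    have h1 : μ.real μ.support = 1 := by
      rw [measureReal_def, (prob_compl_eq_zero_iff₀ (Measure.isClosed_support).measurableSet.nullMeasurableSet).1
        Measure.measure_compl_support, ENNReal.toReal_one]
    rw [← h1]
    refine (measureReal_mono ?_ (measure_ne_top _ _)).trans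
      (measureReal_biUnion_finset_le Z (dyadicCube n))
    intro y hy
    obtain ⟨z, hz, hyz⟩ := mem_iUnion₂.1 (htc hy)
    exact mem_iUnion₂.2 ⟨dyadicIndex n y, Finset.mem_biUnion.2 ⟨z, hz,
      dyadicIndex_mem_cubesNear (Metric.mem_ball.1 hyz).le⟩, mem_dyadicCube_iff.2 rfl⟩
  have hpow : 1 ≤ (Z.card : ℝ) ^ (q - 1) * ∑ m ∈ Z, μ.real (dyadicCube n m) ^ q := by
    have := Real.rpow_sum_le_const_mul_sum_rpow Z (fun m => μ.real (dyadicCube n m)) hq.le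
    simp only [abs_of_nonneg measureReal_nonneg] at this
    exact (Real.one_le_rpow hone (by linarith)).trans this
  have hfin : ∑ m ∈ Z, μ.real (dyadicCube n m) ^ q ≤ cubeSum μ n q :=
    (summable_cubeSum μ n hq.le).sum_le_tsum _ fun _ _ => by positivity
  have hZq : (Z.card : ℝ) ^ (q - 1) ≤ (3 ^ k * (C * R ^ α)) ^ (q - 1) * 2 ^ (n * (q - 1) * α) := by
    refine (Real.rpow_le_rpow (by positivity) hZc (by linarith)).trans (le_of_eq ?_)
    rw [Real.mul_rpow hB.le (by positivity), ← Real.rpow_mul zero_le_two]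
    congr 2; ring
  rw [Real.rpow_neg zero_le_two, ← mul_inv, inv_le_iff_one_le_mul₀ (by positivity), mul_comm]
  refine hpow.trans (mul_le_mul hZq hfin ?_ (by positivity))
  exact Finset.sum_nonneg fun _ _ => by positivity

theorem cubeSum_pos (hS : IsCompact μ.support) (n : ℕ) {q : ℝ} (hq : 1 < q) :
    0 < cubeSum μ n q := by
  obtain ⟨c, hc, h⟩ := exists_cubeSum_ge μ hS (isAssouadExponent_natCast _) hq
  exact lt_of_lt_of_le (by positivity) (h n)

/-! ### The `L^q` dimension -/

/-- This bound and the next make the real-valued `liminf` in `lqDim` meaningful; without them it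
could take a default value. -/
theorem isBoundedUnder_ge_lqDim {q : ℝ} (hq : 1 < q) : IsBoundedUnder (· ≥ ·) atTop
    (fun n : ℕ => -Real.logb 2 (cubeSum μ n q) / ((n : ℝ) * (q - 1))) := by
  refine isBoundedUnder_of ⟨0, fun n => ?_⟩
  have h1 : Real.logb 2 (cubeSum μ n q) ≤ 0 :=
    Real.logb_nonpos one_lt_two (cubeSum_nonneg μ n q) (cubeSum_le_one μ n hq.le)
  exact div_nonneg (by linarith) (mul_nonneg (Nat.cast_nonneg n) (by linarith))

theorem isBoundedUnder_le_lqDim (hS : IsCompact μ.support) {q : ℝ} (hq : 1 < q) :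
    IsBoundedUnder (· ≤ ·) atTop
      (fun n : ℕ => -Real.logb 2 (cubeSum μ n q) / ((n : ℝ) * (q - 1))) := by
  obtain ⟨c, hc, h⟩ := exists_cubeSum_ge μ hS (isAssouadExponent_natCast _) hq
  refine isBoundedUnder_of_eventually_le (a := |Real.logb 2 c| / (q - 1) + k) ?_
  filter_upwards [eventually_ge_atTop 1] with n hn
  have hn1 : (1 : ℝ) ≤ n := by exact_mod_cast hn
  have hq1 : 0 < q - 1 := by linarith
  have h1 := Real.logb_le_logb_of_le one_lt_two (by positivity) (h n)
  rw [Real.logb_mul hc.ne' (by positivity), Real.logb_rpow two_pos (by norm_num)] at h1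
  rw [div_le_iff₀ (by positivity)]
  have h3 : |Real.logb 2 c| ≤ |Real.logb 2 c| * n := le_mul_of_one_le_right (abs_nonneg _) hn1
  have h4 : (|Real.logb 2 c| / (q - 1) + k) * (n * (q - 1)) =
      |Real.logb 2 c| * n + n * (q - 1) * k := by field_simp
  rw [h4]
  linarith [neg_abs_le (Real.logb 2 c)]

/-- With its converse `le_lqDim_of_cubeSum_le`, this trades the `liminf` for bounds valid at every
level, so later arguments never return to logarithms. -/
theorem exists_cubeSum_le_of_lt_lqDim {q t : ℝ} (hq : 1 < q) (ht : t < lqDim μ q) :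
    ∃ C : ℝ, 0 < C ∧ ∀ n : ℕ, cubeSum μ n q ≤ C * 2 ^ (-(n * (q - 1) * t)) := by
  rw [lqDim_eq] at ht
  have hev := eventually_lt_of_lt_liminf ht (isBoundedUnder_ge_lqDim μ hq)
  obtain ⟨n₀, hn₀⟩ := eventually_atTop.1 hev
  have hq1 : 0 < q - 1 := by linarith
  -- Absorbs the initial levels, where only `cubeSum ≤ 1` is known. Including `n₀` makes every
  -- remaining level positive, so the division by `n` is harmless.
  set C := ∑ n ∈ Finset.range (n₀ + 1), (2 : ℝ) ^ ((n : ℝ) * (q - 1) * t) with hC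
  have hC0 : 0 < C := Finset.sum_pos (fun _ _ => by positivity) ⟨0, by simp⟩
  refine ⟨1 + C, by linarith, fun n => ?_⟩
  rcases lt_or_ge n (n₀ + 1) with hn | hn
  · have h1 : (2 : ℝ) ^ ((n : ℝ) * (q - 1) * t) ≤ C :=
      Finset.single_le_sum (f := fun n : ℕ => (2 : ℝ) ^ ((n : ℝ) * (q - 1) * t))
        (fun _ _ => by positivity) (Finset.mem_range.2 hn)
    calc cubeSum μ n q ≤ 1 := cubeSum_le_one μ n hq.le
      _ = 2 ^ ((n : ℝ) * (q - 1) * t) * 2 ^ (-(n * (q - 1) * t)) := by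
          rw [← Real.rpow_add two_pos]; simp
      _ ≤ (1 + C) * 2 ^ (-(n * (q - 1) * t)) :=
          mul_le_mul_of_nonneg_right (by linarith) (by positivity)
  · have h1 := hn₀ n (by omega)
    have hn1 : (0 : ℝ) < n := by exact_mod_cast (by omega : 0 < n)
    rw [lt_div_iff₀ (by positivity)] at h1
    rcases (cubeSum_nonneg μ n q).eq_or_lt with h0 | h0
    · rw [← h0]; positivity
    have h2 : Real.logb 2 (cubeSum μ n q) ≤ -(n * (q - 1) * t) := by linarith
    rw [Real.logb_le_iff_le_rpow one_lt_two h0] at h2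
    exact h2.trans (le_mul_of_one_le_left (by positivity) (by linarith))

theorem le_lqDim_of_cubeSum_le (hS : IsCompact μ.support) {q t C : ℝ} (hq : 1 < q)
    (h : ∀ n : ℕ, cubeSum μ n q ≤ C * 2 ^ (-(n * (q - 1) * t))) : t ≤ lqDim μ q := by
  rw [lqDim_eq]
  have hq1 : 0 < q - 1 := by linarith
  have hC : 0 < C := by
    have := (cubeSum_pos μ hS 0 hq).trans_le (h 0)
    simpa using this
  refine le_of_forall_lt fun t' ht' => ?_
  obtain ⟨t'', h1, h2⟩ := exists_between ht'
  refine h1.trans_le (le_liminf_of_le (isBoundedUnder_le_lqDim μ hS hq).isCoboundedUnder_ge ?_)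
  have hlim : Tendsto (fun n : ℕ => (n : ℝ) * ((q - 1) * (t - t''))) atTop atTop :=
    tendsto_natCast_atTop_atTop.atTop_mul_const (mul_pos hq1 (by linarith))
  filter_upwards [hlim.eventually_ge_atTop (Real.logb 2 C), eventually_gt_atTop 0] with n hn hn0
  have hn1 : (0 : ℝ) < n := by exact_mod_cast hn0
  have h3 := Real.logb_le_logb_of_le one_lt_two (cubeSum_pos μ hS n hq) (h n)
  rw [Real.logb_mul hC.ne' (by positivity), Real.logb_rpow two_pos (by norm_num)] at h3
  rw [le_div_iff₀ (by positivity)]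
  nlinarith

theorem lqDim_nonneg (hS : IsCompact μ.support) {q : ℝ} (hq : 1 < q) : 0 ≤ lqDim μ q :=
  le_lqDim_of_cubeSum_le μ hS (C := 1) hq fun n => by simpa using cubeSum_le_one μ n hq.le

/-- If `α < t < d_q` for an Assouad exponent `α`, the lower bound `2^(-n(q-1)α)` and the upper bound
`2^(-n(q-1)t)` on the same sum collide for large `n`. -/
theorem lqDim_le_assouadDim (hS : IsCompact μ.support) {q : ℝ} (hq : 1 < q) :
    lqDim μ q ≤ assouadDim μ.support := by
  refine le_csInf ⟨k, isAssouadExponent_natCast _⟩ fun α hα => ?_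
  obtain ⟨c, hc, h⟩ := exists_cubeSum_ge μ hS hα hq
  by_contra! hlt
  obtain ⟨t, h1, h2⟩ := exists_between hlt
  obtain ⟨C, hC, hup⟩ := exists_cubeSum_le_of_lt_lqDim μ hq h2
  have hq1 : 0 < q - 1 := by linarith
  have hlim : Tendsto (fun n : ℕ => (n : ℝ) * ((q - 1) * (t - α))) atTop atTop :=
    tendsto_natCast_atTop_atTop.atTop_mul_const (mul_pos hq1 (by linarith))
  obtain ⟨n, hn⟩ := (hlim.eventually_gt_atTop (Real.logb 2 (C / c))).exists
  have h3 := (h n).trans (hup n)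
  rw [Real.logb_lt_iff_lt_rpow one_lt_two (by positivity), div_lt_iff₀ hc] at hn
  have h4 : (2 : ℝ) ^ ((n : ℝ) * ((q - 1) * (t - α))) * 2 ^ (-(n * (q - 1) * t)) =
      2 ^ (-(n * (q - 1) * α)) := by
    rw [← Real.rpow_add two_pos]; congr 1; ring
  have h5 : C * 2 ^ (-(n * (q - 1) * t)) < c * 2 ^ (-(n * (q - 1) * α)) := by
    rw [← h4]
    calc C * (2 : ℝ) ^ (-(n * (q - 1) * t))
        < 2 ^ ((n : ℝ) * ((q - 1) * (t - α))) * c * 2 ^ (-(n * (q - 1) * t)) :=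
          mul_lt_mul_of_pos_right hn (by positivity)
      _ = _ := by ring
  linarith

end

/-! ### Monotonicity of the `L^q` dimensions and the Frostman exponent -/

section
variable {k : ℕ} (μ : Measure (Euc k)) [IsProbabilityMeasure μ]

/-- Hölder interpolation between the exponents 1 and `q₁`: `q₂ = (1-θ) + θ q₁`, and the sum with
exponent 1 is the total mass 1. -/
theorem cubeSum_le_rpow_of_le (n : ℕ) {q₁ q₂ : ℝ} (h2 : 1 < q₂) (h21 : q₂ ≤ q₁) :
    cubeSum μ n q₂ ≤ cubeSum μ n q₁ ^ ((q₂ - 1) / (q₁ - 1)) := by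
  rcases h21.eq_or_lt with rfl | h21
  · rw [div_self (by linarith), Real.rpow_one]
  set θ := (q₂ - 1) / (q₁ - 1) with hθ
  have hq1 : 0 < q₁ - 1 := by linarith
  have hθ0 : 0 < θ := div_pos (by linarith) hq1
  have hθ1 : θ < 1 := (div_lt_one hq1).2 (by linarith)
  have hθq : θ * (q₁ - 1) = q₂ - 1 := by rw [hθ]; field_simp
  have hc : ((1 - θ)⁻¹).HolderConjugate θ⁻¹ := by
    have := Real.HolderConjugate.inv_inv (a := 1 - θ) (b := θ) (by linarith) hθ0 (by ring)
    exact this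
  have hf : ∀ m : Fin k → ℤ, (μ.real (dyadicCube n m) ^ (1 - θ)) ^ (1 - θ)⁻¹ =
      μ.real (dyadicCube n m) := fun m => by
    rw [← Real.rpow_mul measureReal_nonneg, mul_inv_cancel₀ (by linarith), Real.rpow_one]
  have hg : ∀ m : Fin k → ℤ, ((μ.real (dyadicCube n m) ^ q₁) ^ θ) ^ θ⁻¹ =
      μ.real (dyadicCube n m) ^ q₁ := fun m => by
    rw [← Real.rpow_mul (by positivity), mul_inv_cancel₀ hθ0.ne', Real.rpow_one]
  have := Real.inner_le_Lp_mul_Lq_tsum_of_nonneg hc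
    (f := fun m : Fin k → ℤ => μ.real (dyadicCube n m) ^ (1 - θ))
    (g := fun m : Fin k → ℤ => (μ.real (dyadicCube n m) ^ q₁) ^ θ)
    (fun _ => by positivity) (fun _ => by positivity)
    (by simpa only [hf] using (hasSum_dyadicCube μ n).summable)
    (by simpa only [hg] using summable_cubeSum μ n (by linarith))
  have h3 := this
  simp only [hf, hg, (hasSum_dyadicCube μ n).tsum_eq, Real.one_rpow, one_mul, one_div,
    inv_inv] at h3
  refine le_trans (le_of_eq ?_) h3
  refine tsum_congr fun m => ?_
  rw [← Real.rpow_mul measureReal_nonneg]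
  rcases (measureReal_nonneg (μ := μ) (s := dyadicCube n m)).eq_or_lt with h0 | h0
  · rw [← h0, Real.zero_rpow (by linarith), Real.zero_rpow (by linarith), zero_mul]
  · rw [← Real.rpow_add h0]; congr 1; linarith

theorem lqDim_anti (hS : IsCompact μ.support) {q₁ q₂ : ℝ} (h2 : 1 < q₂) (h21 : q₂ ≤ q₁) :
    lqDim μ q₁ ≤ lqDim μ q₂ := by
  have hq1 : 0 < q₁ - 1 := by linarith
  refine le_of_forall_lt_imp_le_of_dense fun t ht => ?_
  obtain ⟨C, hC, h⟩ := exists_cubeSum_le_of_lt_lqDim μ (by linarith) ht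
  refine le_lqDim_of_cubeSum_le μ hS (C := C ^ ((q₂ - 1) / (q₁ - 1))) h2 fun n => ?_
  refine ((cubeSum_le_rpow_of_le μ n h2 h21).trans (Real.rpow_le_rpow (cubeSum_nonneg μ n q₁) (h n)
    (div_nonneg (by linarith) hq1.le))).trans (le_of_eq ?_)
  rw [Real.mul_rpow hC.le (by positivity), ← Real.rpow_mul zero_le_two]
  congr 2; field_simp

/-- The `ℓ^q` norms decrease in `q`: each term `μ(D)^q₂` is at most the whole sum, so the surplus
power of it can be pulled out. -/
theorem cubeSum_le_rpow_of_ge (n : ℕ) {q₁ q₂ : ℝ} (h2 : 1 < q₂) (h21 : q₂ ≤ q₁) :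
    cubeSum μ n q₁ ≤ cubeSum μ n q₂ ^ (q₁ / q₂) := by
  have hq2 : 0 < q₂ := by linarith
  have hr : 1 ≤ q₁ / q₂ := (one_le_div hq2).2 h21
  set A := cubeSum μ n q₂ with hA
  have hA0 : 0 ≤ A := cubeSum_nonneg μ n q₂
  have hle : ∀ m : Fin k → ℤ, μ.real (dyadicCube n m) ^ q₁ ≤
      μ.real (dyadicCube n m) ^ q₂ * A ^ (q₁ / q₂ - 1) := fun m => by
    have h1 : μ.real (dyadicCube n m) ^ q₂ ≤ A :=
      (summable_cubeSum μ n h2.le).le_tsum m fun _ _ => by positivity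
    have h3 : μ.real (dyadicCube n m) ^ q₁ = (μ.real (dyadicCube n m) ^ q₂) *
        (μ.real (dyadicCube n m) ^ q₂) ^ (q₁ / q₂ - 1) := by
      rw [← Real.rpow_mul measureReal_nonneg]
      rcases (measureReal_nonneg (μ := μ) (s := dyadicCube n m)).eq_or_lt with h0 | h0
      · rw [← h0, Real.zero_rpow (by linarith), Real.zero_rpow (by linarith), zero_mul]
      · rw [← Real.rpow_add h0]; congr 1; field_simp; ring
    rw [h3]
    exact mul_le_mul_of_nonneg_left (Real.rpow_le_rpow (by positivity) h1 (by linarith))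
      (by positivity)
  have h4 : cubeSum μ n q₁ ≤ A * A ^ (q₁ / q₂ - 1) := by
    rw [hA, cubeSum, cubeSum, ← tsum_mul_right]
    exact Summable.tsum_le_tsum hle (summable_cubeSum μ n (by linarith))
      ((summable_cubeSum μ n h2.le).mul_right _)
  rcases hA0.eq_or_lt with h0 | h0
  · rw [← h0] at h4 ⊢
    rw [zero_mul] at h4
    exact h4.trans (by positivity)
  · refine h4.trans (le_of_eq ?_)
    rw [← Real.rpow_one_add' hA0 (by linarith)]; congr 1; ring

/-- With `q = p/(p-1)` the factor `(q-1)/q` is `1/p`, so this is the monotonicity of `d_{p/(p-1)}/p`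
in `p`. -/
theorem lqDim_mul_le (hS : IsCompact μ.support) {q₁ q₂ : ℝ} (h2 : 1 < q₂) (h21 : q₂ ≤ q₁) :
    (q₂ - 1) / q₂ * lqDim μ q₂ ≤ (q₁ - 1) / q₁ * lqDim μ q₁ := by
  have hq1 : 0 < q₁ - 1 := by linarith
  have hq2 : 0 < q₂ - 1 := by linarith
  have h2' : 0 < q₂ := by linarith
  have h1' : 0 < q₁ := by linarith
  rw [← le_div_iff₀' (by positivity)]
  refine le_of_forall_lt_imp_le_of_dense fun t ht => ?_
  obtain ⟨C, hC, h⟩ := exists_cubeSum_le_of_lt_lqDim μ h2 ht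
  rw [le_div_iff₀' (by positivity), ← div_le_iff₀' (by positivity)]
  refine le_lqDim_of_cubeSum_le μ hS (C := C ^ (q₁ / q₂)) (by linarith) fun n => ?_
  refine ((cubeSum_le_rpow_of_ge μ n h2 h21).trans (Real.rpow_le_rpow (cubeSum_nonneg μ n q₂) (h n)
    (by positivity))).trans (le_of_eq ?_)
  rw [Real.mul_rpow hC.le (by positivity), ← Real.rpow_mul zero_le_two]
  congr 2; field_simp

/-! ### The Frostman exponent as the endpoint `q = ∞` of the `L^q` dimensions. -/

/-- `s` is an admissible exponent in the definition of the Frostman exponent. -/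
def IsFrostmanExponent {k : ℕ} (μ : Measure (Euc k)) (s : ℝ) : Prop :=
  0 ≤ s ∧ ∃ C : ℝ, ∀ (x : Euc k) (r : ℝ), 0 < r → μ.real (Metric.ball x r) ≤ C * r ^ s

/-- A cube lies in a ball of comparable radius, so `μ(D)^(q-1) ≲ 2^(-n(q-1)s)`; summing against the
remaining factor `μ(D)` costs only the total mass. -/
theorem IsFrostmanExponent.le_lqDim (hS : IsCompact μ.support) {s q : ℝ}
    (hs : IsFrostmanExponent μ s) (hq : 1 < q) : s ≤ lqDim μ q := by
  obtain ⟨hs0, C, hC⟩ := hs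
  have hC0 : 0 ≤ C := by
    simpa using measureReal_nonneg.trans (hC 0 1 one_pos)
  have hq1 : 0 < q - 1 := by linarith
  set B := C * (Real.sqrt k + 1) ^ s with hB
  have hB0 : 0 ≤ B := by positivity
  have hcube : ∀ (n : ℕ) (m : Fin k → ℤ), μ.real (dyadicCube n m) ≤ B * 2 ^ (-(n * s)) := by
    intro n m
    rcases (dyadicCube (k := k) n m).eq_empty_or_nonempty with h0 | ⟨x, hx⟩
    · rw [h0, measureReal_empty]; positivity
    · have h2 : (0 : ℝ) < 2 ^ n := by positivity
      have hlt : Real.sqrt k / 2 ^ n < (Real.sqrt k + 1) / 2 ^ n :=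
        div_lt_div_of_pos_right (by linarith) h2
      rw [← mem_dyadicCube_iff.1 hx]
      refine (measureReal_mono (dyadicCube_subset_ball hlt) (measure_ne_top _ _)).trans
        ((hC x _ (by positivity)).trans (le_of_eq ?_))
      rw [Real.div_rpow (by positivity) h2.le, ← Real.rpow_natCast, ← Real.rpow_mul zero_le_two,
        Real.rpow_neg zero_le_two, hB]
      ring
  refine le_lqDim_of_cubeSum_le μ hS (C := B ^ (q - 1)) hq fun n => ?_
  have hle : ∀ m : Fin k → ℤ, μ.real (dyadicCube n m) ^ q ≤
      μ.real (dyadicCube n m) * (B ^ (q - 1) * 2 ^ (-(n * (q - 1) * s))) := fun m => by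
    have h3 : μ.real (dyadicCube n m) ^ q =
        μ.real (dyadicCube n m) * μ.real (dyadicCube n m) ^ (q - 1) := by
      rw [← Real.rpow_one_add' measureReal_nonneg (by linarith)]; congr 1; ring
    rw [h3]
    refine mul_le_mul_of_nonneg_left ?_ measureReal_nonneg
    refine (Real.rpow_le_rpow measureReal_nonneg (hcube n m) hq1.le).trans (le_of_eq ?_)
    rw [Real.mul_rpow hB0 (by positivity), ← Real.rpow_mul zero_le_two]
    congr 2; ring
  refine (Summable.tsum_le_tsum hle (summable_cubeSum μ n hq.le)
    ((hasSum_dyadicCube μ n).summable.mul_right _)).trans (le_of_eq ?_)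
  rw [tsum_mul_right, (hasSum_dyadicCube μ n).tsum_eq, one_mul]

theorem isFrostmanExponent_zero : IsFrostmanExponent μ 0 :=
  ⟨le_rfl, 1, fun x r _ => by simp⟩

/-- One term of the moment sum is at most the sum, which gives `μ(D) ≲ 2^(-ns)` for every cube. A
ball of radius `r ≤ 2^(-n)` meets at most `4^k` cubes of level `n`. -/
theorem isFrostmanExponent_of_lt {s q : ℝ} (hs0 : 0 ≤ s) (hq : 1 < q)
    (hs : s < (q - 1) / q * lqDim μ q) : IsFrostmanExponent μ s := by
  have hq1 : 0 < q - 1 := by linarith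
  have hq0 : 0 < q := by linarith
  obtain ⟨C, hC, h⟩ := exists_cubeSum_le_of_lt_lqDim μ hq
    ((div_lt_iff₀' (show 0 < (q - 1) / q by positivity)).2 hs)
  have hcube : ∀ (n : ℕ) (m : Fin k → ℤ),
      μ.real (dyadicCube n m) ≤ C ^ q⁻¹ * 2 ^ (-(n * s)) := by
    intro n m
    have h1 : μ.real (dyadicCube n m) ^ q ≤ C * 2 ^ (-(n * (q - 1) * (s / ((q - 1) / q)))) :=
      ((summable_cubeSum μ n hq.le).le_tsum m fun _ _ => by positivity).trans (h n)
    have h2 := Real.rpow_le_rpow (by positivity) h1 (inv_nonneg.2 hq0.le)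
    rw [← Real.rpow_mul measureReal_nonneg, mul_inv_cancel₀ hq0.ne', Real.rpow_one,
      Real.mul_rpow hC.le (by positivity), ← Real.rpow_mul zero_le_two] at h2
    refine h2.trans (le_of_eq ?_)
    congr 2; field_simp
  refine ⟨hs0, max 1 (4 ^ k * (C ^ q⁻¹ * 2 ^ s)), fun x r hr => ?_⟩
  rcases le_or_gt 1 r with h1 | h1
  · calc μ.real (Metric.ball x r) ≤ 1 * 1 := by simp
      _ ≤ _ := mul_le_mul (le_max_left _ _) (Real.one_le_rpow h1 hs0) zero_le_one (by positivity)
  obtain ⟨n, hn1, hn2⟩ := exists_nat_pow_near (one_le_inv_iff₀.2 ⟨hr, h1.le⟩) one_lt_two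
  have hrn : 2 ^ n * r ≤ 1 := by
    rw [← le_div_iff₀ hr, one_div]; exact hn1
  have hcard : ((cubesNear n x r).card : ℝ) ≤ 4 ^ k :=
    (card_cubesNear_le n x hr.le).trans (pow_le_pow_left₀ (by positivity) (by linarith) k)
  have h2s : (2 : ℝ) ^ (-(n * s)) ≤ 2 ^ s * r ^ s := by
    rw [← Real.mul_rpow zero_le_two hr.le, neg_mul_eq_neg_mul, Real.rpow_mul zero_le_two]
    refine Real.rpow_le_rpow (by positivity) ?_ hs0
    rw [Real.rpow_neg zero_le_two, Real.rpow_natCast, inv_le_iff_one_le_mul₀ (by positivity)]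
    rw [inv_lt_iff_one_lt_mul₀ hr, pow_succ] at hn2
    nlinarith
  calc μ.real (Metric.ball x r) ≤ ∑ m ∈ cubesNear n x r, μ.real (dyadicCube n m) :=
        measureReal_ball_le_sum μ n x r
    _ ≤ ∑ m ∈ cubesNear n x r, C ^ q⁻¹ * 2 ^ (-(n * s)) :=
        Finset.sum_le_sum fun m _ => hcube n m
    _ = (cubesNear n x r).card * (C ^ q⁻¹ * 2 ^ (-(n * s))) := by
        rw [Finset.sum_const, nsmul_eq_mul]
    _ ≤ 4 ^ k * (C ^ q⁻¹ * (2 ^ s * r ^ s)) :=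
        mul_le_mul hcard (mul_le_mul_of_nonneg_left h2s (by positivity)) (by positivity)
          (by positivity)
    _ = 4 ^ k * (C ^ q⁻¹ * 2 ^ s) * r ^ s := by ring
    _ ≤ _ := mul_le_mul_of_nonneg_right (le_max_right _ _) (by positivity)

theorem frostmanExponent_le_lqDim (hS : IsCompact μ.support) {q : ℝ} (hq : 1 < q) :
    frostmanExponent μ ≤ lqDim μ q :=
  csSup_le ⟨0, isFrostmanExponent_zero μ⟩ fun _ hs => IsFrostmanExponent.le_lqDim μ hS hs hq

theorem mul_lqDim_le_frostmanExponent (hS : IsCompact μ.support) {q : ℝ} (hq : 1 < q) :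
    (q - 1) / q * lqDim μ q ≤ frostmanExponent μ := by
  have hbdd : BddAbove {s | IsFrostmanExponent μ s} :=
    ⟨lqDim μ q, fun _ hs => IsFrostmanExponent.le_lqDim μ hS hs hq⟩
  refine le_of_forall_lt_imp_le_of_dense fun t ht => ?_
  rcases le_or_gt 0 t with h0 | h0
  · exact le_csSup hbdd (isFrostmanExponent_of_lt μ h0 hq ht)
  · exact h0.le.trans (le_csSup hbdd (isFrostmanExponent_zero μ))

/-! ### The dimension with conjugate exponent -/

theorem conjugateDim_nonneg (hS : IsCompact μ.support) {p : ℝ} (hp : 1 ≤ p) :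
    0 ≤ conjugateDim μ p := by
  rw [conjugateDim]
  split_ifs with h
  · exact Real.sSup_nonneg fun s hs => hs.1
  · have hp1 : 0 < p - 1 := sub_pos.2 (lt_of_le_of_ne hp (Ne.symm h))
    exact lqDim_nonneg μ hS ((one_lt_div hp1).2 (by linarith))

theorem conjugateDim_mono (hS : IsCompact μ.support) {p₁ p₂ : ℝ} (h1 : 1 ≤ p₁) (h12 : p₁ ≤ p₂) :
    conjugateDim μ p₁ ≤ conjugateDim μ p₂ := by
  rcases h12.eq_or_lt with rfl | h12
  · exact le_rfl
  have hp2 : 0 < p₂ - 1 := by linarith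
  have hq2 : 1 < p₂ / (p₂ - 1) := (one_lt_div hp2).2 (by linarith)
  rw [conjugateDim, conjugateDim, if_neg (show p₂ ≠ 1 by linarith)]
  split_ifs with h
  · exact frostmanExponent_le_lqDim μ hS hq2
  · have hp1 : 0 < p₁ - 1 := sub_pos.2 (lt_of_le_of_ne h1 (Ne.symm h))
    refine lqDim_anti μ hS hq2 ?_
    rw [div_le_div_iff₀ hp2 hp1]; linarith

theorem conjugateDim_div_anti (hS : IsCompact μ.support) {p₁ p₂ : ℝ} (h1 : 1 ≤ p₁)
    (h12 : p₁ ≤ p₂) : conjugateDim μ p₂ ≤ p₂ / p₁ * conjugateDim μ p₁ := by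
  have h1' : 0 < p₁ := by linarith
  rcases h12.eq_or_lt with rfl | h12
  · rw [div_self h1'.ne', one_mul]
  have hp2 : 0 < p₂ - 1 := by linarith
  have h2' : 0 < p₂ := by linarith
  have hq2 : 1 < p₂ / (p₂ - 1) := (one_lt_div hp2).2 (by linarith)
  have hconj : ∀ p : ℝ, 0 < p - 1 → 0 < p → (p / (p - 1) - 1) / (p / (p - 1)) = p⁻¹ :=
    fun p h h' => by field_simp; ring
  rw [conjugateDim, conjugateDim, if_neg (show p₂ ≠ 1 by linarith)]
  split_ifs with h
  · have := mul_lqDim_le_frostmanExponent μ hS hq2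
    rw [hconj p₂ hp2 h2', inv_mul_le_iff₀ h2'] at this
    rwa [h, div_one]
  · have hp1 : 0 < p₁ - 1 := sub_pos.2 (lt_of_le_of_ne h1 (Ne.symm h))
    have := lqDim_mul_le μ hS hq2 (q₁ := p₁ / (p₁ - 1))
      (by rw [div_le_div_iff₀ hp2 hp1]; linarith)
    rw [hconj p₂ hp2 h2', hconj p₁ hp1 h1', inv_mul_le_iff₀ h2'] at this
    exact this.trans (le_of_eq (by ring))

theorem conjugateDim_le_assouadDim (hS : IsCompact μ.support) {p : ℝ} (hp : p ∈ Icc (1 : ℝ) 2) :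
    conjugateDim μ p ≤ assouadDim μ.support := by
  refine (conjugateDim_mono μ hS hp.1 hp.2).trans ?_
  rw [conjugateDim, if_neg (by norm_num)]
  exact lqDim_le_assouadDim μ hS (by norm_num)

end

/-- A nonnegative function `h` such that `h` is monotone and `h p / p` is antitone is continuous. -/
theorem continuousOn_of_mono_of_div_anti {h : ℝ → ℝ} (h0 : 0 ≤ h 2)
    (hmono : ∀ p₁ p₂, 1 ≤ p₁ → p₁ ≤ p₂ → h p₁ ≤ h p₂)
    (hanti : ∀ p₁ p₂, 1 ≤ p₁ → p₁ ≤ p₂ → h p₂ ≤ p₂ / p₁ * h p₁) : ContinuousOn h (Icc 1 2) := by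
  -- The two monotonicities give `0 ≤ h p₂ - h p₁ ≤ (p₂ - p₁)/p₁ * h p₁ ≤ (p₂ - p₁) * h 2`.
  have hlip : ∀ p₁ ∈ Icc (1 : ℝ) 2, ∀ p₂ ∈ Icc (1 : ℝ) 2, p₁ ≤ p₂ →
      |h p₂ - h p₁| ≤ h 2 * (p₂ - p₁) := by
    intro p₁ h1 p₂ h2 h12
    have hp1 : 0 < p₁ := by linarith [h1.1]
    rw [abs_of_nonneg (sub_nonneg.2 (hmono _ _ h1.1 h12))]
    have h3 := hanti _ _ h1.1 h12
    have h4 := hmono _ _ h1.1 h1.2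
    rw [div_mul_eq_mul_div, le_div_iff₀ hp1] at h3
    have h5 := hmono _ _ h1.1 h12
    nlinarith [h1.1, h1.2, mul_nonneg (sub_nonneg.2 h12) (sub_nonneg.2 h4),
      mul_nonneg (sub_nonneg.2 h1.1) (sub_nonneg.2 h5)]
  refine LipschitzOnWith.continuousOn (K := (h 2).toNNReal)
    (LipschitzOnWith.of_dist_le_mul fun x hx y hy => ?_)
  rw [Real.coe_toNNReal _ h0, Real.dist_eq, Real.dist_eq]
  rcases le_total x y with hxy | hxy
  · rw [abs_sub_comm, abs_sub_comm x, abs_of_nonneg (sub_nonneg.2 hxy)]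
    exact hlip x hx y hy hxy
  · rw [abs_of_nonneg (sub_nonneg.2 hxy)]
    exact hlip y hy x hx hxy

/-! ### Basic properties of the Fourier transform -/

section
variable {E : Type*} [NormedAddCommGroup E] [InnerProductSpace ℝ E] [MeasurableSpace E]

theorem norm_exp_fourier (a : ℝ) :
    ‖Complex.exp (-2 * Real.pi * Complex.I * (a : ℂ))‖ = 1 := by
  have : -2 * Real.pi * Complex.I * (a : ℂ) = ((-2 * Real.pi * a : ℝ) : ℂ) * Complex.I := by
    push_cast; ring
  rw [this, Complex.norm_exp_ofReal_mul_I]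

theorem norm_fourierTransform_le_one (μ : Measure E) [IsProbabilityMeasure μ] (ξ : E) :
    ‖fourierTransform μ ξ‖ ≤ 1 := by
  refine (norm_integral_le_of_norm_le_const (C := 1)
    (Eventually.of_forall fun x => (norm_exp_fourier _).le)).trans ?_
  simp

theorem continuous_fourierTransform [BorelSpace E] [SecondCountableTopology E]
    (μ : Measure E) [IsProbabilityMeasure μ] : Continuous (fourierTransform μ) := by
  refine continuous_of_dominated (bound := fun _ => 1) (fun ξ => ?_)
    (fun ξ => Eventually.of_forall fun x => (norm_exp_fourier _).le) (integrable_const _)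
    (Eventually.of_forall fun x => ?_)
  · exact Continuous.aestronglyMeasurable (by fun_prop)
  · fun_prop

theorem continuous_norm_fourierTransform_rpow [BorelSpace E] [SecondCountableTopology E]
    (μ : Measure E) [IsProbabilityMeasure μ] {p : ℝ} (hp : 0 ≤ p) :
    Continuous fun ξ => ‖fourierTransform μ ξ‖ ^ p :=
  (continuous_fourierTransform μ).norm.rpow_const fun _ => Or.inr hp

theorem norm_fourierTransform_rpow_le_one (μ : Measure E) [IsProbabilityMeasure μ] {p : ℝ}
    (hp : 0 ≤ p) (ξ : E) : ‖fourierTransform μ ξ‖ ^ p ≤ 1 :=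
  Real.rpow_le_one (norm_nonneg _) (norm_fourierTransform_le_one μ ξ) hp

end

section
variable {k : ℕ} (μ : Measure (Euc k)) [IsProbabilityMeasure μ]

theorem integrableOn_norm_fourierTransform_rpow {p : ℝ} (hp : 0 ≤ p) (x : Euc k) (R : ℝ) :
    IntegrableOn (fun ξ => ‖fourierTransform μ ξ‖ ^ p) (Metric.ball x R) :=
  ((continuous_norm_fourierTransform_rpow μ hp).continuousOn.integrableOn_compact
    (isCompact_closedBall x R)).mono_set Metric.ball_subset_closedBall

theorem volume_real_ball_eq (x : Euc k) {R : ℝ} (hR : 0 < R) :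
    volume.real (Metric.ball x R) = R ^ (k : ℝ) * volume.real (Metric.ball (0 : Euc k) 1) := by
  rw [measureReal_def, Measure.addHaar_ball_of_pos volume x hR, ENNReal.toReal_mul,
    ENNReal.toReal_ofReal (by positivity), finrank_euclideanSpace_fin, Real.rpow_natCast,
    measureReal_def]

/-! ### The Fourier `l^p` dimension -/

/-- `s` is an admissible exponent in the definition of the Fourier `l^p` dimension. -/
def IsFourierLpExponent {k : ℕ} (μ : Measure (Euc k)) (p s : ℝ) : Prop :=
  0 ≤ s ∧ s < k ∧ ∃ C : ℝ, ∀ R : ℝ, 0 < R →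
    ∫ ξ in Metric.ball (0 : Euc k) R, ‖fourierTransform μ ξ‖ ^ p ≤ C * R ^ ((k : ℝ) - s)

theorem isFourierLpExponent_zero (hk : 0 < k) {p : ℝ} (hp : 0 ≤ p) :
    IsFourierLpExponent μ p 0 := by
  refine ⟨le_rfl, by exact_mod_cast hk, volume.real (Metric.ball (0 : Euc k) 1), fun R hR => ?_⟩
  have h1 : ∫ ξ in Metric.ball (0 : Euc k) R, ‖fourierTransform μ ξ‖ ^ p ≤
      ∫ _ in Metric.ball (0 : Euc k) R, (1 : ℝ) :=
    setIntegral_mono (integrableOn_norm_fourierTransform_rpow μ hp 0 R)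
      (integrableOn_const measure_ball_lt_top.ne) fun ξ => norm_fourierTransform_rpow_le_one μ hp ξ
  refine h1.trans (le_of_eq ?_)
  rw [setIntegral_const, smul_eq_mul, mul_one, volume_real_ball_eq 0 hR, sub_zero, mul_comm]

omit [IsProbabilityMeasure μ] in
theorem bddAbove_isFourierLpExponent (p : ℝ) : BddAbove {s | IsFourierLpExponent μ p s} :=
  ⟨k, fun _ hs => hs.2.1.le⟩

omit [IsProbabilityMeasure μ] in
theorem fourierLpDim_nonneg (p : ℝ) : 0 ≤ fourierLpDim μ p :=
  Real.sSup_nonneg fun _ hs => hs.1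

/-- Raising the power shrinks the integrand, because `|μ̂| ≤ 1`. -/
theorem IsFourierLpExponent.mono {p₁ p₂ s : ℝ} (h1 : 0 < p₁) (h12 : p₁ ≤ p₂)
    (hs : IsFourierLpExponent μ p₁ s) : IsFourierLpExponent μ p₂ s := by
  obtain ⟨hs0, hsk, C, hC⟩ := hs
  refine ⟨hs0, hsk, C, fun R hR => le_trans ?_ (hC R hR)⟩
  exact setIntegral_mono (integrableOn_norm_fourierTransform_rpow μ (by linarith) 0 R)
    (integrableOn_norm_fourierTransform_rpow μ h1.le 0 R) fun ξ =>
    Real.rpow_le_rpow_of_exponent_ge' (norm_nonneg _) (norm_fourierTransform_le_one μ ξ) h1.le h12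

/-- Hölder's inequality against the constant 1 on a ball of volume `≍ R^k`. It yields the
monotonicity of `κ_p/p`. -/
theorem IsFourierLpExponent.mul_div {p₁ p₂ s : ℝ} (h1 : 0 < p₁) (h12 : p₁ < p₂)
    (hs : IsFourierLpExponent μ p₂ s) : IsFourierLpExponent μ p₁ (s * (p₁ / p₂)) := by
  obtain ⟨hs0, hsk, C, hC⟩ := hs
  have h2 : 0 < p₂ := h1.trans h12
  have hr1 : p₁ / p₂ < 1 := (div_lt_one h2).2 h12
  have hr0 : 0 < p₁ / p₂ := by positivity
  refine ⟨by positivity, ?_, C ^ (p₁ / p₂) * volume.real (Metric.ball (0 : Euc k) 1) ^ (1 - p₁ / p₂),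
    fun R hR => ?_⟩
  · exact (mul_le_of_le_one_right hs0 hr1.le).trans_lt hsk
  have hconj : (p₂ / p₁).HolderConjugate ((1 - p₁ / p₂)⁻¹) := by
    have := Real.HolderConjugate.inv_inv (a := p₁ / p₂) (b := 1 - p₁ / p₂) hr0 (by linarith)
      (by ring)
    rwa [inv_div] at this
  have hfin : IsFiniteMeasure (volume.restrict (Metric.ball (0 : Euc k) R)) :=
    ⟨by simpa using measure_ball_lt_top⟩
  have hH := integral_mul_le_Lp_mul_Lq_of_nonneg
    (μ := volume.restrict (Metric.ball (0 : Euc k) R)) hconj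
    (f := fun ξ => ‖fourierTransform μ ξ‖ ^ p₁) (g := fun _ => 1)
    (Eventually.of_forall fun _ => by positivity) (Eventually.of_forall fun _ => zero_le_one)
    (MemLp.of_bound (continuous_norm_fourierTransform_rpow μ h1.le).aestronglyMeasurable 1
      (Eventually.of_forall fun ξ => by
        rw [Real.norm_of_nonneg (by positivity)]
        exact norm_fourierTransform_rpow_le_one μ h1.le ξ))
    (memLp_const 1)
  have hpow : ∀ ξ, (‖fourierTransform μ ξ‖ ^ p₁) ^ (p₂ / p₁) = ‖fourierTransform μ ξ‖ ^ p₂ :=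
    fun ξ => by rw [← Real.rpow_mul (norm_nonneg _)]; congr 1; field_simp
  simp only [mul_one, hpow, Real.one_rpow, one_div, inv_inv, inv_div] at hH
  rw [setIntegral_const, smul_eq_mul, mul_one, volume_real_ball_eq 0 hR] at hH
  have hI0 : 0 ≤ ∫ ξ in Metric.ball (0 : Euc k) R, ‖fourierTransform μ ξ‖ ^ p₂ :=
    integral_nonneg fun _ => by positivity
  have hC0 : 0 ≤ C := by
    have := hI0.trans (hC R hR)
    exact nonneg_of_mul_nonneg_left this (by positivity)
  refine hH.trans ((mul_le_mul_of_nonneg_right (Real.rpow_le_rpow hI0 (hC R hR) hr0.le)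
    (by positivity)).trans (le_of_eq ?_))
  rw [Real.mul_rpow hC0 (by positivity), Real.mul_rpow (by positivity) measureReal_nonneg,
    ← Real.rpow_mul hR.le, ← Real.rpow_mul hR.le]
  have : R ^ ((k : ℝ) - s * (p₁ / p₂)) =
      R ^ (((k : ℝ) - s) * (p₁ / p₂)) * R ^ ((k : ℝ) * (1 - p₁ / p₂)) := by
    rw [← Real.rpow_add hR]; congr 1; ring
  rw [this]; ring

theorem fourierLpDim_mono (hk : 0 < k) {p₁ p₂ : ℝ} (h1 : 0 < p₁) (h12 : p₁ ≤ p₂) :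
    fourierLpDim μ p₁ ≤ fourierLpDim μ p₂ :=
  csSup_le_csSup (bddAbove_isFourierLpExponent μ p₂) ⟨0, isFourierLpExponent_zero μ hk h1.le⟩
    fun _ hs => IsFourierLpExponent.mono μ h1 h12 hs

theorem fourierLpDim_div_anti (hk : 0 < k) {p₁ p₂ : ℝ} (h1 : 0 < p₁) (h12 : p₁ ≤ p₂) :
    fourierLpDim μ p₂ ≤ p₂ / p₁ * fourierLpDim μ p₁ := by
  rcases h12.eq_or_lt with rfl | h12
  · rw [div_self h1.ne', one_mul]
  have h2 : 0 < p₂ := h1.trans h12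
  refine csSup_le ⟨0, isFourierLpExponent_zero μ hk h2.le⟩ fun s hs => ?_
  have : s * (p₁ / p₂) ≤ fourierLpDim μ p₁ :=
    le_csSup (bddAbove_isFourierLpExponent μ p₁) (IsFourierLpExponent.mul_div μ h1 h12 hs)
  calc s = p₂ / p₁ * (s * (p₁ / p₂)) := by field_simp
    _ ≤ _ := mul_le_mul_of_nonneg_left this (by positivity)

/-! ### The Fourier `l^2` dimension is at most the `L^2` dimension -/

/-- Passes from sharp cutoffs to a Gaussian one: the Gaussian at scale `2^n` is dominated by a
rapidly decreasing combination of indicators of the balls of radius `2^(n+j)`. -/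
theorem exists_integral_gaussian_le {β C : ℝ} (hk : 0 < k) (hβk : β ≤ k)
    (hC : ∀ R : ℝ, 0 < R →
      ∫ ξ in Metric.ball (0 : Euc k) R, ‖fourierTransform μ ξ‖ ^ (2 : ℝ) ≤ C * R ^ β) :
    ∃ C' : ℝ, ∀ n : ℕ,
      ∫ ξ : Euc k, Real.exp (-((4 ^ n)⁻¹ * ‖ξ‖ ^ 2)) * ‖fourierTransform μ ξ‖ ^ (2 : ℝ) ≤
        C' * 2 ^ (n * β) := by
  have hC0 : 0 ≤ C := by
    have h := hC 1 one_pos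
    rw [Real.one_rpow, mul_one] at h
    exact le_trans (integral_nonneg fun _ => by positivity) h
  set G : Euc k → ℝ := fun ξ => ‖fourierTransform μ ξ‖ ^ (2 : ℝ) with hG
  have hG0 : ∀ ξ, 0 ≤ G ξ := fun ξ => by positivity
  have hGc : Continuous G := continuous_norm_fourierTransform_rpow μ zero_le_two
  -- From `exp (-v) ≤ k! / v^k` on `4^(j-1) ≤ v < 4^j`; at `j = 0` the value is at least 1, which
  -- covers `v < 1`. The decay `4^(-jk)` beats the growth `2^(jβ)` because `β ≤ k`.
  set c : ℕ → ℝ := fun j => k.factorial * 4 ^ k * ((4 ^ j) ^ k)⁻¹ with hc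
  have hc0 : ∀ j, 0 ≤ c j := fun j => by positivity
  have hexp : ∀ (n : ℕ) (ξ : Euc k), ∃ j : ℕ, ‖ξ‖ < 2 ^ (n + j) ∧
      Real.exp (-((4 ^ n)⁻¹ * ‖ξ‖ ^ 2)) ≤ c j := by
    intro n ξ
    set v := (4 ^ n)⁻¹ * ‖ξ‖ ^ 2 with hv
    have hv' : ‖ξ‖ ^ 2 = 4 ^ n * v := by rw [hv]; field_simp
    have hlt : ∀ j : ℕ, v < 4 ^ j → ‖ξ‖ < 2 ^ (n + j) := by
      intro j hj
      refine lt_of_pow_lt_pow_left₀ 2 (by positivity) ?_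
      rw [hv', ← pow_mul, mul_comm (n + j), pow_mul, pow_add]
      norm_num
      exact hj
    rcases lt_or_ge v 1 with h1 | h1
    · refine ⟨0, hlt 0 (by simpa using h1), ?_⟩
      have h2 : (1 : ℝ) ≤ k.factorial := by exact_mod_cast k.factorial_pos
      have h3 : (1 : ℝ) ≤ 4 ^ k := one_le_pow₀ (by norm_num)
      calc Real.exp (-v) ≤ 1 := Real.exp_le_one_iff.2 (by rw [neg_nonpos]; positivity)
        _ ≤ k.factorial * 4 ^ k := one_le_mul_of_one_le_of_one_le h2 h3
        _ = c 0 := by simp [hc]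
    · obtain ⟨j, hj1, hj2⟩ := exists_nat_pow_near h1 (by norm_num : (1 : ℝ) < 4)
      refine ⟨j + 1, hlt _ hj2, ?_⟩
      have h2 := Real.pow_div_factorial_le_exp v (by linarith) k
      have h3 : c (j + 1) = k.factorial / (4 ^ j) ^ k := by
        simp only [hc, pow_succ, mul_pow]; field_simp
      rw [h3, Real.exp_neg, inv_le_comm₀ (Real.exp_pos _) (by positivity), inv_div]
      refine le_trans ?_ h2
      gcongr
  set B : ℕ → ℕ → Set (Euc k) := fun n j => Metric.ball 0 (2 ^ (n + j))
  have hr0 : (0 : ℝ) ≤ (2 : ℝ) ^ β * (4 ^ k)⁻¹ := by positivity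
  have hr1 : (2 : ℝ) ^ β * (4 ^ k)⁻¹ < 1 := by
    rw [← div_eq_mul_inv, div_lt_one (by positivity)]
    calc (2 : ℝ) ^ β ≤ 2 ^ (k : ℝ) := Real.rpow_le_rpow_of_exponent_le one_le_two hβk
      _ = 2 ^ k := Real.rpow_natCast 2 k
      _ < 4 ^ k := pow_lt_pow_left₀ (by norm_num) (by norm_num) hk.ne'
  have hterm : ∀ n j : ℕ, c j * (C * (2 ^ (n + j)) ^ β) =
      k.factorial * 4 ^ k * C * 2 ^ (n * β) * ((2 : ℝ) ^ β * (4 ^ k)⁻¹) ^ j := by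
    intro n j
    have h1 : ((2 : ℝ) ^ (n + j)) ^ β = 2 ^ (n * β) * (2 ^ β) ^ j := by
      rw [← Real.rpow_natCast, ← Real.rpow_mul zero_le_two, ← Real.rpow_natCast,
        ← Real.rpow_mul zero_le_two, ← Real.rpow_add two_pos]
      congr 1; push_cast; ring
    have h2 : ((4 : ℝ) ^ j) ^ k = (4 ^ k) ^ j := by rw [← pow_mul, ← pow_mul, mul_comm]
    simp only [hc, h1, h2, mul_pow, inv_pow]; ring
  have hsum : ∀ n : ℕ, Summable fun j : ℕ => c j * (C * (2 ^ (n + j)) ^ β) := by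
    intro n
    simp only [hterm]
    exact (summable_geometric_of_lt_one hr0 hr1).mul_left _
  refine ⟨k.factorial * 4 ^ k * C * ∑' j : ℕ, ((2 : ℝ) ^ β * (4 ^ k)⁻¹) ^ j, fun n => ?_⟩
  have htot : ∑' j : ℕ, c j * (C * (2 ^ (n + j)) ^ β) =
      k.factorial * 4 ^ k * C * (∑' j : ℕ, ((2 : ℝ) ^ β * (4 ^ k)⁻¹) ^ j) * 2 ^ (n * β) := by
    simp only [hterm]; rw [tsum_mul_left]; ring
  rw [← htot]
  have hnn : ∀ j, 0 ≤ c j * (C * (2 ^ (n + j)) ^ β) := fun j => by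
    have := hc0 j; positivity
  rw [integral_eq_lintegral_of_nonneg_ae (Eventually.of_forall fun ξ => by positivity)
    (Continuous.aestronglyMeasurable (show Continuous fun ξ : Euc k =>
      Real.exp (-((4 ^ n)⁻¹ * ‖ξ‖ ^ 2)) * G ξ from Continuous.mul (by fun_prop) hGc))]
  refine ENNReal.toReal_le_of_le_ofReal (tsum_nonneg hnn) ?_
  rw [ENNReal.ofReal_tsum_of_nonneg hnn (hsum n)]
  calc ∫⁻ ξ, ENNReal.ofReal (Real.exp (-((4 ^ n)⁻¹ * ‖ξ‖ ^ 2)) * G ξ)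
      ≤ ∫⁻ ξ, ∑' j : ℕ, (B n j).indicator (fun ξ => ENNReal.ofReal (c j * G ξ)) ξ := by
        refine lintegral_mono fun ξ => ?_
        obtain ⟨j, hj1, hj2⟩ := hexp n ξ
        refine le_trans ?_ (ENNReal.le_tsum j)
        rw [indicator_of_mem (by simpa [B] using hj1)]
        exact ENNReal.ofReal_le_ofReal (mul_le_mul_of_nonneg_right hj2 (hG0 ξ))
    _ = ∑' j : ℕ, ∫⁻ ξ, (B n j).indicator (fun ξ => ENNReal.ofReal (c j * G ξ)) ξ :=
        lintegral_tsum fun j => ((by fun_prop : Measurable fun ξ =>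
          ENNReal.ofReal (c j * G ξ)).indicator Metric.isOpen_ball.measurableSet).aemeasurable
    _ ≤ ∑' j : ℕ, ENNReal.ofReal (c j * (C * (2 ^ (n + j)) ^ β)) := by
        refine ENNReal.tsum_le_tsum fun j => ?_
        rw [lintegral_indicator Metric.isOpen_ball.measurableSet,
          ← ofReal_integral_eq_lintegral_ofReal
            ((integrableOn_norm_fourierTransform_rpow μ zero_le_two 0 _).const_mul _)
            (Eventually.of_forall fun ξ => mul_nonneg (hc0 j) (hG0 ξ)), integral_const_mul]
        exact ENNReal.ofReal_le_ofReal
          (mul_le_mul_of_nonneg_left (hC _ (by positivity)) (hc0 j))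

/-- `|μ̂|²` is the Fourier transform of the law of the difference of two independent points of μ. -/
theorem fourierTransform_mul_conj (ξ : Euc k) :
    ∫ z, Complex.exp (-2 * Real.pi * Complex.I * ((inner ℝ (z.1 - z.2) ξ : ℝ) : ℂ)) ∂(μ.prod μ) =
      ((‖fourierTransform μ ξ‖ ^ (2 : ℝ) : ℝ) : ℂ) := by
  have h1 : ∀ z : Euc k × Euc k,
      Complex.exp (-2 * Real.pi * Complex.I * ((inner ℝ (z.1 - z.2) ξ : ℝ) : ℂ)) =
        Complex.exp (-2 * Real.pi * Complex.I * ((inner ℝ ξ z.1 : ℝ) : ℂ)) *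
        (starRingEnd ℂ) (Complex.exp (-2 * Real.pi * Complex.I * ((inner ℝ ξ z.2 : ℝ) : ℂ))) := by
    intro z
    have h2 : inner ℝ (z.1 - z.2) ξ = inner ℝ ξ z.1 - inner ℝ ξ z.2 := by
      rw [real_inner_comm, inner_sub_right]
    have h3 : (starRingEnd ℂ) 2 = 2 := Complex.conj_ofNat 2
    rw [← Complex.exp_conj, ← Complex.exp_add, h2]
    congr 1
    simp only [map_mul, map_neg, Complex.conj_I, Complex.conj_ofReal, h3]
    push_cast
    ring
  simp only [h1]
  rw [integral_prod_mul (fun x => Complex.exp (-2 * Real.pi * Complex.I * ((inner ℝ ξ x : ℝ) : ℂ)))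
    (fun x => (starRingEnd ℂ) (Complex.exp (-2 * Real.pi * Complex.I * ((inner ℝ ξ x : ℝ) : ℂ)))),
    integral_conj]
  change fourierTransform μ ξ * (starRingEnd ℂ) (fourierTransform μ ξ) = _
  rw [Complex.mul_conj, Complex.normSq_eq_norm_sq, Real.rpow_two]

/-- Fubini and the self-duality of the Gaussian: smoothing at frequency `2^n` becomes an energy at
distance `2^(-n)`. -/
theorem integral_gaussian_energy (n : ℕ) :
    ∫ ξ : Euc k, Real.exp (-((4 ^ n)⁻¹ * ‖ξ‖ ^ 2)) * ‖fourierTransform μ ξ‖ ^ (2 : ℝ) =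
      (Real.pi * 4 ^ n) ^ ((k : ℝ) / 2) *
        ∫ z, Real.exp (-(Real.pi ^ 2 * 4 ^ n * ‖z.1 - z.2‖ ^ 2)) ∂(μ.prod μ) := by
  have hb : 0 < (((4 : ℂ) ^ n)⁻¹).re := by
    have : ((4 : ℂ) ^ n)⁻¹ = (((4 : ℝ) ^ n)⁻¹ : ℝ) := by push_cast; rfl
    rw [this, Complex.ofReal_re]; positivity
  set b : ℂ := ((4 : ℂ) ^ n)⁻¹ with hbdef
  set c : ℂ := -2 * Real.pi * Complex.I with hcdef
  have hg := fun w : Euc k => GaussianFourier.integral_cexp_neg_mul_sq_norm_add hb c w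
  have hexp : ∀ ξ : Euc k, Complex.exp (-b * ‖ξ‖ ^ 2) =
      ((Real.exp (-((4 ^ n)⁻¹ * ‖ξ‖ ^ 2)) : ℝ) : ℂ) := fun ξ => by
    rw [Complex.ofReal_exp]; congr 1; rw [hbdef]; push_cast; ring
  have hint : Integrable (fun ξ : Euc k => Complex.exp (-b * ‖ξ‖ ^ 2)) := by
    simpa using GaussianFourier.integrable_cexp_neg_mul_sq_norm_add hb 0 (0 : Euc k)
  have hprod : Integrable (Function.uncurry fun (z : Euc k × Euc k) (ξ : Euc k) =>
      Complex.exp (-b * ‖ξ‖ ^ 2 + c * ((inner ℝ (z.1 - z.2) ξ : ℝ) : ℂ)))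
      ((μ.prod μ).prod volume) := by
    have h2 : Integrable (fun y : (Euc k × Euc k) × Euc k => Complex.exp (-b * ‖y.2‖ ^ 2))
        ((μ.prod μ).prod volume) := hint.comp_snd (μ.prod μ)
    refine h2.mono (Continuous.aestronglyMeasurable (by unfold Function.uncurry; fun_prop))
      (Eventually.of_forall fun y => ?_)
    rw [Function.uncurry, Complex.exp_add, norm_mul, hcdef, norm_exp_fourier, mul_one]
  have hswap := integral_integral_swap hprod
  simp only [hg] at hswap
  have hR : ∀ ξ : Euc k, ∫ z : Euc k × Euc k, Complex.exp (-b * ‖ξ‖ ^ 2 +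
      c * ((inner ℝ (z.1 - z.2) ξ : ℝ) : ℂ)) ∂(μ.prod μ) =
      ((Real.exp (-((4 ^ n)⁻¹ * ‖ξ‖ ^ 2)) * ‖fourierTransform μ ξ‖ ^ (2 : ℝ) : ℝ) : ℂ) := by
    intro ξ
    simp only [Complex.exp_add]
    rw [integral_const_mul, hcdef, fourierTransform_mul_conj, hexp, Complex.ofReal_mul]
  have hL : ∀ z : Euc k × Euc k, ((Real.pi : ℂ) / b) ^ ((Module.finrank ℝ (Euc k) : ℂ) / 2) *
      Complex.exp (c ^ 2 * ‖z.1 - z.2‖ ^ 2 / (4 * b)) =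
      (((Real.pi * 4 ^ n) ^ ((k : ℝ) / 2) *
        Real.exp (-(Real.pi ^ 2 * 4 ^ n * ‖z.1 - z.2‖ ^ 2)) : ℝ) : ℂ) := by
    intro z
    rw [Complex.ofReal_mul, Complex.ofReal_cpow (by positivity), Complex.ofReal_exp]
    congr 2
    · rw [hbdef]; push_cast; rw [div_inv_eq_mul]
    · simp
    · rw [hbdef, hcdef, mul_pow, mul_pow, Complex.I_sq]; push_cast; field_simp; ring
  simp only [hR, hL] at hswap
  rw [integral_complex_ofReal, integral_complex_ofReal, integral_const_mul] at hswap
  exact_mod_cast hswap.symm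

/-- The sum is the `μ × μ` mass of pairs sharing a cube. Such pairs satisfy `|z₁ - z₂|² ≤ k 4^(-n)`,
so the Gaussian is at least `exp (-π² k)` on them. -/
theorem cubeSum_two_le (n : ℕ) :
    cubeSum μ n 2 ≤ Real.exp (Real.pi ^ 2 * k) *
      ∫ z, Real.exp (-(Real.pi ^ 2 * 4 ^ n * ‖z.1 - z.2‖ ^ 2)) ∂(μ.prod μ) := by
  set A : Set (Euc k × Euc k) := ⋃ m, dyadicCube n m ×ˢ dyadicCube n m with hA
  have hAm : MeasurableSet A :=
    MeasurableSet.iUnion fun m => (measurableSet_dyadicCube n m).prod (measurableSet_dyadicCube n m)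
  have hAμ : cubeSum μ n 2 = (μ.prod μ).real A := by
    rw [measureReal_def, hA, measure_iUnion
      (fun a b hab => (pairwise_disjoint_dyadicCube n hab).set_prod_left _ _)
      (fun m => (measurableSet_dyadicCube n m).prod (measurableSet_dyadicCube n m)),
      ENNReal.tsum_toReal_eq (fun m => measure_ne_top _ _), cubeSum]
    refine tsum_congr fun m => ?_
    rw [Measure.prod_prod, ENNReal.toReal_mul, Real.rpow_two, sq, measureReal_def]
  have hint : Integrable (fun z : Euc k × Euc k =>
      Real.exp (Real.pi ^ 2 * k) * Real.exp (-(Real.pi ^ 2 * 4 ^ n * ‖z.1 - z.2‖ ^ 2)))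
      (μ.prod μ) := by
    refine Integrable.const_mul (Integrable.of_bound (C := 1)
      (Continuous.aestronglyMeasurable (by fun_prop)) (Eventually.of_forall fun z => ?_)) _
    rw [Real.norm_of_nonneg (Real.exp_pos _).le]
    exact Real.exp_le_one_iff.2 (by rw [neg_nonpos]; positivity)
  rw [hAμ, ← integral_const_mul, ← integral_indicator_one hAm]
  refine integral_mono ((integrable_const 1).indicator hAm) hint fun z => ?_
  by_cases hz : z ∈ A
  · rw [indicator_of_mem hz, Pi.one_apply, ← Real.exp_add, Real.one_le_exp_iff]
    obtain ⟨m, hm1, hm2⟩ := mem_iUnion.1 hz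
    have h1 := dist_le_of_dyadicIndex_eq
      ((mem_dyadicCube_iff.1 hm1).trans (mem_dyadicCube_iff.1 hm2).symm)
    rw [dist_eq_norm, le_div_iff₀ (by positivity)] at h1
    have h2 := pow_le_pow_left₀ (by positivity) h1 2
    rw [Real.sq_sqrt (by positivity), mul_pow, ← pow_mul, mul_comm n 2, pow_mul] at h2
    norm_num at h2
    nlinarith [mul_le_mul_of_nonneg_left h2 (sq_nonneg Real.pi)]
  · rw [indicator_of_notMem hz]; positivity

/-- With `κ_2 > k/2` this gives `d_2 + κ_2 > k`, so that `p = 2` is admissible. -/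
theorem fourierLpDim_two_le_lqDim_two (hS : IsCompact μ.support) (hk : 0 < k) :
    fourierLpDim μ 2 ≤ lqDim μ 2 := by
  refine csSup_le ⟨0, isFourierLpExponent_zero μ hk zero_le_two⟩ fun s hs => ?_
  obtain ⟨hs0, hsk, C, hC⟩ := hs
  obtain ⟨C', hC'⟩ := exists_integral_gaussian_le μ hk (by linarith : (k : ℝ) - s ≤ k) hC
  refine le_lqDim_of_cubeSum_le μ hS
    (C := Real.exp (Real.pi ^ 2 * k) * (C' * (Real.pi ^ ((k : ℝ) / 2))⁻¹)) one_lt_two fun n => ?_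
  have h1 := hC' n
  rw [integral_gaussian_energy, Real.mul_rpow Real.pi_pos.le (by positivity)] at h1
  have h4 : ((4 : ℝ) ^ n) ^ ((k : ℝ) / 2) = 2 ^ ((n : ℝ) * k) := by
    rw [show (4 : ℝ) = 2 ^ (2 : ℝ) by norm_num, ← Real.rpow_natCast, ← Real.rpow_mul zero_le_two,
      ← Real.rpow_mul zero_le_two]
    congr 1; ring
  rw [h4] at h1
  refine (cubeSum_two_le μ n).trans ?_
  rw [mul_assoc]
  refine mul_le_mul_of_nonneg_left ?_ (Real.exp_pos _).le
  have h5 : (2 : ℝ) ^ ((n : ℝ) * (k - s)) = 2 ^ ((n : ℝ) * k) * 2 ^ (-(n * (2 - 1) * s)) := by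
    rw [← Real.rpow_add two_pos]; congr 1; ring
  rw [h5] at h1
  have h6 : 0 < Real.pi ^ ((k : ℝ) / 2) := by positivity
  have h7 : (0 : ℝ) < 2 ^ ((n : ℝ) * k) := by positivity
  have h8 : 0 < Real.pi ^ ((k : ℝ) / 2) * 2 ^ ((n : ℝ) * k) := by positivity
  rw [← le_div_iff₀' h8] at h1
  refine h1.trans (le_of_eq ?_)
  field_simp

end

/-! ### The largest decay exponent -/

section
variable {k : ℕ} (μ : Measure (Euc k)) [IsProbabilityMeasure μ]

theorem continuousOn_conjugateDim (hS : IsCompact μ.support) :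
    ContinuousOn (conjugateDim μ) (Icc 1 2) :=
  continuousOn_of_mono_of_div_anti (conjugateDim_nonneg μ hS one_le_two)
    (fun _ _ h h' => conjugateDim_mono μ hS h h') fun _ _ h h' => conjugateDim_div_anti μ hS h h'

theorem continuousOn_fourierLpDim (hk : 0 < k) : ContinuousOn (fourierLpDim μ) (Icc 1 2) :=
  continuousOn_of_mono_of_div_anti (fourierLpDim_nonneg μ 2)
    (fun _ _ h h' => fourierLpDim_mono μ hk (by linarith) h')
    fun _ _ h h' => fourierLpDim_div_anti μ hk (by linarith) h'

theorem two_mem_admissibleExponents (hS : IsCompact μ.support) (hk : 0 < k)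
    (hκ : (k : ℝ) / 2 < fourierLpDim μ 2) : 2 ∈ admissibleExponents μ := by
  refine ⟨by norm_num, ?_⟩
  have h1 := fourierLpDim_two_le_lqDim_two μ hS hk
  rw [conjugateDim, if_neg (by norm_num), show (2 : ℝ) / (2 - 1) = 2 by norm_num]
  linarith

/-- The admissible set need not be closed, so the numerator is truncated at 0: `N/(N+E)` is
continuous on all of `[1,2]`, agrees with `σ_p` at admissible `p` and vanishes elsewhere. It is
positive at `p = 2`, so its maximum over `[1,2]` sits at an admissible point. -/
theorem exists_isGreatest_decayExponent (hS : IsCompact μ.support) (hk : 0 < k)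
    (hκ : (k : ℝ) / 2 < fourierLpDim μ 2) :
    ∃ p ∈ admissibleExponents μ,
      IsGreatest (decayExponent μ '' admissibleExponents μ) (decayExponent μ p) := by
  set N : ℝ → ℝ := fun p => max (conjugateDim μ p + fourierLpDim μ p - k) 0 with hN
  set E : ℝ → ℝ := fun p => 2 * p + 2 * (assouadDim μ.support - conjugateDim μ p) with hE
  have hE0 : ∀ p ∈ Icc (1 : ℝ) 2, 0 < E p := fun p hp => by
    have := conjugateDim_le_assouadDim μ hS hp
    simp only [hE]; linarith [hp.1]
  have hN0 : ∀ p, 0 ≤ N p := fun p => le_max_right _ _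
  have hcd := continuousOn_conjugateDim μ hS
  have hcκ := continuousOn_fourierLpDim μ hk
  have hNc : ContinuousOn N (Icc 1 2) := ((hcd.add hcκ).sub continuousOn_const).sup continuousOn_const
  have hEc : ContinuousOn E (Icc 1 2) :=
    (continuousOn_const.mul continuousOn_id).add
      (continuousOn_const.mul (continuousOn_const.sub hcd))
  have hσc : ContinuousOn (fun p => N p / (N p + E p)) (Icc 1 2) :=
    hNc.div (hNc.add hEc) fun p hp => by linarith [hN0 p, hE0 p hp]
  have hσ : ∀ p ∈ admissibleExponents μ, decayExponent μ p = N p / (N p + E p) := by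
    intro p hp
    have h1 : N p = conjugateDim μ p + fourierLpDim μ p - k := max_eq_left (by linarith [hp.2])
    rw [decayExponent, h1]
    congr 1; simp only [hE]; ring
  obtain ⟨p, hp, hmax⟩ := isCompact_Icc.exists_isMaxOn ⟨1, by norm_num⟩ hσc
  have h2 := two_mem_admissibleExponents μ hS hk hκ
  have hpos : 0 < N p / (N p + E p) := by
    refine lt_of_lt_of_le ?_ (hmax h2.1)
    have h3 : 0 < N 2 := lt_max_of_lt_left (by linarith [h2.2])
    exact div_pos h3 (by linarith [hE0 2 h2.1])
  have hpA : p ∈ admissibleExponents μ := by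
    refine ⟨hp, ?_⟩
    by_contra! hle
    have h3 : N p = 0 := max_eq_right (by linarith)
    rw [h3, zero_div] at hpos
    exact lt_irrefl _ hpos
  refine ⟨p, hpA, ⟨p, hpA, rfl⟩, ?_⟩
  rintro _ ⟨p', hp', rfl⟩
  rw [hσ p hpA, hσ p' hp']
  exact hmax hp'.1

/-- Every number below a decay exponent lies below the larger exponent `N / (2 p' + N)` for some
`p' > 1`, where `N` is the numerator of `σ_{p'}`. -/
theorem exists_one_lt_of_lt_decayExponent (hS : IsCompact μ.support) (hk : 0 < k) {p σ : ℝ}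
    (hp : p ∈ admissibleExponents μ) (hσ0 : 0 < σ) (hσ : σ < decayExponent μ p) :
    ∃ p', 1 < p' ∧ (k : ℝ) < conjugateDim μ p' + fourierLpDim μ p' ∧
      σ * (2 * p' + (conjugateDim μ p' + fourierLpDim μ p' - k)) <
        conjugateDim μ p' + fourierLpDim μ p' - k := by
  set N : ℝ → ℝ := fun p => conjugateDim μ p + fourierLpDim μ p - k with hN
  have hNc : ContinuousOn N (Icc 1 2) :=
    ((continuousOn_conjugateDim μ hS).add (continuousOn_fourierLpDim μ hk)).sub continuousOn_const
  have hHc : ContinuousOn (fun p => N p - σ * (2 * p + N p)) (Icc 1 2) :=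
    hNc.sub (continuousOn_const.mul ((continuousOn_const.mul continuousOn_id).add hNc))
  have hNp : 0 < N p := by simp only [hN]; linarith [hp.2]
  have hpos : 0 < N p - σ * (2 * p + N p) := by
    have h1 := conjugateDim_le_assouadDim μ hS hp.1
    have h3 : 2 * p - k + 2 * assouadDim μ.support + fourierLpDim μ p - conjugateDim μ p =
        N p + 2 * p + 2 * (assouadDim μ.support - conjugateDim μ p) := by simp only [hN]; ring
    rw [decayExponent, h3, lt_div_iff₀ (by linarith [hp.1.1])] at hσ
    change _ < N p at hσ
    nlinarith
  rcases hp.1.1.eq_or_lt with h1 | h1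
  · subst h1
    -- At `p = 1` both inequalities are strict and continuous in the exponent, so they persist
    -- slightly to the right of 1.
    have hev : ∀ᶠ x in 𝓝[>] (1 : ℝ), 0 < N x - σ * (2 * x + N x) ∧ 0 < N x := by
      have h4 := ((hHc 1 (by norm_num)).eventually (lt_mem_nhds hpos)).and
        ((hNc 1 (by norm_num)).eventually (lt_mem_nhds hNp))
      have h5 : 𝓝[Ioc 1 2] (1 : ℝ) ≤ 𝓝[Icc 1 2] 1 := nhdsWithin_mono _ Ioc_subset_Icc_self
      rw [nhdsWithin_Ioc_eq_nhdsGT one_lt_two] at h5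
      exact h5 h4
    obtain ⟨x, hx, hx1⟩ := (hev.and (Ioc_mem_nhdsGT one_lt_two)).exists
    simp only [hN] at hx
    exact ⟨x, hx1.1, by linarith [hx.2], by linarith [hx.1]⟩
  · exact ⟨p, h1, hp.2, by simp only [hN] at hpos; linarith⟩

end

/-! ### Pointwise bounds of the Fourier transform by local averages -/

section
variable {k : ℕ} (μ : Measure (Euc k)) [IsProbabilityMeasure μ]

open scoped SchwartzMap FourierTransform in
-- A bump function ψ equal to 1 on the compact support gives `μ = ψμ`, hence `μ̂ = ψ̂ * μ̂`.
theorem exists_schwartz_reproducing (hS : IsCompact μ.support) :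
    ∃ g : 𝓢(Euc k, ℂ), ∀ η, fourierTransform μ η = ∫ ζ, g ζ * fourierTransform μ (η - ζ) := by
  obtain ⟨R, hR⟩ := hS.isBounded.subset_closedBall 0
  let b : ContDiffBump (0 : Euc k) :=
    ⟨max R 1, max R 1 + 1, lt_max_of_lt_right one_pos, by linarith⟩
  have hb : ∀ x ∈ μ.support, b x = 1 := fun x hx => b.one_of_mem_closedBall
    (Metric.closedBall_subset_closedBall (le_max_left R 1) (hR hx))
  have hcs : HasCompactSupport fun x => (b x : ℂ) :=
    b.hasCompactSupport.comp_left (g := fun y : ℝ => (y : ℂ)) Complex.ofReal_zero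
  let ψ : 𝓢(Euc k, ℂ) := hcs.toSchwartzMap (Complex.ofRealCLM.contDiff.comp b.contDiff)
  have hψ : ∀ x ∈ μ.support, ψ x = 1 := fun x hx => by
    change (b x : ℂ) = 1
    rw [hb x hx, Complex.ofReal_one]
  refine ⟨𝓕 ψ, fun η => ?_⟩
  set g : 𝓢(Euc k, ℂ) := 𝓕 ψ with hg
  have hinv : ∀ x, ψ x = ∫ ζ, Complex.exp (↑(2 * Real.pi * inner ℝ ζ x) * Complex.I) * g ζ := by
    intro x
    have h1 : 𝓕⁻ g = ψ := FourierTransform.fourierInv_fourier_eq ψ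
    rw [← h1, SchwartzMap.fourierInv_coe, Real.fourierInv_eq']
    rfl
  have hae : ∀ᵐ x ∂μ, x ∈ μ.support := Measure.support_mem_ae
  have hint : Integrable (Function.uncurry fun (ζ x : Euc k) =>
      g ζ * Complex.exp (-2 * Real.pi * Complex.I * ((inner ℝ (η - ζ) x : ℝ) : ℂ)))
      (volume.prod μ) := by
    have h2 : Integrable (fun z : Euc k × Euc k => g z.1) (volume.prod μ) :=
      g.integrable.comp_fst μ
    refine h2.mono (Continuous.aestronglyMeasurable ?_) (Eventually.of_forall fun z => ?_)
    · have := g.continuous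
      unfold Function.uncurry; fun_prop
    · rw [Function.uncurry, norm_mul, norm_exp_fourier, mul_one]
  calc fourierTransform μ η
      = ∫ x, Complex.exp (-2 * Real.pi * Complex.I * ((inner ℝ η x : ℝ) : ℂ)) * ψ x ∂μ := by
        refine integral_congr_ae ?_
        filter_upwards [hae] with x hx
        rw [hψ x hx, mul_one]
    _ = ∫ x, (∫ ζ, g ζ * Complex.exp
          (-2 * Real.pi * Complex.I * ((inner ℝ (η - ζ) x : ℝ) : ℂ))) ∂μ := by
        refine integral_congr_ae (Eventually.of_forall fun x => ?_)
        simp only []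
        rw [hinv, ← integral_const_mul]
        refine integral_congr_ae (Eventually.of_forall fun ζ => ?_)
        simp only []
        rw [← mul_assoc, ← Complex.exp_add, mul_comm, inner_sub_left]
        congr 2; push_cast; ring
    _ = ∫ ζ, ∫ x, g ζ * Complex.exp
          (-2 * Real.pi * Complex.I * ((inner ℝ (η - ζ) x : ℝ) : ℂ)) ∂μ :=
        (integral_integral_swap hint).symm
    _ = ∫ ζ, g ζ * fourierTransform μ (η - ζ) := by
        simp only [integral_const_mul]; rfl

/-- Hölder's inequality for the measure `|g|` turns the reproducing formula into a mean value bound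
for `|μ̂|^p`. The part of the convolution beyond radius `t` is negligible by the Schwartz decay of
`g`. -/
theorem exists_norm_fourierTransform_rpow_le (hS : IsCompact μ.support) {p : ℝ} (hp : 1 < p)
    (M : ℕ) : ∃ C : ℝ, 0 ≤ C ∧ ∀ (η : Euc k) (t : ℝ), 0 < t →
      ‖fourierTransform μ η‖ ^ p ≤
        C * (∫ ζ in Metric.ball η t, ‖fourierTransform μ ζ‖ ^ p) + C * (t ^ M)⁻¹ := by
  obtain ⟨g, hg⟩ := exists_schwartz_reproducing μ hS
  have hp0 : 0 < p := by linarith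
  obtain ⟨B, hB0, hB⟩ : ∃ B : ℝ, 0 < B ∧ ∀ ζ, ‖g ζ‖ ≤ B := by
    obtain ⟨B, hB, h⟩ := g.decay 0 0
    exact ⟨B, hB, fun ζ => by simpa using h ζ⟩
  set W := ∫ ζ, ‖g ζ‖ with hW
  have hW0 : 0 ≤ W := integral_nonneg fun _ => norm_nonneg _
  set q := p.conjExponent with hq
  have hpq : p.HolderConjugate q := Real.HolderConjugate.conjExponent hp
  have hq0 : 0 < q := hpq.symm.pos
  have hIM : Integrable fun ζ => ‖ζ‖ ^ M * ‖g ζ‖ := g.integrable_pow_mul volume M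
  set I := ∫ ζ, ‖ζ‖ ^ M * ‖g ζ‖ with hI
  have hI0 : 0 ≤ I := integral_nonneg fun _ => by positivity
  refine ⟨W ^ (p / q) * (B + I), by positivity, fun η t ht => ?_⟩
  set h : Euc k → ℝ := fun ζ => ‖fourierTransform μ (η - ζ)‖ with hh
  have hhc : Continuous h := ((continuous_fourierTransform μ).comp (by fun_prop)).norm
  have hh0 : ∀ ζ, 0 ≤ h ζ := fun _ => norm_nonneg _
  have hh1 : ∀ ζ, h ζ ≤ 1 := fun _ => norm_fourierTransform_le_one μ _
  have hgc : Continuous fun ζ => ‖g ζ‖ := g.continuous.norm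
  have hwh : Integrable fun ζ => ‖g ζ‖ * h ζ ^ p := by
    refine g.integrable.norm.mono (Continuous.aestronglyMeasurable
      (hgc.mul (hhc.rpow_const fun _ => Or.inr hp0.le))) (Eventually.of_forall fun ζ => ?_)
    rw [norm_mul, Real.norm_of_nonneg (Real.rpow_nonneg (hh0 ζ) p)]
    exact mul_le_of_le_one_right (norm_nonneg _) (Real.rpow_le_one (hh0 ζ) (hh1 ζ) hp0.le)
  have hf1 : ∀ ζ, (‖g ζ‖ ^ p⁻¹ * h ζ) ^ p = ‖g ζ‖ * h ζ ^ p := fun ζ => by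
    rw [Real.mul_rpow (by positivity) (hh0 ζ), ← Real.rpow_mul (norm_nonneg _),
      inv_mul_cancel₀ hp0.ne', Real.rpow_one]
  have hf2 : ∀ ζ, (‖g ζ‖ ^ q⁻¹) ^ q = ‖g ζ‖ := fun ζ => by
    rw [← Real.rpow_mul (norm_nonneg _), inv_mul_cancel₀ hq0.ne', Real.rpow_one]
  have hm1 : MemLp (fun ζ => ‖g ζ‖ ^ p⁻¹ * h ζ) (ENNReal.ofReal p) := by
    refine (integrable_norm_rpow_iff (Continuous.aestronglyMeasurable
      ((hgc.rpow_const fun _ => Or.inr (by positivity)).mul hhc)) (by simpa using hp0)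
      ENNReal.ofReal_ne_top).1 ?_
    refine hwh.congr (Eventually.of_forall fun ζ => ?_)
    change _ = ‖‖g ζ‖ ^ p⁻¹ * h ζ‖ ^ _
    rw [ENNReal.toReal_ofReal hp0.le, Real.norm_of_nonneg (mul_nonneg (by positivity) (hh0 ζ)), hf1]
  have hm2 : MemLp (fun ζ => ‖g ζ‖ ^ q⁻¹) (ENNReal.ofReal q) := by
    refine (integrable_norm_rpow_iff (Continuous.aestronglyMeasurable
      (hgc.rpow_const fun _ => Or.inr (by positivity))) (by simpa using hq0)
      ENNReal.ofReal_ne_top).1 ?_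
    refine g.integrable.norm.congr (Eventually.of_forall fun ζ => ?_)
    simp only []
    rw [ENNReal.toReal_ofReal hq0.le, Real.norm_of_nonneg (by positivity), hf2]
  have hH := integral_mul_le_Lp_mul_Lq_of_nonneg hpq
    (Eventually.of_forall fun ζ => mul_nonneg (by positivity) (hh0 ζ))
    (Eventually.of_forall fun ζ => by positivity) hm1 hm2
  simp only [hf1, hf2] at hH
  have hprod : ∀ ζ, ‖g ζ‖ ^ p⁻¹ * h ζ * ‖g ζ‖ ^ q⁻¹ = ‖g ζ‖ * h ζ := fun ζ => by
    rw [mul_right_comm, ← Real.rpow_add_of_nonneg (norm_nonneg _) (by positivity) (by positivity),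
      hpq.inv_add_inv_eq_one, Real.rpow_one]
  simp only [hprod] at hH
  have hF : ‖fourierTransform μ η‖ ≤ ∫ ζ, ‖g ζ‖ * h ζ := by
    rw [hg η]
    refine (norm_integral_le_integral_norm _).trans (le_of_eq ?_)
    simp only [norm_mul, hh]
  have hJ0 : 0 ≤ ∫ ζ, ‖g ζ‖ * h ζ ^ p :=
    integral_nonneg fun ζ => mul_nonneg (norm_nonneg _) (Real.rpow_nonneg (hh0 ζ) p)
  have hFp : ‖fourierTransform μ η‖ ^ p ≤ W ^ (p / q) * ∫ ζ, ‖g ζ‖ * h ζ ^ p := by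
    refine (Real.rpow_le_rpow (norm_nonneg _) (hF.trans hH) hp0.le).trans (le_of_eq ?_)
    rw [Real.mul_rpow (by positivity) (by positivity), ← Real.rpow_mul hJ0, ← Real.rpow_mul hW0,
      one_div_mul_cancel hp0.ne', Real.rpow_one, mul_comm, one_div_mul_eq_div]
  set T : Set (Euc k) := Metric.ball η t with hT
  set ind : Euc k → ℝ := T.indicator fun ζ => ‖fourierTransform μ ζ‖ ^ p with hind
  have hindI : Integrable ind :=
    (integrable_indicator_iff Metric.isOpen_ball.measurableSet).2
      (integrableOn_norm_fourierTransform_rpow μ hp0.le η t)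
  have hindI' : Integrable fun ζ => ind (η - ζ) := hindI.comp_sub_left η
  have hpt : ∀ ζ, ‖g ζ‖ * h ζ ^ p ≤ B * ind (η - ζ) + (t ^ M)⁻¹ * (‖ζ‖ ^ M * ‖g ζ‖) := by
    intro ζ
    have hhp : 0 ≤ h ζ ^ p := Real.rpow_nonneg (hh0 ζ) p
    by_cases hζ : ‖ζ‖ < t
    · have : ind (η - ζ) = h ζ ^ p := indicator_of_mem (by simpa [hT] using hζ) _
      rw [this]
      have h2 := mul_le_mul_of_nonneg_right (hB ζ) hhp
      have h3 : 0 ≤ (t ^ M)⁻¹ * (‖ζ‖ ^ M * ‖g ζ‖) := by positivity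
      linarith
    · have : ind (η - ζ) = 0 := indicator_of_notMem (by simpa [hT] using hζ) _
      rw [this, mul_zero, zero_add, ← mul_assoc]
      have h2 : 1 ≤ (t ^ M)⁻¹ * ‖ζ‖ ^ M := by
        rw [inv_mul_eq_div, one_le_div (by positivity)]
        exact pow_le_pow_left₀ ht.le (not_lt.1 hζ) M
      calc ‖g ζ‖ * h ζ ^ p ≤ ‖g ζ‖ :=
            mul_le_of_le_one_right (norm_nonneg _) (Real.rpow_le_one (hh0 ζ) (hh1 ζ) hp0.le)
        _ ≤ _ := le_mul_of_one_le_left (norm_nonneg _) h2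
  have hJ : ∫ ζ, ‖g ζ‖ * h ζ ^ p ≤
      B * (∫ ζ in T, ‖fourierTransform μ ζ‖ ^ p) + (t ^ M)⁻¹ * I := by
    refine (integral_mono hwh ((hindI'.const_mul B).add (hIM.const_mul _)) hpt).trans (le_of_eq ?_)
    simp only [Pi.add_apply]
    rw [integral_add (hindI'.const_mul B) (hIM.const_mul _), integral_const_mul,
      integral_const_mul, integral_sub_left_eq_self ind volume η,
      integral_indicator Metric.isOpen_ball.measurableSet]
  have hA0 : 0 ≤ ∫ ζ in T, ‖fourierTransform μ ζ‖ ^ p := integral_nonneg fun _ => by positivity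
  have hWp : 0 ≤ W ^ (p / q) := by positivity
  refine hFp.trans ((mul_le_mul_of_nonneg_left hJ hWp).trans ?_)
  have ht0 : 0 ≤ (t ^ M)⁻¹ := by positivity
  have : W ^ (p / q) * (B + I) * (∫ ζ in T, ‖fourierTransform μ ζ‖ ^ p) +
      W ^ (p / q) * (B + I) * (t ^ M)⁻¹ =
      W ^ (p / q) * (B * (∫ ζ in T, ‖fourierTransform μ ζ‖ ^ p) + (t ^ M)⁻¹ * I) +
      W ^ (p / q) * (I * (∫ ζ in T, ‖fourierTransform μ ζ‖ ^ p) + B * (t ^ M)⁻¹) := by ring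
  rw [this]
  exact le_add_of_nonneg_right (by positivity)

end

/-! ### Averages of the Fourier transform along a locally expanding map -/

/-- Bounded overlap: `A` bounds the number of sets `B m` through a single point. -/
theorem sum_setIntegral_le {α ι : Type*} [MeasurableSpace α] {ν : Measure α} (Z : Finset ι)
    (B : ι → Set α) (V : Set α) (hB : ∀ m ∈ Z, B m ⊆ V) (hBm : ∀ m, MeasurableSet (B m))
    {H : α → ℝ} (hH0 : ∀ x, 0 ≤ H x) (hH : IntegrableOn H V ν) {A : ℝ}
    (hA : ∀ x, ∀ Z' ⊆ Z, (∀ m ∈ Z', x ∈ B m) → (Z'.card : ℝ) ≤ A) :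
    ∑ m ∈ Z, ∫ x in B m, H x ∂ν ≤ A * ∫ x in V, H x ∂ν := by
  classical
  have h1 : ∀ m ∈ Z, ∫ x in B m, H x ∂ν = ∫ x in V, (B m).indicator H x ∂ν := fun m hm => by
    rw [setIntegral_indicator (hBm m), inter_eq_self_of_subset_right (hB m hm)]
  have hint : ∀ m ∈ Z, Integrable ((B m).indicator H) (ν.restrict V) := fun m _ =>
    hH.indicator (hBm m)
  rw [Finset.sum_congr rfl h1, ← integral_finsetSum _ hint, ← integral_const_mul]
  refine integral_mono (integrable_finsetSum _ hint) (hH.const_mul A) fun x => ?_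
  have h2 : ∑ m ∈ Z, (B m).indicator H x = (Z.filter fun m => x ∈ B m).card * H x := by
    simp only [indicator_apply]
    rw [← Finset.sum_filter, Finset.sum_const, nsmul_eq_mul]
  simp only []
  rw [h2]
  exact mul_le_mul_of_nonneg_right
    (hA x _ (Finset.filter_subset _ _) fun m hm => (Finset.mem_filter.1 hm).2) (hH0 x)

section
variable {k : ℕ} (μ : Measure (Euc k)) [IsProbabilityMeasure μ]

/-- Each value is replaced by an integral over a ball of radius `t = R^ε`. If several such balls
share a point, their centres are within `2t`, so the corresponding `y m` are within `2t/(cR)` and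
occupy `O(t^k)` cubes. This overlap is the loss `R^(kε)`. -/
theorem exists_sum_norm_fourierTransform_rpow_le (hS : IsCompact μ.support) {p s ε b c R₀ : ℝ}
    (hp : 1 < p) (hs : IsFourierLpExponent μ p s) (hε : 0 < ε) (hε1 : ε ≤ 1) (hb : 0 ≤ b)
    (hc : 0 < c) (hR₀ : 0 ≤ R₀) :
    ∃ C : ℝ, 0 ≤ C ∧ ∀ (n : ℕ) (R : ℝ), 1 ≤ R → 2 ^ n ≤ R → ∀ (Z : Finset (Fin k → ℤ))
      (y η : (Fin k → ℤ) → Euc k), Z ⊆ cubesNear n 0 R₀ → (∀ m ∈ Z, dyadicIndex n (y m) = m) →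
      (∀ m ∈ Z, ‖η m‖ ≤ b * R) →
      (∀ m ∈ Z, ∀ m' ∈ Z, c * R * ‖y m - y m'‖ ≤ ‖η m - η m'‖) →
      ∑ m ∈ Z, ‖fourierTransform μ (η m)‖ ^ p ≤ C * R ^ (k * ε + (k - s)) := by
  -- Chosen so that the tail `t^(-M) ≤ R^(-k)` outweighs the `O(R^k)` cubes in the sum.
  obtain ⟨M, hM⟩ := exists_nat_ge (k / ε)
  rw [div_le_iff₀ hε] at hM
  obtain ⟨C₁, hC₁, hsub⟩ := exists_norm_fourierTransform_rpow_le μ hS hp M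
  obtain ⟨hs0, hsk, C₂, hC₂⟩ := hs
  have hC₂0 : 0 ≤ C₂ := by
    have h := hC₂ 1 one_pos
    rw [Real.one_rpow, mul_one] at h
    exact le_trans (integral_nonneg fun _ => by positivity) h
  set A : ℝ := (4 / c + 2) ^ k with hA
  refine ⟨C₁ * (A * (C₂ * (b + 1) ^ (k - s))) + (2 * R₀ + 2) ^ k * C₁, by positivity, ?_⟩
  intro n R hR hn Z y η hZ hy hη hsep
  have hR0 : 0 < R := by linarith
  set t := R ^ ε with ht
  have ht1 : 1 ≤ t := Real.one_le_rpow hR hε.le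
  have htR : t ≤ R := by
    simpa using Real.rpow_le_rpow_of_exponent_le hR hε1
  have htk : t ^ k = R ^ (k * ε) := by
    rw [ht, ← Real.rpow_natCast, ← Real.rpow_mul hR0.le]; congr 1; ring
  have hsum1 : ∑ m ∈ Z, ‖fourierTransform μ (η m)‖ ^ p ≤
      C₁ * (∑ m ∈ Z, ∫ ζ in Metric.ball (η m) t, ‖fourierTransform μ ζ‖ ^ p) +
        Z.card * (C₁ * (t ^ M)⁻¹) := by
    rw [Finset.mul_sum, ← nsmul_eq_mul, ← Finset.sum_const, ← Finset.sum_add_distrib]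
    exact Finset.sum_le_sum fun m _ => hsub (η m) t (by linarith)
  have hcard : (Z.card : ℝ) ≤ (2 * R₀ + 2) ^ k * R ^ k := by
    refine (Nat.cast_le.2 (Finset.card_le_card hZ)).trans ((card_cubesNear_le n 0 hR₀).trans ?_)
    rw [← mul_pow]
    refine pow_le_pow_left₀ (by positivity) ?_ k
    nlinarith
  have htail : R ^ k * (t ^ M)⁻¹ ≤ 1 := by
    rw [← div_eq_mul_inv, div_le_one (by positivity), ht, ← Real.rpow_natCast, ← Real.rpow_natCast,
      ← Real.rpow_mul hR0.le]
    exact Real.rpow_le_rpow_of_exponent_le hR (by linarith)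
  have hmult : ∑ m ∈ Z, ∫ ζ in Metric.ball (η m) t, ‖fourierTransform μ ζ‖ ^ p ≤
      (A * t ^ k) * ∫ ζ in Metric.ball (0 : Euc k) ((b + 1) * R), ‖fourierTransform μ ζ‖ ^ p := by
    refine sum_setIntegral_le Z (fun m => Metric.ball (η m) t) _ (fun m hm => ?_)
      (fun m => Metric.isOpen_ball.measurableSet)
      (fun _ => by positivity)
      (integrableOn_norm_fourierTransform_rpow μ (by linarith) 0 _) fun x Z' hZ' hx => ?_
    · refine Metric.ball_subset_ball' ?_
      rw [dist_zero_right]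
      have := hη m hm
      linarith
    · rcases Z'.eq_empty_or_nonempty with rfl | ⟨m₀, hm₀⟩
      · simp only [Finset.card_empty, Nat.cast_zero]; positivity
      have hsubset : Z' ⊆ cubesNear n (y m₀) (2 * t / (c * R)) := by
        intro m hm
        rw [← hy m (hZ' hm)]
        refine dyadicIndex_mem_cubesNear ?_
        rw [dist_eq_norm, le_div_iff₀ (by positivity), mul_comm]
        refine (hsep m (hZ' hm) m₀ (hZ' hm₀)).trans ?_
        rw [← dist_eq_norm]
        have h1 := Metric.mem_ball.1 (hx m hm)
        have h2 := Metric.mem_ball.1 (hx m₀ hm₀)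
        rw [dist_comm] at h1
        linarith [dist_triangle (η m) x (η m₀)]
      refine (Nat.cast_le.2 (Finset.card_le_card hsubset)).trans
        ((card_cubesNear_le n _ (by positivity)).trans ?_)
      rw [hA, ← mul_pow]
      refine pow_le_pow_left₀ (by positivity) ?_ k
      have h3 : 2 ^ n * (2 * t / (c * R)) ≤ 2 * t / c := by
        rw [mul_div_assoc', div_le_div_iff₀ (by positivity) hc]
        have : 0 ≤ 2 * t * c := by positivity
        nlinarith
      have h4 : (4 / c + 2) * t = 2 * (2 * t / c) + 2 * t := by ring
      linarith
  have hball := hC₂ ((b + 1) * R) (by positivity)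
  rw [Real.mul_rpow (by positivity) hR0.le] at hball
  have hRexp : 1 ≤ R ^ (k * ε + (k - s)) :=
    Real.one_le_rpow hR (add_nonneg (by positivity) (by linarith))
  have hAt : 0 ≤ A * t ^ k := by positivity
  calc ∑ m ∈ Z, ‖fourierTransform μ (η m)‖ ^ p
      ≤ C₁ * (A * t ^ k * (C₂ * ((b + 1) ^ (k - s) * R ^ (k - s)))) +
          ((2 * R₀ + 2) ^ k * R ^ k) * (C₁ * (t ^ M)⁻¹) := by
        refine hsum1.trans (add_le_add (mul_le_mul_of_nonneg_left
          (hmult.trans (mul_le_mul_of_nonneg_left hball hAt)) hC₁) ?_)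
        exact mul_le_mul_of_nonneg_right hcard (by positivity)
    _ = C₁ * (A * (C₂ * (b + 1) ^ (k - s))) * R ^ (k * ε + (k - s)) +
          (2 * R₀ + 2) ^ k * C₁ * (R ^ k * (t ^ M)⁻¹) := by
        rw [Real.rpow_add hR0, ← htk]; ring
    _ ≤ C₁ * (A * (C₂ * (b + 1) ^ (k - s))) * R ^ (k * ε + (k - s)) +
          (2 * R₀ + 2) ^ k * C₁ * R ^ (k * ε + (k - s)) := by
        refine add_le_add le_rfl (mul_le_mul_of_nonneg_left (htail.trans hRexp) (by positivity))
    _ = _ := by ring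

/-- Hölder's inequality over the dyadic cubes of level `n` with `2^n ≤ |ρ| < 2^(n+1)` separates the
masses of the cubes from the values of μ̂ at one frequency per cube. -/
theorem exists_setIntegral_norm_fourierTransform_le (hS : IsCompact μ.support) {p s ε τ c : ℝ}
    (hp : 1 < p) (hs : IsFourierLpExponent μ p s) (hε : 0 < ε) (hε1 : ε ≤ 1) (hτ0 : 0 ≤ τ)
    (hτ : τ < conjugateDim μ p) {G : Euc k → Euc k} (hG : Continuous G) {U : Set (Euc k)}
    (hU : MeasurableSet U) (hc : 0 < c) (hGU : ∀ x ∈ U, ∀ y ∈ U, c * ‖x - y‖ ≤ ‖G x - G y‖) :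
    ∃ C : ℝ, 0 ≤ C ∧ ∀ (O : Euc k ≃ₗᵢ[ℝ] Euc k) (ρ : ℝ), 1 ≤ |ρ| →
      ∫ y in U ∩ μ.support, ‖fourierTransform μ (ρ • O (G y))‖ ∂μ ≤
        C * |ρ| ^ ((k * ε + (k - s) - τ) / p) := by
  classical
  have hp1 : 0 < p - 1 := by linarith
  have hp0 : 0 < p := by linarith
  set q := p / (p - 1) with hq
  have hq1 : 1 < q := (one_lt_div hp1).2 (by linarith)
  have hqp : q.HolderConjugate p := (Real.HolderConjugate.conjExponent hp).symm
  have hq0 : 0 < q := by linarith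
  rw [conjugateDim, if_neg hp.ne'] at hτ
  obtain ⟨C₁, hC₁, hcube⟩ := exists_cubeSum_le_of_lt_lqDim μ hq1 hτ
  obtain ⟨R₀, hR₀, hSR⟩ : ∃ R₀ : ℝ, 0 ≤ R₀ ∧ μ.support ⊆ Metric.closedBall 0 R₀ := by
    obtain ⟨R₀, h⟩ := hS.isBounded.subset_closedBall (0 : Euc k)
    exact ⟨max R₀ 0, le_max_right _ _,
      h.trans (Metric.closedBall_subset_closedBall (le_max_left _ _))⟩
  obtain ⟨b, hb, hGb⟩ : ∃ b : ℝ, 0 ≤ b ∧ ∀ x ∈ μ.support, ‖G x‖ ≤ b := by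
    obtain ⟨b, hb⟩ := hS.exists_bound_of_continuousOn hG.continuousOn
    exact ⟨max b 0, le_max_right _ _, fun x hx => (hb x hx).trans (le_max_left _ _)⟩
  obtain ⟨C₂, hC₂, hsum⟩ :=
    exists_sum_norm_fourierTransform_rpow_le μ hS hp hs hε hε1 hb hc hR₀
  refine ⟨(C₁ * 2 ^ ((q - 1) * τ)) ^ (1 / q) * C₂ ^ (1 / p), by positivity, fun O ρ hρ => ?_⟩
  set R := |ρ| with hR
  have hR0 : 0 < R := by linarith
  obtain ⟨n, hn1, hn2⟩ := exists_nat_pow_near hρ one_lt_two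
  set V := U ∩ μ.support with hV
  have hVm : MeasurableSet V := hU.inter Measure.isClosed_support.measurableSet
  set H : Euc k → ℝ := fun y => ‖fourierTransform μ (ρ • O (G y))‖ with hH
  have hHc : Continuous H := by
    have h1 := continuous_fourierTransform μ
    have h2 := O.continuous
    simp only [hH]; fun_prop
  have hHi : Integrable H μ := Integrable.of_bound (C := 1) hHc.aestronglyMeasurable
    (Eventually.of_forall fun y => by
      rw [Real.norm_of_nonneg (norm_nonneg _)]; exact norm_fourierTransform_le_one μ _)
  set Z₀ := cubesNear n (0 : Euc k) R₀ with hZ₀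
  set D : (Fin k → ℤ) → Set (Euc k) := fun m => dyadicCube n m ∩ V with hD
  have hDm : ∀ m, MeasurableSet (D m) := fun m => (measurableSet_dyadicCube n m).inter hVm
  -- Null pieces are dropped because the sample point is chosen by comparison with an average.
  set Z := Z₀.filter fun m => μ (D m) ≠ 0 with hZ
  have hVeq : V = ⋃ m ∈ Z₀, D m := by
    refine Subset.antisymm (fun x hx => ?_) (iUnion₂_subset fun m _ => inter_subset_right)
    exact mem_iUnion₂.2 ⟨dyadicIndex n x,
      dyadicIndex_mem_cubesNear (Metric.mem_closedBall.1 (hSR hx.2)), mem_dyadicCube_iff.2 rfl, hx⟩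
  have hsplit : ∫ y in V, H y ∂μ = ∑ m ∈ Z, ∫ y in D m, H y ∂μ := by
    rw [hVeq, integral_biUnion_finset Z₀ (fun m _ => hDm m)
      (fun a _ a' _ haa' => ((pairwise_disjoint_dyadicCube n haa').mono inter_subset_left
        inter_subset_left)) (fun m _ => hHi.integrableOn), hZ, Finset.sum_filter]
    refine Finset.sum_congr rfl fun m _ => ?_
    split_ifs with h
    · rfl
    · rw [setIntegral_measure_zero _ (not_not.1 h)]
  -- Some point of the piece has a value of `H` at least its average there.
  have hex : ∀ m, ∃ y, m ∈ Z → y ∈ D m ∧ ∫ y in D m, H y ∂μ ≤ μ.real (dyadicCube n m) * H y := by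
    intro m
    by_cases hm : m ∈ Z
    · have hm0 : μ (D m) ≠ 0 := (Finset.mem_filter.1 hm).2
      obtain ⟨y, hy, hle⟩ := exists_setAverage_le hm0 (measure_ne_top _ _) hHi.integrableOn
      refine ⟨y, fun _ => ⟨hy, ?_⟩⟩
      rw [setAverage_eq, smul_eq_mul, measureReal_def, inv_mul_le_iff₀ (ENNReal.toReal_pos hm0 (measure_ne_top _ _))]
        at hle
      exact hle.trans (mul_le_mul_of_nonneg_right
        (measureReal_mono inter_subset_left (measure_ne_top _ _)) (norm_nonneg _))
    · exact ⟨0, fun h => absurd h hm⟩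
  choose y hy using hex
  have hbound := hsum n R hρ hn1 Z y (fun m => ρ • O (G (y m))) (Finset.filter_subset _ _)
    (fun m hm => mem_dyadicCube_iff.1 (hy m hm).1.1)
    (fun m hm => by
      rw [norm_smul, LinearIsometryEquiv.norm_map, Real.norm_eq_abs, mul_comm]
      exact mul_le_mul_of_nonneg_right (hGb _ (hy m hm).1.2.2) hR0.le)
    (fun m hm m' hm' => by
      rw [← smul_sub, ← map_sub, norm_smul, LinearIsometryEquiv.norm_map, Real.norm_eq_abs,
        mul_comm c, mul_assoc]
      exact mul_le_mul_of_nonneg_left (hGU _ (hy m hm).1.2.1 _ (hy m' hm').1.2.1) hR0.le)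
  have hμq : ∑ m ∈ Z, |μ.real (dyadicCube n m)| ^ q ≤
      C₁ * 2 ^ ((q - 1) * τ) * R ^ (-((q - 1) * τ)) := by
    simp only [abs_of_nonneg measureReal_nonneg]
    refine ((summable_cubeSum μ n hq1.le).sum_le_tsum _ fun _ _ => by positivity).trans
      ((hcube n).trans ?_)
    rw [mul_assoc C₁]
    refine mul_le_mul_of_nonneg_left ?_ hC₁.le
    have hτq : 0 ≤ (q - 1) * τ := mul_nonneg (by linarith) hτ0
    have h1 : (2 : ℝ) ^ (-(n * (q - 1) * τ)) = ((2 ^ n) ^ ((q - 1) * τ))⁻¹ := by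
      rw [Real.rpow_neg zero_le_two, ← Real.rpow_natCast, ← Real.rpow_mul zero_le_two, mul_assoc]
    rw [h1, Real.rpow_neg hR0.le, ← div_eq_mul_inv, inv_le_comm₀ (by positivity) (by positivity),
      inv_div, ← Real.div_rpow hR0.le zero_le_two]
    refine Real.rpow_le_rpow (by positivity) ?_ hτq
    rw [pow_succ] at hn2
    linarith
  have hHp : ∑ m ∈ Z, |H (y m)| ^ p ≤ C₂ * R ^ (k * ε + (k - s)) := by
    simp only [hH, abs_norm]; exact hbound
  have hexp1 : (R ^ (-((q - 1) * τ))) ^ (1 / q) = R ^ (-τ / p) := by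
    rw [← Real.rpow_mul hR0.le]; congr 1
    rw [hq]; field_simp; ring
  have hexp2 : (R ^ (k * ε + (k - s))) ^ (1 / p) = R ^ ((k * ε + (k - s)) / p) := by
    rw [← Real.rpow_mul hR0.le, mul_one_div]
  calc ∫ y in V, H y ∂μ = ∑ m ∈ Z, ∫ y in D m, H y ∂μ := hsplit
    _ ≤ ∑ m ∈ Z, μ.real (dyadicCube n m) * H (y m) :=
        Finset.sum_le_sum fun m hm => (hy m hm).2
    _ ≤ (∑ m ∈ Z, |μ.real (dyadicCube n m)| ^ q) ^ (1 / q) * (∑ m ∈ Z, |H (y m)| ^ p) ^ (1 / p) :=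
        Real.inner_le_Lp_mul_Lq Z _ _ hqp
    _ ≤ (C₁ * 2 ^ ((q - 1) * τ) * R ^ (-((q - 1) * τ))) ^ (1 / q) *
          (C₂ * R ^ (k * ε + (k - s))) ^ (1 / p) := by
        gcongr
    _ = (C₁ * 2 ^ ((q - 1) * τ)) ^ (1 / q) * C₂ ^ (1 / p) *
          (R ^ (-τ / p) * R ^ ((k * ε + (k - s)) / p)) := by
        rw [Real.mul_rpow (by positivity) (by positivity), Real.mul_rpow hC₂ (by positivity),
          hexp1, hexp2]
        ring
    _ = _ := by
        rw [← Real.rpow_add hR0]; congr 2; ring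

/-- Decay of the averages of `|μ̂|` along dilations of a locally expanding map. -/
theorem exists_integral_norm_fourierTransform_le (hS : IsCompact μ.support) (hk : 0 < k) {p a : ℝ}
    (hp : 1 < p) (hN : (k : ℝ) < conjugateDim μ p + fourierLpDim μ p)
    (ha : a * p < conjugateDim μ p + fourierLpDim μ p - k) {G : Euc k → Euc k} (hG : Continuous G)
    (hGloc : ∀ x ∈ μ.support, ∃ r > 0, ∃ c > 0, ∀ y ∈ Metric.ball x r, ∀ z ∈ Metric.ball x r,
      c * ‖y - z‖ ≤ ‖G y - G z‖) :
    ∃ C : ℝ, 0 ≤ C ∧ ∀ (O : Euc k ≃ₗᵢ[ℝ] Euc k) (ρ : ℝ), 1 ≤ |ρ| →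
      ∫ y, ‖fourierTransform μ (ρ • O (G y))‖ ∂μ ≤ C * |ρ| ^ (-a) := by
  have hp0 : 0 < p := by linarith
  have hk0 : (0 : ℝ) < k := by exact_mod_cast hk
  set N := conjugateDim μ p + fourierLpDim μ p - k with hNdef
  have hN0 : 0 < N := by simp only [hNdef]; linarith
  -- The slack is shared by three losses, each at most `δ`: in `s`, in `kε` and in `τ`. The bound
  -- `3δ ≤ N`, with `κ_p ≤ k`, keeps `τ` nonnegative.
  set δ := min (N - a * p) N / 3 with hδ
  have hδ0 : 0 < δ := by
    have : 0 < min (N - a * p) N := lt_min (by linarith) hN0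
    positivity
  have hδ1 : 3 * δ ≤ N - a * p := by
    have := min_le_left (N - a * p) N
    simp only [hδ]; linarith
  have hδ2 : 3 * δ ≤ N := by
    have := min_le_right (N - a * p) N
    simp only [hδ]; linarith
  have hκk : fourierLpDim μ p ≤ k :=
    csSup_le ⟨0, isFourierLpExponent_zero μ hk hp0.le⟩ fun s hs => hs.2.1.le
  obtain ⟨s, hs, hsκ⟩ := exists_lt_of_lt_csSup (s := {s | IsFourierLpExponent μ p s})
    ⟨0, isFourierLpExponent_zero μ hk hp0.le⟩
    (show fourierLpDim μ p - δ < sSup {s | IsFourierLpExponent μ p s} from sub_lt_self _ hδ0)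
  set ε := min 1 (δ / k) with hε
  have hε0 : 0 < ε := lt_min one_pos (by positivity)
  have hεk : k * ε ≤ δ := by
    have := mul_le_mul_of_nonneg_left (min_le_right 1 (δ / k)) hk0.le
    rwa [mul_div_cancel₀ _ hk0.ne'] at this
  set τ := conjugateDim μ p - δ with hτ
  have hτ0 : 0 ≤ τ := by simp only [hτ]; linarith
  choose! r hr c hc hGc using hGloc
  obtain ⟨T, hTS, hT⟩ := hS.elim_nhds_subcover (fun x => Metric.ball x (r x))
    fun x hx => Metric.ball_mem_nhds x (hr x hx)
  have hloc : ∀ x ∈ T, ∃ C : ℝ, 0 ≤ C ∧ ∀ (O : Euc k ≃ₗᵢ[ℝ] Euc k) (ρ : ℝ), 1 ≤ |ρ| →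
      ∫ y in Metric.ball x (r x) ∩ μ.support, ‖fourierTransform μ (ρ • O (G y))‖ ∂μ ≤
        C * |ρ| ^ ((k * ε + (k - s) - τ) / p) := fun x hx =>
    exists_setIntegral_norm_fourierTransform_le μ hS hp hs hε0 (min_le_left _ _) hτ0
      (by simp only [hτ]; linarith) hG Metric.isOpen_ball.measurableSet (hc x (hTS x hx))
      (hGc x (hTS x hx))
  choose! C hC0 hC using hloc
  refine ⟨∑ x ∈ T, C x, Finset.sum_nonneg hC0, fun O ρ hρ => ?_⟩
  set H : Euc k → ℝ := fun y => ‖fourierTransform μ (ρ • O (G y))‖ with hH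
  have hHc : Continuous H := by
    have h1 := continuous_fourierTransform μ
    have h2 := O.continuous
    simp only [hH]; fun_prop
  have hHi : Integrable H μ := Integrable.of_bound (C := 1) hHc.aestronglyMeasurable
    (Eventually.of_forall fun y => by
      rw [Real.norm_of_nonneg (norm_nonneg _)]; exact norm_fourierTransform_le_one μ _)
  have hmeas : ∀ x, MeasurableSet (Metric.ball x (r x) ∩ μ.support) := fun x =>
    Metric.isOpen_ball.measurableSet.inter Measure.isClosed_support.measurableSet
  calc ∫ y, H y ∂μ
      ≤ ∫ y, ∑ x ∈ T, (Metric.ball x (r x) ∩ μ.support).indicator H y ∂μ := by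
        refine integral_mono_ae hHi (integrable_finsetSum _ fun x _ => hHi.indicator (hmeas x)) ?_
        filter_upwards [Measure.support_mem_ae (μ := μ)] with y hy
        obtain ⟨x, hx, hyx⟩ := mem_iUnion₂.1 (hT hy)
        have h1 := Finset.single_le_sum
          (f := fun x => (Metric.ball x (r x) ∩ μ.support).indicator H y)
          (fun x _ => indicator_nonneg (fun _ _ => norm_nonneg _) y) hx
        refine le_trans (le_of_eq ?_) h1
        exact (indicator_of_mem (mem_inter hyx hy) H).symm
    _ = ∑ x ∈ T, ∫ y in Metric.ball x (r x) ∩ μ.support, H y ∂μ := by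
        rw [integral_finsetSum _ fun x _ => hHi.indicator (hmeas x)]
        exact Finset.sum_congr rfl fun x _ => integral_indicator (hmeas x)
    _ ≤ ∑ x ∈ T, C x * |ρ| ^ (-a) := by
        refine Finset.sum_le_sum fun x hx => (hC x hx O ρ hρ).trans ?_
        refine mul_le_mul_of_nonneg_left (Real.rpow_le_rpow_of_exponent_le hρ ?_) (hC0 x hx)
        rw [div_le_iff₀ hp0]
        have h3 : k - s - τ ≤ 2 * δ - N := by simp only [hτ, hNdef]; linarith
        linarith
    _ = _ := (Finset.sum_mul _ _ _).symm

end

/-! ### The gradient of a `C²` function -/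

section
variable {k : ℕ}

theorem inner_gradient_left (f : Euc k → ℝ) (x v : Euc k) :
    inner ℝ (gradient f x) v = fderiv ℝ f x v := by
  rw [gradient, InnerProductSpace.toDual_symm_apply]

theorem contDiff_gradient {f : Euc k → ℝ} (hf : ContDiff ℝ 2 f) : ContDiff ℝ 1 (gradient f) := by
  refine contDiff_euclidean.2 fun i => ?_
  have h1 : (fun x => gradient f x i) = fun x => fderiv ℝ f x (EuclideanSpace.single i 1) := by
    funext x
    rw [← inner_gradient_left, EuclideanSpace.inner_single_right]
    simp
  rw [h1]
  exact (hf.fderiv_right (by norm_num)).clm_apply contDiff_const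

/-- The mean value inequality is used twice: on the derivative, whose own derivative is bounded on
the closed ball, and then on `f` along the segment. -/
theorem exists_taylor_bound {f : Euc k → ℝ} (hf : ContDiff ℝ 2 f) (R : ℝ) :
    ∃ C : ℝ, 0 ≤ C ∧ ∀ x ∈ Metric.closedBall (0 : Euc k) R, ∀ y ∈ Metric.closedBall (0 : Euc k) R,
      |f x - f y - inner ℝ (gradient f y) (x - y)| ≤ C * ‖x - y‖ ^ 2 := by
  have hf1 : ContDiff ℝ 1 (fderiv ℝ f) := hf.fderiv_right (by norm_num)
  have hf2 : Continuous fun x => ‖fderiv ℝ (fderiv ℝ f) x‖ :=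
    continuous_norm.comp (hf1.continuous_fderiv one_ne_zero)
  obtain ⟨C, hC⟩ :=
    (isCompact_closedBall (0 : Euc k) R).exists_bound_of_continuousOn hf2.continuousOn
  refine ⟨max C 0, le_max_right _ _, fun x hx y hy => ?_⟩
  have hconv : Convex ℝ (Metric.closedBall (0 : Euc k) R) := convex_closedBall 0 R
  have hseg : segment ℝ y x ⊆ Metric.closedBall (0 : Euc k) R := hconv.segment_subset hy hx
  have hbound : ∀ z ∈ segment ℝ y x, ‖fderiv ℝ f z - fderiv ℝ f y‖ ≤ max C 0 * ‖x - y‖ := by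
    intro z hz
    refine (hconv.norm_image_sub_le_of_norm_fderiv_le (𝕜 := ℝ) (C := max C 0)
      (fun w _ => (hf1.differentiable one_ne_zero).differentiableAt)
      (fun w hw => ((Real.le_norm_self _).trans (hC w hw)).trans (le_max_left _ _)) hy (hseg hz)).trans ?_
    refine mul_le_mul_of_nonneg_left ?_ (le_max_right _ _)
    obtain ⟨t, ht, rfl⟩ := (segment_eq_image' ℝ y x).subset hz
    rw [add_sub_cancel_left, norm_smul, Real.norm_of_nonneg ht.1]
    exact mul_le_of_le_one_left (norm_nonneg _) ht.2
  have h := (convex_segment (𝕜 := ℝ) y x).norm_image_sub_le_of_norm_fderiv_le' (𝕜 := ℝ)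
    (fun w _ => (hf.differentiable two_ne_zero).differentiableAt) hbound
    (left_mem_segment ℝ y x) (right_mem_segment ℝ y x)
  rw [inner_gradient_left, ← Real.norm_eq_abs]
  refine h.trans (le_of_eq ?_)
  ring

/-! ### From curvature of the graph to a locally anti-Lipschitz gradient. -/

/-- The linear map `(v, t) ↦ snoc v t`. -/
noncomputable def snocCLM (k : ℕ) : Euc k × ℝ →L[ℝ] Euc (k + 1) :=
  LinearMap.toContinuousLinearMap
    { toFun := fun z => snoc z.1 z.2
      map_add' := fun a b => by
        ext i; refine Fin.lastCases ?_ (fun j => ?_) i <;> simp [snoc]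
      map_smul' := fun c a => by
        ext i; refine Fin.lastCases ?_ (fun j => ?_) i <;> simp [snoc] }

theorem snocCLM_apply (v : Euc k) (t : ℝ) : snocCLM k (v, t) = snoc v t := rfl

theorem inner_snoc (v w : Euc k) (s t : ℝ) :
    inner ℝ (snoc v s) (snoc w t) = inner ℝ v w + t * s := by
  simp [PiLp.inner_apply, Fin.sum_univ_castSucc, snoc]

theorem hasFDerivAt_snoc {u : Euc k → Euc k} {g : Euc k → ℝ} {u' : Euc k →L[ℝ] Euc k}
    {g' : Euc k →L[ℝ] ℝ} {x : Euc k} (hu : HasFDerivAt u u' x) (hg : HasFDerivAt g g' x) :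
    HasFDerivAt (fun y => snoc (u y) (g y)) ((snocCLM k).comp (u'.prod g')) x :=
  (snocCLM k).hasFDerivAt.comp x (hu.prodMk hg)

/-- Along a direction `v` killed by the Hessian only the normalising factor of the unit normal
varies. Its derivative is then normal to the graph and pairs to zero with every tangent vector, so
`v` is a null vector of the second fundamental form, which is nonsingular. -/
theorem injective_fderiv_gradient {f : Euc k → ℝ} (hf : ContDiff ℝ 2 f) {x : Euc k}
    (hx : gaussianCurvature f x ≠ 0) {v : Euc k} (hv : fderiv ℝ (gradient f) x v = 0) : v = 0 := by
  have hdet : (secondForm f x).det ≠ 0 := fun h => hx (by rw [gaussianCurvature, h, zero_div])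
  have hG : DifferentiableAt ℝ (gradient f) x :=
    ((contDiff_gradient hf).differentiable one_ne_zero).differentiableAt
  have hf' : DifferentiableAt ℝ f x := (hf.differentiable two_ne_zero).differentiableAt
  have hgraph : HasFDerivAt (graphMap f)
      ((snocCLM k).comp ((ContinuousLinearMap.id ℝ (Euc k)).prod (fderiv ℝ f x))) x :=
    hasFDerivAt_snoc (hasFDerivAt_id x) hf'.hasFDerivAt
  set c : Euc k → ℝ := fun y => (Real.sqrt (1 + ‖gradient f y‖ ^ 2))⁻¹ with hc
  have hcd : DifferentiableAt ℝ c x := by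
    have h1 : (1 : ℝ) + ‖gradient f x‖ ^ 2 ≠ 0 := by positivity
    refine DifferentiableAt.inv (DifferentiableAt.sqrt
      ((differentiableAt_const 1).add (hG.norm_sq ℝ)) h1) ?_
    positivity
  have hnormal : HasFDerivAt (unitNormal f) _ x :=
    hcd.hasFDerivAt.smul (hasFDerivAt_snoc hG.hasFDerivAt.neg (hasFDerivAt_const (1 : ℝ) x))
  have hN : fderiv ℝ (unitNormal f) x v = fderiv ℝ c x v • snoc (-gradient f x) 1 := by
    rw [hnormal.fderiv]
    have h0 : snoc (0 : Euc k) 0 = 0 := (snocCLM k).map_zero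
    simp [hv, snocCLM_apply, h0]
  have horth : ∀ w, inner ℝ (fderiv ℝ (unitNormal f) x v) (fderiv ℝ (graphMap f) x w) = 0 := by
    intro w
    rw [hN, hgraph.fderiv, inner_smul_left]
    simp [snocCLM_apply, inner_snoc]
  have hsum : v = ∑ i, v i • EuclideanSpace.single i (1 : ℝ) := by
    ext j; simp [Pi.single_apply]
  have hmul : Matrix.vecMul (fun i => v i) (secondForm f x) = 0 := by
    funext j
    rw [Matrix.vecMul, dotProduct, Pi.zero_apply, ← horth (EuclideanSpace.single j 1)]
    conv_rhs => rw [hsum]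
    simp only [map_sum, map_smul, sum_inner, inner_smul_left, secondForm, Matrix.of_apply]
    rfl
  have h0 := Matrix.eq_zero_of_vecMul_eq_zero hdet hmul
  ext i
  exact congrFun h0 i

/-- An injective linear map in finite dimension is bounded below by some `1/K`, and strict
differentiability makes the error at most half of that near `x`. -/
theorem exists_antilipschitz_gradient {f : Euc k → ℝ} (hf : ContDiff ℝ 2 f) {x : Euc k}
    (hx : gaussianCurvature f x ≠ 0) :
    ∃ r > 0, ∃ c > 0, ∀ y ∈ Metric.ball x r, ∀ z ∈ Metric.ball x r,
      c * ‖y - z‖ ≤ ‖gradient f y - gradient f z‖ := by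
  set A := fderiv ℝ (gradient f) x with hA
  have hstrict : HasStrictFDerivAt (gradient f) A x :=
    (contDiff_gradient hf).contDiffAt.hasStrictFDerivAt one_ne_zero
  have hker : LinearMap.ker (A : Euc k →ₗ[ℝ] Euc k) = ⊥ := by
    refine LinearMap.ker_eq_bot'.2 fun v hv => injective_fderiv_gradient hf hx hv
  obtain ⟨K, hK0, hK⟩ := LinearMap.exists_antilipschitzWith (A : Euc k →ₗ[ℝ] Euc k) hker
  have hK0' : (0 : ℝ) < K := hK0
  have hanti : ∀ v, (K : ℝ)⁻¹ * ‖v‖ ≤ ‖A v‖ := fun v => by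
    have := hK.le_mul_dist v 0
    rw [map_zero, dist_zero_right, dist_zero_right] at this
    rwa [inv_mul_le_iff₀ hK0']
  have hε : (0 : ℝ) < (K : ℝ)⁻¹ / 2 := by positivity
  have hlo := hstrict.isLittleO.bound hε
  obtain ⟨r, hr, hrs⟩ := Metric.eventually_nhds_iff.1 hlo
  refine ⟨r, hr, (K : ℝ)⁻¹ / 2, hε, fun y hy z hz => ?_⟩
  have h1 : ‖gradient f y - gradient f z - A (y - z)‖ ≤ (K : ℝ)⁻¹ / 2 * ‖y - z‖ :=
    hrs (y := (y, z)) (by rw [Prod.dist_eq]; exact max_lt hy hz)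
  have h2 := hanti (y - z)
  have h3 := norm_sub_norm_le (A (y - z)) (A (y - z) - (gradient f y - gradient f z))
  rw [sub_sub_cancel, norm_sub_rev (A (y - z))] at h3
  linarith

end

/-! ### Words in a self-similar system -/

namespace SelfSimilarIFS

variable {k : ℕ} (Φ : SelfSimilarIFS k)

/-- The contraction ratio of the composition along a word. -/
noncomputable def wordRatio (L : List (Fin Φ.N)) : ℝ := (L.map Φ.ratio).prod

/-- The orthogonal part of the composition along a word. -/
noncomputable def wordRot (L : List (Fin Φ.N)) : Euc k ≃ₗᵢ[ℝ] Euc k := (L.map Φ.rot).prod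

/-- The composition of the maps of the system along a word. -/
noncomputable def wordMap : List (Fin Φ.N) → Euc k → Euc k
  | [], x => x
  | i :: L, x => Φ.map i (wordMap L x)

theorem wordRatio_cons (i : Fin Φ.N) (L : List (Fin Φ.N)) :
    Φ.wordRatio (i :: L) = Φ.ratio i * Φ.wordRatio L := by
  simp [wordRatio]

theorem wordRatio_pos (L : List (Fin Φ.N)) : 0 < Φ.wordRatio L := by
  refine List.prod_pos fun a ha => ?_
  obtain ⟨i, -, rfl⟩ := List.mem_map.1 ha
  exact Φ.ratio_pos i

theorem continuous_map (i : Fin Φ.N) : Continuous (Φ.map i) := by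
  have := (Φ.rot i).continuous
  unfold SelfSimilarIFS.map; fun_prop

theorem continuous_wordMap (L : List (Fin Φ.N)) : Continuous (Φ.wordMap L) := by
  induction L with
  | nil => exact continuous_id
  | cons i L ih => exact (Φ.continuous_map i).comp ih

theorem wordMap_sub (L : List (Fin Φ.N)) (x y : Euc k) :
    Φ.wordMap L x - Φ.wordMap L y = Φ.wordRatio L • Φ.wordRot L (x - y) := by
  induction L with
  | nil => simp [wordMap, wordRatio, wordRot]
  | cons i L ih =>
    have h1 : Φ.wordRot (i :: L) (x - y) = Φ.rot i (Φ.wordRot L (x - y)) := by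
      simp [wordRot]
    rw [h1, wordRatio_cons, wordMap, wordMap, SelfSimilarIFS.map, SelfSimilarIFS.map,
      add_sub_add_right_eq_sub, ← smul_sub, ← map_sub, ih, map_smul, smul_smul]

theorem IsAttractor.wordMap_mem {Φ : SelfSimilarIFS k} {K : Set (Euc k)} (hK : Φ.IsAttractor K)
    (L : List (Fin Φ.N)) {x : Euc k} (hx : x ∈ K) : Φ.wordMap L x ∈ K := by
  induction L with
  | nil => exact hx
  | cons i L ih =>
    rw [hK.2.2]
    exact mem_iUnion.2 ⟨i, mem_image_of_mem _ ih⟩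

theorem exists_ratio_bounds : ∃ a b : ℝ, 0 < a ∧ 0 < b ∧ b < 1 ∧
    ∀ i, a ≤ Φ.ratio i ∧ Φ.ratio i ≤ b := by
  have : Nonempty (Fin Φ.N) := ⟨⟨0, by have := Φ.one_lt_N; omega⟩⟩
  obtain ⟨i, hi⟩ := Finite.exists_min Φ.ratio
  obtain ⟨j, hj⟩ := Finite.exists_max Φ.ratio
  exact ⟨_, _, Φ.ratio_pos i, Φ.ratio_pos j, Φ.ratio_lt_one j, fun l => ⟨hi l, hj l⟩⟩

/-- Decomposition of integrals against a stationary measure along words whose contraction ratio is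
comparable to `δ`. -/
theorem exists_word_decomposition {μ : Measure (Euc k)} (hμ : Φ.IsStationary μ) {a b : ℝ}
    (ha : 0 < a) (hb : 0 < b) (hab : ∀ i, a ≤ Φ.ratio i ∧ Φ.ratio i ≤ b) (n : ℕ) :
    ∀ δ : ℝ, b ^ n ≤ δ → ∃ (ι : Type) (_ : Fintype ι) (p : ι → ℝ) (L : ι → List (Fin Φ.N)),
      (∀ i, 0 ≤ p i) ∧ (∀ i, (L i).length ≤ n ∧ Φ.wordRatio (L i) ≤ δ ∧
        min 1 (a * δ) ≤ Φ.wordRatio (L i)) ∧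
      ∀ g : Euc k → ℂ, Continuous g → (∀ x, ‖g x‖ ≤ 1) →
        ∫ x, g x ∂μ = ∑ i, (p i : ℂ) * ∫ x, g (Φ.wordMap (L i) x) ∂μ := by
  obtain ⟨hprob, -, w, hw, -, hμw⟩ := hμ
  -- For `δ ≥ 1` the empty word, of ratio 1, already suffices; this is why the lower bound carries
  -- `min 1`.
  have hbase : ∀ (m : ℕ) (δ : ℝ), 1 ≤ δ → ∃ (ι : Type) (_ : Fintype ι) (p : ι → ℝ)
      (L : ι → List (Fin Φ.N)), (∀ i, 0 ≤ p i) ∧ (∀ i, (L i).length ≤ m ∧ Φ.wordRatio (L i) ≤ δ ∧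
        min 1 (a * δ) ≤ Φ.wordRatio (L i)) ∧
      ∀ g : Euc k → ℂ, Continuous g → (∀ x, ‖g x‖ ≤ 1) →
        ∫ x, g x ∂μ = ∑ i, (p i : ℂ) * ∫ x, g (Φ.wordMap (L i) x) ∂μ := by
    intro m δ hδ
    refine ⟨Unit, inferInstance, fun _ => 1, fun _ => [], fun _ => zero_le_one, fun _ => ?_,
      fun g _ _ => ?_⟩
    · simp [wordRatio, hδ]
    · simp [wordMap]
  have hstep : ∀ g : Euc k → ℂ, Continuous g → (∀ x, ‖g x‖ ≤ 1) →
      ∫ x, g x ∂μ = ∑ i, (w i : ℂ) * ∫ x, g (Φ.map i x) ∂μ := by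
    intro g hg hg1
    have hint : ∀ i ∈ (Finset.univ : Finset (Fin Φ.N)),
        Integrable g (ENNReal.ofReal (w i) • μ.map (Φ.map i)) := fun i _ => by
      have : IsProbabilityMeasure (μ.map (Φ.map i)) :=
        Measure.isProbabilityMeasure_map (Φ.continuous_map i).aemeasurable
      exact (Integrable.of_bound hg.aestronglyMeasurable 1
        (Eventually.of_forall hg1)).smul_measure ENNReal.ofReal_ne_top
    conv_lhs => rw [hμw]
    rw [integral_finsetSum_measure hint]
    refine Finset.sum_congr rfl fun i _ => ?_
    rw [integral_smul_measure, integral_map (Φ.continuous_map i).aemeasurable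
      hg.aestronglyMeasurable, ENNReal.toReal_ofReal (hw i).1.le, Complex.real_smul]
  induction n with
  | zero => exact fun δ hδ => hbase 0 δ (by simpa using hδ)
  | succ n ih =>
    intro δ hδ
    rcases le_or_gt 1 δ with h1 | h1
    · exact hbase _ δ h1
    have hδ0 : 0 < δ := lt_of_lt_of_le (by positivity) hδ
    have hδi : ∀ i, b ^ n ≤ δ / Φ.ratio i := fun i => by
      rw [le_div_iff₀ (Φ.ratio_pos i)]
      refine le_trans ?_ hδ
      rw [pow_succ]
      exact mul_le_mul_of_nonneg_left (hab i).2 (by positivity)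
    -- The stopping-time tree is built from the root: after the first letter `i`, the remaining word
    -- must have ratio about `δ / ratio i`.
    choose ι hι p L hp hL hg using fun i => ih (δ / Φ.ratio i) (hδi i)
    refine ⟨Σ i, ι i, inferInstance, fun z => w z.1 * p z.1 z.2, fun z => z.1 :: L z.1 z.2,
      fun z => mul_nonneg (hw z.1).1.le (hp z.1 z.2), fun z => ?_, fun g hgc hg1 => ?_⟩
    · obtain ⟨h2, h3, h4⟩ := hL z.1 z.2
      have hr := Φ.ratio_pos z.1
      refine ⟨by simpa using h2, ?_, ?_⟩
      · rw [wordRatio_cons]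
        rwa [le_div_iff₀' hr] at h3
      · rw [wordRatio_cons]
        have h5 := mul_le_mul_of_nonneg_left h4 hr.le
        refine (min_le_right _ _).trans (le_trans ?_ h5)
        rw [mul_min_of_nonneg _ _ hr.le, mul_one]
        refine le_min ?_ (le_of_eq (by field_simp))
        nlinarith [(hab z.1).1]
    · rw [hstep g hgc hg1, Fintype.sum_sigma]
      refine Finset.sum_congr rfl fun i _ => ?_
      rw [hg i (fun x => g (Φ.map i x)) (hgc.comp (Φ.continuous_map i)) fun x => hg1 _,
        Finset.mul_sum]
      refine Finset.sum_congr rfl fun j _ => ?_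
      simp only [wordMap]
      push_cast
      ring

/-! ### Counting the pairs of ratio and rotation. -/

theorem finite_products {G : Type*} [Group G] {F : Set G} (hF : F.Finite) (n : ℕ) :
    (products F n).Finite := by
  have h1 : {w : Fin n → G | ∀ j, w j ∈ F}.Finite := Set.Finite.pi' fun _ => hF
  refine (h1.image fun w => (List.ofFn w).prod).subset ?_
  rintro g ⟨w, hw, rfl⟩
  exact ⟨w, hw, rfl⟩

theorem wordRot_mem_products (L : List (Fin Φ.N)) :
    Φ.wordRot L ∈ products (Set.range Φ.rot) L.length := by
  refine ⟨fun j => Φ.rot (L.get j), fun j => ⟨_, rfl⟩, ?_⟩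
  rw [wordRot]
  congr 1
  conv_rhs => rw [← List.ofFn_get L, List.map_ofFn]
  rfl

theorem wordRatio_eq_prod (L : List (Fin Φ.N)) :
    Φ.wordRatio L = ∏ i, Φ.ratio i ^ L.count i := by
  rw [wordRatio, Finset.prod_list_map_count]
  refine Finset.prod_subset (Finset.subset_univ _) fun i _ hi => ?_
  rw [List.count_eq_zero_of_not_mem (by simpa using hi), pow_zero]

/-- The pairs of contraction ratio and orthogonal part of short words. -/
def wordTypes (n : ℕ) : Set (ℝ × (Euc k ≃ₗᵢ[ℝ] Euc k)) :=
  {z | ∃ L : List (Fin Φ.N), L.length ≤ n ∧ (Φ.wordRatio L, Φ.wordRot L) = z}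

/-- Ratios commute, so a ratio depends only on the number of occurrences of each letter, which
leaves polynomially many. The rotations are counted by the products of each length up to `n`. -/
theorem finite_wordTypes_and_ncard_le (n : ℕ) : (Φ.wordTypes n).Finite ∧
    (Φ.wordTypes n).ncard ≤
      (n + 1) ^ Φ.N * ∑ j ∈ Finset.range (n + 1), (products (Set.range Φ.rot) j).ncard := by
  classical
  set A : Set ℝ := Set.range fun m : Fin Φ.N → Fin (n + 1) => ∏ i, Φ.ratio i ^ (m i : ℕ) with hA
  set B : Set (Euc k ≃ₗᵢ[ℝ] Euc k) :=
    ⋃ j ∈ Finset.range (n + 1), products (Set.range Φ.rot) j with hB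
  have hBfin : B.Finite := (Finset.range (n + 1)).finite_toSet.biUnion fun j _ =>
    finite_products (Set.finite_range _) j
  have hAfin : A.Finite := Set.finite_range _
  have hsub : Φ.wordTypes n ⊆ A ×ˢ B := by
    rintro _ ⟨L, hL, rfl⟩
    refine ⟨⟨fun i => ⟨L.count i, ?_⟩, (Φ.wordRatio_eq_prod L).symm⟩,
      mem_iUnion₂.2 ⟨L.length, Finset.mem_range.2 (by omega), Φ.wordRot_mem_products L⟩⟩
    have := List.count_le_length (a := i) (l := L)
    omega
  refine ⟨(hAfin.prod hBfin).subset hsub, ?_⟩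
  refine (Set.ncard_le_ncard hsub (hAfin.prod hBfin)).trans ?_
  rw [Set.ncard_prod]
  refine Nat.mul_le_mul ?_ ?_
  · rw [hA, ← Set.image_univ]
    refine (Set.ncard_image_le Set.finite_univ).trans (le_of_eq ?_)
    rw [Set.ncard_univ, Nat.card_eq_fintype_card]
    simp
  · exact Finset.set_ncard_biUnion_le _ _

end SelfSimilarIFS

theorem exists_add_one_pow_le_exp {ε : ℝ} (hε : 0 < ε) (M : ℕ) :
    ∃ C : ℝ, 0 < C ∧ ∀ n : ℕ, ((n : ℝ) + 1) ^ M ≤ C * Real.exp (ε * n) := by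
  refine ⟨M.factorial / ε ^ M * Real.exp ε, by positivity, fun n => ?_⟩
  have h := Real.pow_div_factorial_le_exp (ε * (n + 1)) (by positivity) M
  rw [div_le_iff₀ (by positivity), mul_pow, mul_add, mul_one, Real.exp_add] at h
  rw [← mul_le_mul_iff_right₀ (show 0 < ε ^ M by positivity)]
  refine h.trans (le_of_eq ?_)
  field_simp

theorem SelfSimilarIFS.exists_ncard_wordTypes_le {k : ℕ} (Φ : SelfSimilarIFS k)
    (hΦ : NonExpanding (Set.range Φ.rot)) {ε : ℝ} (hε : 0 < ε) :
    ∃ C : ℝ, 0 < C ∧ ∀ n : ℕ, ((Φ.wordTypes n).ncard : ℝ) ≤ C * Real.exp (ε * n) := by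
  obtain ⟨C₁, h1⟩ := hΦ (ε / 2) (by positivity)
  obtain ⟨C₂, hC₂, h2⟩ := exists_add_one_pow_le_exp (half_pos hε) (Φ.N + 1)
  set C := max C₁ 1 with hC
  have hC0 : 0 < C := lt_max_of_lt_right one_pos
  refine ⟨C * C₂, by positivity, fun n => ?_⟩
  have h3 : ((Φ.wordTypes n).ncard : ℝ) ≤ (n + 1) ^ Φ.N *
      ∑ j ∈ Finset.range (n + 1), ((products (Set.range Φ.rot) j).ncard : ℝ) := by
    exact_mod_cast (Φ.finite_wordTypes_and_ncard_le n).2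
  have h4 : ∑ j ∈ Finset.range (n + 1), ((products (Set.range Φ.rot) j).ncard : ℝ) ≤
      (n + 1) * (C * Real.exp (ε / 2 * n)) := by
    refine (Finset.sum_le_card_nsmul _ _ (C * Real.exp (ε / 2 * n)) fun j hj => ?_).trans
      (le_of_eq (by simp))
    have hjn : (j : ℝ) ≤ n := by
      exact_mod_cast Nat.lt_succ_iff.1 (Finset.mem_range.1 hj)
    refine (h1 j).trans (mul_le_mul (le_max_left _ _) ?_ (Real.exp_pos _).le hC0.le)
    exact Real.exp_le_exp.2 (mul_le_mul_of_nonneg_left hjn (by positivity))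
  calc ((Φ.wordTypes n).ncard : ℝ)
      ≤ (n + 1) ^ Φ.N * ((n + 1) * (C * Real.exp (ε / 2 * n))) :=
        h3.trans (mul_le_mul_of_nonneg_left h4 (by positivity))
    _ = C * Real.exp (ε / 2 * n) * (n + 1) ^ (Φ.N + 1) := by ring
    _ ≤ C * Real.exp (ε / 2 * n) * (C₂ * Real.exp (ε / 2 * n)) :=
        mul_le_mul_of_nonneg_left (h2 n) (by positivity)
    _ = C * C₂ * (Real.exp (ε / 2 * n) * Real.exp (ε / 2 * n)) := by ring
    _ = C * C₂ * Real.exp (ε * n) := by rw [← Real.exp_add]; congr 2; ring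

/-- A non-expanding self-similar measure is, for every `δ`, a combination of similar copies of
itself with ratio comparable to `δ`, of which there are only `δ^(-ε)` up to translation. -/
theorem SelfSimilarIFS.exists_decomposition {k : ℕ} (Φ : SelfSimilarIFS k)
    {μ : Measure (Euc k)} (hμ : Φ.IsStationary μ) (hΦ : NonExpanding (Set.range Φ.rot)) :
    ∃ a : ℝ, 0 < a ∧ ∀ ε : ℝ, 0 < ε → ∃ C : ℝ, 0 < C ∧ ∀ δ : ℝ, 0 < δ → δ ≤ 1 →
      ∃ T : Finset (ℝ × (Euc k ≃ₗᵢ[ℝ] Euc k)), (T.card : ℝ) ≤ C * δ ^ (-ε) ∧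
        (∀ z ∈ T, a * δ ≤ z.1) ∧
        ∃ (ι : Type) (_ : Fintype ι) (p : ι → ℝ) (L : ι → List (Fin Φ.N)),
          (∀ i, 0 ≤ p i) ∧ (∀ i, (Φ.wordRatio (L i), Φ.wordRot (L i)) ∈ T ∧
            Φ.wordRatio (L i) ≤ δ) ∧
          ∀ g : Euc k → ℂ, Continuous g → (∀ x, ‖g x‖ ≤ 1) →
            ∫ x, g x ∂μ = ∑ i, (p i : ℂ) * ∫ x, g (Φ.wordMap (L i) x) ∂μ := by
  classical
  obtain ⟨a, b, ha, hb, hb1, hab⟩ := Φ.exists_ratio_bounds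
  have ha1 : a ≤ 1 := by
    have := hab ⟨0, by have := Φ.one_lt_N; omega⟩
    linarith [this.1, this.2]
  refine ⟨a, ha, fun ε hε => ?_⟩
  have hlb : 0 < -Real.log b := neg_pos.2 (Real.log_neg hb hb1)
  -- Words have length at most about `log δ / log b`, so the growth rate `ε |log b|` per letter
  -- becomes `δ^(-ε)`.
  obtain ⟨C, hC, hcard⟩ := Φ.exists_ncard_wordTypes_le hΦ (mul_pos hε hlb)
  refine ⟨C * Real.exp (ε * -Real.log b), by positivity, fun δ hδ0 hδ1 => ?_⟩
  have hlδ : 0 ≤ -Real.log δ := neg_nonneg.2 (Real.log_nonpos hδ0.le hδ1)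
  set n := ⌈-Real.log δ / -Real.log b⌉₊ with hn
  have hn1 : -Real.log δ / -Real.log b ≤ n := Nat.le_ceil _
  have hn2 : (n : ℝ) < -Real.log δ / -Real.log b + 1 :=
    Nat.ceil_lt_add_one (div_nonneg hlδ hlb.le)
  have hbn : b ^ n ≤ δ := by
    rw [← Real.log_le_log_iff (by positivity) hδ0, Real.log_pow]
    rw [div_le_iff₀ hlb] at hn1
    linarith
  obtain ⟨ι, hι, p, L, hp, hL, hg⟩ := Φ.exists_word_decomposition hμ ha hb hab n δ hbn
  have hfin := (Φ.finite_wordTypes_and_ncard_le n).1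
  refine ⟨hfin.toFinset.filter fun z => a * δ ≤ z.1, ?_, fun z hz => (Finset.mem_filter.1 hz).2,
    ι, hι, p, L, hp, fun i => ⟨?_, (hL i).2.1⟩, hg⟩
  · have h1 : ((hfin.toFinset.filter fun z => a * δ ≤ z.1).card : ℝ) ≤ (Φ.wordTypes n).ncard := by
      rw [Set.ncard_eq_toFinset_card _ hfin]
      exact Nat.cast_le.2 (Finset.card_filter_le _ _)
    refine h1.trans ((hcard n).trans ?_)
    rw [mul_assoc C]
    refine mul_le_mul_of_nonneg_left ?_ hC.le
    rw [Real.rpow_def_of_pos hδ0, ← Real.exp_add]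
    refine Real.exp_le_exp.2 ?_
    have h2 : -Real.log b * n ≤ -Real.log δ + -Real.log b := by
      have := mul_le_mul_of_nonneg_left hn2.le hlb.le
      rwa [mul_add, mul_div_cancel₀ _ hlb.ne', mul_one] at this
    nlinarith [mul_le_mul_of_nonneg_left h2 hε.le]
  · refine Finset.mem_filter.2 ⟨hfin.mem_toFinset.2 ⟨L i, (hL i).1, rfl⟩, ?_⟩
    have h3 : a * δ ≤ 1 := mul_le_one₀ ha1 hδ0.le hδ1
    simpa [min_eq_right h3] using (hL i).2.2

/-! ### Linearisation on small pieces -/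

theorem norm_exp_fourier_sub_le (a b : ℝ) :
    ‖Complex.exp (-2 * Real.pi * Complex.I * (a : ℂ)) -
      Complex.exp (-2 * Real.pi * Complex.I * (b : ℂ))‖ ≤ 2 * Real.pi * |a - b| := by
  have h1 : Complex.exp (-2 * Real.pi * Complex.I * (a : ℂ)) -
      Complex.exp (-2 * Real.pi * Complex.I * (b : ℂ)) =
      Complex.exp (-2 * Real.pi * Complex.I * (b : ℂ)) *
        (Complex.exp (Complex.I * ((-2 * Real.pi * (a - b) : ℝ) : ℂ)) - 1) := by
    rw [mul_sub, mul_one, ← Complex.exp_add]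
    congr 2; push_cast; ring
  rw [h1, norm_mul, norm_exp_fourier, one_mul]
  refine (Real.norm_exp_I_mul_ofReal_sub_one_le).trans (le_of_eq ?_)
  rw [Real.norm_eq_abs, abs_mul, abs_mul, abs_neg, abs_two, abs_of_pos Real.pi_pos]

section
variable {k : ℕ}

/-- The Fourier transform of the image of a small copy of `μ` is close to that of `μ` at a frequency
given by the gradient. -/
theorem SelfSimilarIFS.norm_integral_wordMap_le {Φ : SelfSimilarIFS k} {μ : Measure (Euc k)}
    [IsProbabilityMeasure μ] {K : Set (Euc k)} (hK : Φ.IsAttractor K) (hμK : μ Kᶜ = 0)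
    {f : Euc k → ℝ} (hf : Continuous f) (hG : Continuous (gradient f)) {R C : ℝ} (hC : 0 ≤ C)
    (hKR : K ⊆ Metric.closedBall 0 R)
    (htaylor : ∀ x ∈ Metric.closedBall (0 : Euc k) R, ∀ y ∈ Metric.closedBall (0 : Euc k) R,
      |f x - f y - inner ℝ (gradient f y) (x - y)| ≤ C * ‖x - y‖ ^ 2)
    (L : List (Fin Φ.N)) (ξ : ℝ) :
    ‖∫ x, Complex.exp (-2 * Real.pi * Complex.I * ((ξ * f (Φ.wordMap L x) : ℝ) : ℂ)) ∂μ‖ ≤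
      (∫ y, ‖fourierTransform μ ((ξ * Φ.wordRatio L) •
        (Φ.wordRot L).symm (gradient f (Φ.wordMap L y)))‖ ∂μ) +
      2 * Real.pi * |ξ| * (C * (2 * R) ^ 2) * Φ.wordRatio L ^ 2 := by
  set r := Φ.wordRatio L with hr
  set O := Φ.wordRot L with hO
  set g := Φ.wordMap L with hg
  have hr0 : 0 < r := Φ.wordRatio_pos L
  have hgc : Continuous g := Φ.continuous_wordMap L
  have hae : ∀ᵐ x ∂μ, x ∈ K := mem_ae_iff.2 hμK
  set E := 2 * Real.pi * |ξ| * (C * (2 * R) ^ 2) * r ^ 2 with hE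
  set I := ∫ x, Complex.exp (-2 * Real.pi * Complex.I * ((ξ * f (g x) : ℝ) : ℂ)) ∂μ with hI
  -- The left side does not depend on the base point `y` of the linearisation; this freedom allows
  -- the final averaging over `y`.
  have hpoint : ∀ y ∈ K, ‖I‖ ≤
      ‖fourierTransform μ ((ξ * r) • O.symm (gradient f (g y)))‖ + E := by
    intro y hy
    set η := (ξ * r) • O.symm (gradient f (g y)) with hη
    set B : Euc k → ℝ := fun x => ξ * (f (g y) + inner ℝ (gradient f (g y)) (g x - g y)) with hB
    have hBη : ∀ x, B x = (ξ * f (g y) - inner ℝ η y) + inner ℝ η x := by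
      intro x
      have h1 : inner ℝ (gradient f (g y)) (O (x - y)) =
          inner ℝ (O.symm (gradient f (g y))) (x - y) := by
        rw [← O.inner_map_map (O.symm (gradient f (g y))), O.apply_symm_apply]
      simp only [hB]
      rw [hg, Φ.wordMap_sub, ← hg, ← hr, ← hO, inner_smul_right, h1, hη, inner_smul_left,
        inner_smul_left, inner_sub_right]
      simp only [conj_trivial]
      ring
    have hBc : Continuous B := by simp only [hB]; fun_prop
    have hint1 : Integrable (fun x =>
        Complex.exp (-2 * Real.pi * Complex.I * ((ξ * f (g x) : ℝ) : ℂ))) μ :=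
      Integrable.of_bound (C := 1) (Continuous.aestronglyMeasurable (by fun_prop))
        (Eventually.of_forall fun x => (norm_exp_fourier _).le)
    have hint2 : Integrable (fun x =>
        Complex.exp (-2 * Real.pi * Complex.I * ((B x : ℝ) : ℂ))) μ :=
      Integrable.of_bound (C := 1) (Continuous.aestronglyMeasurable (by fun_prop))
        (Eventually.of_forall fun x => (norm_exp_fourier _).le)
    have hlin : ‖∫ x, Complex.exp (-2 * Real.pi * Complex.I * ((B x : ℝ) : ℂ)) ∂μ‖ =
        ‖fourierTransform μ η‖ := by
      have h2 : ∀ x, Complex.exp (-2 * Real.pi * Complex.I * ((B x : ℝ) : ℂ)) =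
          Complex.exp (-2 * Real.pi * Complex.I * ((ξ * f (g y) - inner ℝ η y : ℝ) : ℂ)) *
          Complex.exp (-2 * Real.pi * Complex.I * ((inner ℝ η x : ℝ) : ℂ)) := fun x => by
        rw [hBη x, ← Complex.exp_add]; congr 1; push_cast; ring
      simp only [h2]
      rw [integral_const_mul, norm_mul, norm_exp_fourier, one_mul]
      rfl
    have herr : ‖I - ∫ x, Complex.exp (-2 * Real.pi * Complex.I * ((B x : ℝ) : ℂ)) ∂μ‖ ≤ E := by
      rw [hI, ← integral_sub hint1 hint2]
      refine (norm_integral_le_of_norm_le_const (C := E) ?_).trans (by simp)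
      filter_upwards [hae] with x hx
      refine (norm_exp_fourier_sub_le _ _).trans ?_
      have h3 := htaylor (g x) (hKR (hK.wordMap_mem L hx)) (g y) (hKR (hK.wordMap_mem L hy))
      have h4 : ‖g x - g y‖ = r * ‖x - y‖ := by
        rw [hg, Φ.wordMap_sub, norm_smul, Real.norm_of_nonneg hr0.le, LinearIsometryEquiv.norm_map]
      have h5 : ‖x - y‖ ≤ 2 * R := by
        have hx' := mem_closedBall_zero_iff.1 (hKR hx)
        have hy' := mem_closedBall_zero_iff.1 (hKR hy)
        linarith [norm_sub_le x y]
      have h6 : |ξ * f (g x) - B x| =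
          |ξ| * |f (g x) - f (g y) - inner ℝ (gradient f (g y)) (g x - g y)| := by
        rw [← abs_mul]; congr 1; simp only [hB]; ring
      rw [h6, hE]
      rw [h4, mul_pow] at h3
      have h7 : ‖x - y‖ ^ 2 ≤ (2 * R) ^ 2 := pow_le_pow_left₀ (norm_nonneg _) h5 2
      have h8 : |f (g x) - f (g y) - inner ℝ (gradient f (g y)) (g x - g y)| ≤
          C * (2 * R) ^ 2 * r ^ 2 := by
        refine h3.trans ?_
        have := mul_le_mul_of_nonneg_left h7 (show 0 ≤ C * r ^ 2 by positivity)
        linarith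
      calc 2 * Real.pi * (|ξ| * |f (g x) - f (g y) - inner ℝ (gradient f (g y)) (g x - g y)|)
          ≤ 2 * Real.pi * (|ξ| * (C * (2 * R) ^ 2 * r ^ 2)) := by gcongr
        _ = _ := by ring
    have h9 := norm_sub_norm_le I (∫ x, Complex.exp (-2 * Real.pi * Complex.I * ((B x : ℝ) : ℂ)) ∂μ)
    rw [hlin] at h9
    linarith
  have hHc : Continuous fun y => ‖fourierTransform μ ((ξ * r) • O.symm (gradient f (g y)))‖ := by
    have h1 := continuous_fourierTransform μ
    have h2 := O.symm.continuous
    fun_prop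
  have hHi : Integrable (fun y => ‖fourierTransform μ ((ξ * r) • O.symm (gradient f (g y)))‖) μ :=
    Integrable.of_bound (C := 1) hHc.aestronglyMeasurable (Eventually.of_forall fun y => by
      rw [Real.norm_of_nonneg (norm_nonneg _)]; exact norm_fourierTransform_le_one μ _)
  calc ‖I‖ = ∫ _, ‖I‖ ∂μ := by simp
    _ ≤ ∫ y, (‖fourierTransform μ ((ξ * r) • O.symm (gradient f (g y)))‖ + E) ∂μ := by
        refine integral_mono_ae (integrable_const _) (hHi.add (integrable_const _)) ?_
        filter_upwards [hae] with y hy using hpoint y hy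
    _ = _ := by rw [integral_add hHi (integrable_const _)]; simp

/-- The decay of the Fourier transform of the image, given that of averages along the gradient. -/
theorem norm_fourierTransform_map_le {μ : Measure (Euc k)} {Φ : SelfSimilarIFS k}
    (hμ : Φ.IsStationary μ) (hΦ : NonExpanding (Set.range Φ.rot)) {f : Euc k → ℝ}
    (hf : ContDiff ℝ 2 f) {a σ A : ℝ} (hσ0 : 0 < σ) (hσ1 : σ < 1) (ha : 2 * σ < a * (1 - σ))
    (hA0 : 0 ≤ A) (hA : ∀ (O : Euc k ≃ₗᵢ[ℝ] Euc k) (ρ : ℝ), 0 < |ρ| →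
      ∫ y, ‖fourierTransform μ (ρ • O (gradient f y))‖ ∂μ ≤ A * |ρ| ^ (-a)) :
    ∃ C : ℝ, ∀ ξ : ℝ, ξ ≠ 0 → ‖fourierTransform (μ.map f) ξ‖ ≤ C * |ξ| ^ (-σ) := by
  have hprob : IsProbabilityMeasure μ := hμ.1
  obtain ⟨K, hK, hμK⟩ := hμ.2.1
  obtain ⟨R, hKR⟩ := hK.1.isBounded.subset_closedBall (0 : Euc k)
  obtain ⟨C₁, hC₁, htaylor⟩ := exists_taylor_bound hf R
  have hfc : Continuous f := hf.continuous
  have hG : Continuous (gradient f) := (contDiff_gradient hf).continuous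
  have ha0 : 0 < a := by
    by_contra! h
    have : a * (1 - σ) ≤ 0 := mul_nonpos_of_nonpos_of_nonneg h (by linarith)
    linarith
  obtain ⟨c, hc, hdec⟩ := Φ.exists_decomposition hμ hΦ
  -- Solves `δ^(-ε) |ξ|^(-a(1-σ)/2) = |ξ|^(-σ)`: the number of types uses up exactly the surplus
  -- decay.
  set ε := (a * (1 - σ) - 2 * σ) / (1 + σ) with hε
  have hε0 : 0 < ε := div_pos (by linarith) (by linarith)
  obtain ⟨C₂, hC₂, hdec⟩ := hdec ε hε0
  have hF : ∀ ξ, fourierTransform (μ.map f) ξ =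
      ∫ x, Complex.exp (-2 * Real.pi * Complex.I * ((ξ * f x : ℝ) : ℂ)) ∂μ := by
    intro ξ
    rw [fourierTransform, integral_map hfc.aemeasurable
      (Continuous.aestronglyMeasurable (by fun_prop))]
    refine integral_congr_ae (Eventually.of_forall fun x => ?_)
    simp [mul_comm ξ]
  have hprob' : IsProbabilityMeasure (μ.map f) := Measure.isProbabilityMeasure_map hfc.aemeasurable
  set D := 2 * Real.pi * (C₁ * (2 * R) ^ 2) with hD
  have hD0 : 0 ≤ D := by positivity
  refine ⟨max 1 (D + C₂ * (A * c ^ (-a))), fun ξ hξ => ?_⟩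
  have hξ0 : 0 < |ξ| := abs_pos.2 hξ
  rcases lt_or_ge |ξ| 1 with hξ1 | hξ1
  · have h1 : 1 ≤ |ξ| ^ (-σ) := Real.one_le_rpow_of_pos_of_le_one_of_nonpos hξ0 hξ1.le (by linarith)
    calc ‖fourierTransform (μ.map f) ξ‖ ≤ 1 * 1 := by
          rw [one_mul]; exact norm_fourierTransform_le_one _ ξ
      _ ≤ _ := mul_le_mul (le_max_left _ _) h1 zero_le_one (by positivity)
  -- The scale at which the linearisation error `|ξ| δ²` equals the target `|ξ|^(-σ)`.
  set δ := |ξ| ^ (-((1 + σ) / 2)) with hδ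
  have hδ0 : 0 < δ := by positivity
  have hδ1 : δ ≤ 1 := Real.rpow_le_one_of_one_le_of_nonpos hξ1 (by linarith)
  obtain ⟨T, hT, hTr, ι, hι, p, L, hp, hL, hdecomp⟩ := hdec δ hδ0 hδ1
  set H : ℝ × (Euc k ≃ₗᵢ[ℝ] Euc k) → Euc k → ℝ := fun z y =>
    ‖fourierTransform μ ((ξ * z.1) • z.2.symm (gradient f y))‖ with hH
  have hHc : ∀ z, Continuous (H z) := fun z => by
    have h1 := continuous_fourierTransform μ
    have h2 := z.2.symm.continuous
    simp only [hH]; fun_prop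
  -- The word decomposition is applied to `H z` as well, in order to read it backwards and
  -- reassemble the averages over the pieces into one over μ.
  have hdecompH : ∀ z, ∫ y, H z y ∂μ = ∑ i, p i * ∫ y, H z (Φ.wordMap (L i) y) ∂μ := by
    intro z
    have h1 := hdecomp (fun y => (H z y : ℂ)) (Complex.continuous_ofReal.comp (hHc z)) fun x => by
      rw [Complex.norm_real, Real.norm_of_nonneg (norm_nonneg _)]
      exact norm_fourierTransform_le_one μ _
    simp only [integral_complex_ofReal] at h1
    exact_mod_cast h1
  have hpsum : ∑ i, p i = 1 := by
    have h1 := hdecomp (fun _ => 1) continuous_const fun _ => by simp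
    simp only [integral_const, probReal_univ, one_smul, mul_one] at h1
    exact_mod_cast h1.symm
  have hξδ : |ξ| * δ ^ 2 = |ξ| ^ (-σ) := by
    rw [hδ, ← Real.rpow_natCast, ← Real.rpow_mul hξ0.le]
    nth_rewrite 1 [← Real.rpow_one |ξ|]
    rw [← Real.rpow_add hξ0]
    congr 1; push_cast; ring
  -- The type of the word `L i` is replaced by the sum over all types in `T`. The integrand then no
  -- longer depends on `i`, which the reassembly requires.
  have hword : ∀ i, ‖∫ x, Complex.exp
      (-2 * Real.pi * Complex.I * ((ξ * f (Φ.wordMap (L i) x) : ℝ) : ℂ)) ∂μ‖ ≤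
      (∑ z ∈ T, ∫ y, H z (Φ.wordMap (L i) y) ∂μ) + D * |ξ| ^ (-σ) := by
    intro i
    refine (SelfSimilarIFS.norm_integral_wordMap_le hK hμK hfc hG hC₁ hKR htaylor (L i) ξ).trans ?_
    refine add_le_add ?_ ?_
    · have h1 : ∀ z ∈ T, 0 ≤ ∫ y, H z (Φ.wordMap (L i) y) ∂μ := fun z _ =>
        integral_nonneg fun _ => norm_nonneg _
      have h2 := Finset.single_le_sum h1 (hL i).1
      simp only [hH] at h2 ⊢
      exact h2
    · have h1 : Φ.wordRatio (L i) ^ 2 ≤ δ ^ 2 :=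
        pow_le_pow_left₀ (Φ.wordRatio_pos _).le (hL i).2 2
      calc 2 * Real.pi * |ξ| * (C₁ * (2 * R) ^ 2) * Φ.wordRatio (L i) ^ 2
          ≤ 2 * Real.pi * |ξ| * (C₁ * (2 * R) ^ 2) * δ ^ 2 := by gcongr
        _ = D * (|ξ| * δ ^ 2) := by simp only [hD]; ring
        _ = D * |ξ| ^ (-σ) := by rw [hξδ]
  have hHint : ∀ z ∈ T, ∫ y, H z y ∂μ ≤ A * (c ^ (-a) * |ξ| ^ (-(a * (1 - σ) / 2))) := by
    intro z hz
    have hz0 : 0 < z.1 := lt_of_lt_of_le (by positivity) (hTr z hz)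
    have h1 : |ξ * z.1| = |ξ| * z.1 := by rw [abs_mul, abs_of_pos hz0]
    refine (hA z.2.symm (ξ * z.1) (by rw [h1]; positivity)).trans ?_
    refine mul_le_mul_of_nonneg_left ?_ hA0
    rw [h1]
    have h2 : |ξ| * (c * δ) ≤ |ξ| * z.1 := mul_le_mul_of_nonneg_left (hTr z hz) hξ0.le
    refine (Real.rpow_le_rpow_of_nonpos (by positivity) h2 (by linarith)).trans (le_of_eq ?_)
    have h3 : |ξ| * (c * δ) = c * |ξ| ^ ((1 - σ) / 2) := by
      rw [hδ, mul_left_comm]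
      congr 1
      nth_rewrite 1 [← Real.rpow_one |ξ|]
      rw [← Real.rpow_add hξ0]
      congr 1; ring
    rw [h3, Real.mul_rpow hc.le (by positivity), ← Real.rpow_mul hξ0.le]
    congr 2; ring
  have hδε : δ ^ (-ε) * |ξ| ^ (-(a * (1 - σ) / 2)) = |ξ| ^ (-σ) := by
    have hσ' : 1 + σ ≠ 0 := by linarith
    rw [hδ, ← Real.rpow_mul hξ0.le, ← Real.rpow_add hξ0]
    congr 1; rw [hε]; field_simp; ring
  calc ‖fourierTransform (μ.map f) ξ‖
      = ‖∑ i, (p i : ℂ) * ∫ x, Complex.exp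
          (-2 * Real.pi * Complex.I * ((ξ * f (Φ.wordMap (L i) x) : ℝ) : ℂ)) ∂μ‖ := by
        rw [hF, hdecomp (fun x => Complex.exp
          (-2 * Real.pi * Complex.I * ((ξ * f x : ℝ) : ℂ))) (by fun_prop)
          fun x => (norm_exp_fourier _).le]
    _ ≤ ∑ i, p i * ((∑ z ∈ T, ∫ y, H z (Φ.wordMap (L i) y) ∂μ) + D * |ξ| ^ (-σ)) := by
        refine (norm_sum_le _ _).trans (Finset.sum_le_sum fun i _ => ?_)
        rw [norm_mul, Complex.norm_real, Real.norm_of_nonneg (hp i)]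
        exact mul_le_mul_of_nonneg_left (hword i) (hp i)
    _ = (∑ z ∈ T, ∫ y, H z y ∂μ) + D * |ξ| ^ (-σ) := by
        simp only [mul_add, Finset.sum_add_distrib]
        rw [← Finset.sum_mul, hpsum, one_mul]
        congr 1
        simp only [Finset.mul_sum, hdecompH]
        exact Finset.sum_comm
    _ ≤ T.card * (A * (c ^ (-a) * |ξ| ^ (-(a * (1 - σ) / 2)))) + D * |ξ| ^ (-σ) := by
        refine add_le_add ?_ le_rfl
        refine (Finset.sum_le_card_nsmul T _ _ hHint).trans (le_of_eq ?_)
        rw [nsmul_eq_mul]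
    _ ≤ C₂ * δ ^ (-ε) * (A * (c ^ (-a) * |ξ| ^ (-(a * (1 - σ) / 2)))) + D * |ξ| ^ (-σ) := by
        gcongr
    _ = C₂ * (A * c ^ (-a)) * (δ ^ (-ε) * |ξ| ^ (-(a * (1 - σ) / 2))) + D * |ξ| ^ (-σ) := by ring
    _ = (D + C₂ * (A * c ^ (-a))) * |ξ| ^ (-σ) := by rw [hδε]; ring
    _ ≤ _ := mul_le_mul_of_nonneg_right (le_max_right _ _) (by positivity)

end

end FourierImage

/-! ### Assembly of the theorem. -/

theorem theorem3 {k : ℕ} (μ : MeasureTheory.Measure (FourierImage.Euc k))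
    (hμ : FourierImage.IsNonExpandingSelfSimilar μ)
    (hκ : (k : ℝ) / 2 < FourierImage.fourierLpDim μ 2)
    (f : FourierImage.Euc k → ℝ) (hf : ContDiff ℝ 2 f)
    (hcurv : ∀ x ∈ μ.support, FourierImage.gaussianCurvature f x ≠ 0) :
    ∃ s : ℝ, IsGreatest (FourierImage.decayExponent μ '' FourierImage.admissibleExponents μ) s ∧
      ∀ σ : ℝ, 0 < σ → σ < s → ∃ C : ℝ, ∀ ξ : ℝ, ξ ≠ 0 →
        ‖FourierImage.fourierTransform (μ.map f) ξ‖ ≤ C * |ξ| ^ (-σ) := by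
  open FourierImage in
  obtain ⟨Φ, hΦμ, hΦ⟩ := hμ
  have hprob : IsProbabilityMeasure μ := hΦμ.1
  obtain ⟨K, hK, hμK⟩ := hΦμ.2.1
  have hS : IsCompact μ.support := hK.1.of_isClosed_subset Measure.isClosed_support
    (Measure.support_subset_of_isClosed hK.1.isClosed (mem_ae_iff.2 hμK))
  -- In dimension 0 no `s` satisfies `0 ≤ s < k`, so the Fourier dimension is the default 0 and the
  -- strict inequality `hκ` fails.
  have hk : 0 < k := by
    rcases Nat.eq_zero_or_pos k with rfl | h
    · exfalso
      have h1 : fourierLpDim μ 2 ≤ 0 :=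
        Real.sSup_nonpos fun s hs => by simpa using hs.2.1.le
      simp only [Nat.cast_zero, zero_div] at hκ
      linarith
    · exact h
  obtain ⟨p, hp, hgreat⟩ := exists_isGreatest_decayExponent μ hS hk hκ
  refine ⟨_, hgreat, fun σ hσ0 hσ => ?_⟩
  obtain ⟨p', hp1, hp', hlt⟩ := exists_one_lt_of_lt_decayExponent μ hS hk hp hσ0 hσ
  set N := conjugateDim μ p' + fourierLpDim μ p' - k with hN
  have hN0 : 0 < N := by simp only [hN]; linarith
  have hσ1 : σ < 1 := by
    by_contra! h
    nlinarith [mul_pos hσ0 (by linarith : 0 < p')]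
  -- This is `σ (2p' + N) < N` rearranged: it leaves room for a decay rate `a < N/p'` with `2σ <
  -- a(1-σ)`.
  have h4 : 2 * σ / (1 - σ) < N / p' := by
    rw [div_lt_div_iff₀ (by linarith) (by linarith)]; nlinarith
  obtain ⟨a, ha1, ha2⟩ := exists_between h4
  rw [div_lt_iff₀ (by linarith)] at ha1
  rw [lt_div_iff₀ (by linarith)] at ha2
  have hG : Continuous (gradient f) := (contDiff_gradient hf).continuous
  obtain ⟨A, hA0, hA⟩ := exists_integral_norm_fourierTransform_le μ hS hk hp1 hp' ha2 hG
    fun x hx => exists_antilipschitz_gradient hf (hcurv x hx)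
  have ha0 : 0 < a := by
    by_contra! h
    have : a * (1 - σ) ≤ 0 := mul_nonpos_of_nonpos_of_nonneg h (by linarith)
    linarith
  -- The decay estimate is known only for `|ρ| ≥ 1`; below 1 the trivial bound by 1 suffices, whence
  -- `max A 1`.
  refine norm_fourierTransform_map_le hΦμ hΦ hf hσ0 hσ1 ha1 (A := max A 1)
    (le_max_of_le_left hA0) fun O ρ hρ => ?_
  rcases le_or_gt 1 |ρ| with h | h
  · exact (hA O ρ h).trans (mul_le_mul_of_nonneg_right (le_max_left _ _) (by positivity))
  · have h5 : 1 ≤ |ρ| ^ (-a) := Real.one_le_rpow_of_pos_of_le_one_of_nonpos hρ h.le (by linarith)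
    have h6 : ∫ y, ‖fourierTransform μ (ρ • O (gradient f y))‖ ∂μ ≤ 1 := by
      refine (integral_mono_of_nonneg (Eventually.of_forall fun _ => norm_nonneg _)
        (integrable_const (1 : ℝ))
        (Eventually.of_forall fun y => norm_fourierTransform_le_one μ _)).trans ?_
      simp
    calc _ ≤ (1 : ℝ) * 1 := by simpa using h6
      _ ≤ _ := mul_le_mul (le_max_right _ _) h5 zero_le_one (by positivity)
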